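/- Let $k\ge 1$ and, for $j=1,\dots,k$, let $m_j\ge 1$ and $n_j\ge 2m_j$ be integers. Let $X_{j1},\dots,X_{jn_j}$ ($j=1,\dots,k$) be independent real random variables such that, for each $j$, the variables $X_{j1},\dots,X_{jn_j}$ are identically distributed. Let $h(x_{jl},\ l=1,\dots,m_j,\ j=1,\dots,k)$ be a real-valued Borel measurable function that is symmetric in the $m_j$ arguments of the $j$-th group for each $j$, and let $$U_{\bar n}=\Big\{\prod_{j=1}^k\binom{n_j}{m_j}^{-1}\Big\}\sum h(X_{jl},\ l=i_{j1},\dots,i_{jm_j},\ j=1,\dots,k),$$ where the sum is over all $1\le i_{j1}<\dots<i_{jm_j}\le n_j$, $j=1,\dots,k$. Write $h$ also for the random variable $h(X_{11},\dots,X_{1m_1};\dots;X_{k1},\dots,X_{km_k})$. Assume that $\mathbb E h=0$ and $\sigma^2:=\mathbb E h^2<\infty$. For each $j$ let $$h_j(X_{j1})=\mathbb E(h\mid X_{j1}),\qquad \sigma_j^2=\mathbb E h_j^2(X_{j1}),\qquad \sigma_{\bar n}^2=\sum_{j=1}^k\frac{m_j^2}{n_j}\sigma_j^2,$$ with $\sigma,\sigma_j,\sigma_{\bar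 n}\ge 0$, and assume that $\max_{1\le j\le k}\sigma_j>0$. Let $\Phi$ be the standard normal distribution function. Then for every real $p$ with $2<p\le 3$, $$\sup_{z\in\mathbb R}\big|P(\sigma_{\bar n}^{-1}U_{\bar n}\le z)-\Phi(z)\big|\le\frac{(1+\sqrt2)\,\sigma}{\sigma_{\bar n}}\sum_{j=1}^k\frac{m_j^2}{n_j}+\frac{6.6}{\sigma_{\bar n}^p}\sum_{j=1}^k\frac{m_j^p}{n_j^{p-1}}\,\mathbb E|h_j(X_{j1})|^p,$$ and for every $z\in\mathbb R$, $$\big|P(\sigma_{\bar n}^{-1}U_{\bar n}\le z)-\Phi(z)\big|\le\frac{9\sigma^2}{(1+|z|)^2\sigma_{\bar n}^2}\Big(\sum_{j=1}^k\frac{m_j^2}{n_j}\Big)^2+13.5\,e^{-|z|/3}\,\frac{\sigma}{\sigma_{\bar n}}\sum_{j=1}^k\frac{m_j^2}{n_j}+\frac{C}{(1+|z|)^p\sigma_{\bar n}^p}\sum_{j=1}^k\frac{m_j^p\,\mathbb E|h_j(X_{j1})|^p}{n_j^{p-1}},$$ where $C$ is an absolute constant. (The right-hand sides are $+\infty$ if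 some $\mathbb E|h_j(X_{j1})|^p$ is infinite.) -/

import Mathlib

open MeasureTheory ProbabilityTheory
open scoped ENNReal

noncomputable section

namespace Multisample

variable {Ω : Type*} [MeasurableSpace Ω] {k : ℕ}

/-- A kernel of `k` blocks of real arguments, the `j`-th block having `m j` arguments, is symmetric
if it is invariant under permutations of the arguments inside each block. -/
def IsBlockSymmetric (m : Fin k → ℕ) (h : (∀ j, Fin (m j) → ℝ) → ℝ) : Prop :=
  ∀ (π : ∀ j, Equiv.Perm (Fin (m j))) (x : ∀ j, Fin (m j) → ℝ),
    h (fun j l => x j (π j l)) = h x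

/-- `k` independent samples of i.i.d. real random variables, the `j`-th one of size `n j`:
the observations are `X j i` with `i < n j` (numbered from `0`); the values `X j i` with `n j ≤ i`
play no role. -/
structure IsSample (μ : Measure Ω) (n : Fin k → ℕ) (X : Fin k → ℕ → Ω → ℝ) : Prop where
  measurable : ∀ j, ∀ i < n j, Measurable (X j i)
  indep : iIndepFun (fun (q : Σ j : Fin k, Fin (n j)) => X q.1 q.2) μ
  identDistrib : ∀ j, ∀ i < n j, IdentDistrib (X j i) (X j 0) μ μ

/-- The kernel evaluated at the first `m j` observations of each sample. -/
def kernelAt (m : Fin k → ℕ) (h : (∀ j, Fin (m j) → ℝ) → ℝ) (X : Fin k → ℕ → Ω → ℝ) : Ω → ℝ :=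
  fun ω => h (fun j l => X j l ω)

open Classical in
/-- The multisample U-statistic: the average of the kernel over all choices of strictly increasing
index tuples `i j : Fin (m j) → Fin (n j)`, one for each sample. -/
def uStat (m n : Fin k → ℕ) (h : (∀ j, Fin (m j) → ℝ) → ℝ) (X : Fin k → ℕ → Ω → ℝ) : Ω → ℝ :=
  fun ω => (∏ j, ((n j).choose (m j) : ℝ)⁻¹) *
    ∑ i : (∀ j, Fin (m j) → Fin (n j)) with ∀ j, StrictMono (i j),
      h (fun j l => X j (i j l) ω)

/-- The random variable `h_j(X_{j1}) = E(h(X_{11}, …, X_{1 m_1}; …; X_{k1}, …, X_{k m_k}) | X_{j1})`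
(the first observation of sample `j` is `X j 0`). -/
def proj (μ : Measure Ω) (m : Fin k → ℕ) (h : (∀ j, Fin (m j) → ℝ) → ℝ)
    (X : Fin k → ℕ → Ω → ℝ) (j : Fin k) : Ω → ℝ :=
  μ[kernelAt m h X | MeasurableSpace.comap (X j 0) inferInstance]

/-- `σ = (E h²)^{1/2}`. -/
def sigma (μ : Measure Ω) (m : Fin k → ℕ) (h : (∀ j, Fin (m j) → ℝ) → ℝ)
    (X : Fin k → ℕ → Ω → ℝ) : ℝ :=
  √(∫ ω, (kernelAt m h X ω) ^ 2 ∂μ)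

/-- `σ_j = (E h_j(X_{j1})²)^{1/2}`. -/
def sigmaProj (μ : Measure Ω) (m : Fin k → ℕ) (h : (∀ j, Fin (m j) → ℝ) → ℝ)
    (X : Fin k → ℕ → Ω → ℝ) (j : Fin k) : ℝ :=
  √(∫ ω, (proj μ m h X j ω) ^ 2 ∂μ)

/-- `σ_n`, where `σ_n² = ∑ j, (m_j² / n_j) σ_j²`. -/
def sigmaN (μ : Measure Ω) (m n : Fin k → ℕ) (h : (∀ j, Fin (m j) → ℝ) → ℝ)
    (X : Fin k → ℕ → Ω → ℝ) : ℝ :=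
  √(∑ j, (m j : ℝ) ^ 2 / (n j : ℝ) * sigmaProj μ m h X j ^ 2)

/-- `∑ j, (m_j^p / n_j^{p-1}) E|h_j(X_{j1})|^p`, which may be infinite. -/
def momentSum (μ : Measure Ω) (m n : Fin k → ℕ) (h : (∀ j, Fin (m j) → ℝ) → ℝ)
    (X : Fin k → ℕ → Ω → ℝ) (p : ℝ) : ℝ≥0∞ :=
  ∑ j, ENNReal.ofReal ((m j : ℝ) ^ p / (n j : ℝ) ^ (p - 1)) *
    ∫⁻ ω, ‖proj μ m h X j ω‖ₑ ^ p ∂μ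

/-- `|P(σ_n⁻¹ U_n ≤ z) - Φ(z)|`, with `Φ` the standard normal distribution function. -/
def normalError (μ : Measure Ω) (m n : Fin k → ℕ) (h : (∀ j, Fin (m j) → ℝ) → ℝ)
    (X : Fin k → ℕ → Ω → ℝ) (z : ℝ) : ℝ :=
  |μ.real {ω | (sigmaN μ m n h X)⁻¹ * uStat m n h X ω ≤ z} - cdf (gaussianReal 0 1) z|

end Multisample

end

open MeasureTheory ProbabilityTheory
open scoped ENNReal

noncomputable section

open Filter Topology Set

set_option linter.unusedSectionVars false

/-! The U-statistic is a sum of independent variables plus a small remainder. Subtracting from the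
kernel at each index tuple the projections on the observations it uses leaves a residual with
conditional mean zero given any single observation of the tuple. Averaging over the tuples gives
`σ_n⁻¹ U_n = W + T`, where `W` is a sum of independent centred summands with total variance one
(`sum_summand_add_remainder`, `sum_integral_summand_sq`) and `T` collects the residuals. Residuals
of tuples sharing at most one observation are orthogonal, each has second moment at most `σ²`, and
the proportion of pairs of tuples sharing two observations is at most `M²`, with `M = ∑ m_j²/n_j`.
With `a = σ M / σ_n` this yields `E T² ≤ a²`. The part `T_q` of `T` coming from the tuples avoiding
`q` is, jointly with the other summands, independent of the summand at `q`, and the same counting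
gives `∑ E (T - T_q)² ≤ a²`. `IsPerturbedSum` records exactly these facts; everything else is normal
approximation for such sums.

Uniform bound. The events `W + T ≤ z` and `W ≤ z` differ only when `W` lies in a random interval of
length `|T|` with endpoint `z`. Testing `W` against a piecewise linear function of slope one around
that interval (`measureReal_mul_le_of_randomInterval`) bounds this probability by `E|WT| + ∑ E|ξ_q
(T - T_q)| + 2b`, where `b = ∑ E ξ² min(1,|ξ|)`; by Cauchy–Schwarz this is at most `2a + 2b`.
Stein's method bounds the error for `W` itself by `4.6 b` (`abs_measureReal_sub_Phi_le`), provided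
`b ≤ 1/6.6`; otherwise `6.6 b ≥ 1` and there is nothing to prove. The result `2a + 6.6b` suffices
because `2 ≤ 1 + √2`.

Nonuniform bound. For `|z| ≤ 2` the uniform bound is enough, and negation reduces the rest to `z ≥
2`. If the moments are not small, Chebyshev for `T` and a Rosenthal-type moment bound for `W` are
enough. Otherwise `T` is cut off at `(z+1)/3`, Chebyshev's inequality paying for this with the term
in `a²`, and the summands are truncated at `1/2`, so that exponential moments exist. Concentration
weighted by `exp (w/2)` gives the factor `exp (-z/3)` in front of `a`, and
`abs_measureReal_sub_Phi_le_exp` is the matching Stein bound. The event that some summand is large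
is controlled by moments of order `p`. -/

namespace NormalApprox

/-! ### The Gaussian tail, the Mills ratio and the solution of Stein's equation -/

/-- The unnormalised standard Gaussian tail. -/
def gtail (x : ℝ) : ℝ := ∫ u in Ioi x, Real.exp (-u ^ 2 / 2)

lemma integrable_exp_neg_sq_half : Integrable (fun u : ℝ => Real.exp (-u ^ 2 / 2)) := by
  have h := integrable_exp_neg_mul_sq (b := 1 / 2) (by norm_num)
  refine h.congr (Eventually.of_forall fun u => ?_)
  simp only
  congr 1; ring

lemma integral_exp_neg_sq_half : ∫ u : ℝ, Real.exp (-u ^ 2 / 2) = √(2 * Real.pi) := by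
  have h := integral_gaussian (1 / 2)
  rw [show Real.pi / (1 / 2) = 2 * Real.pi by ring] at h
  rw [← h]
  refine integral_congr_ae (Eventually.of_forall fun u => ?_)
  simp only
  congr 1; ring

lemma gtail_pos (x : ℝ) : 0 < gtail x := by
  unfold gtail
  rw [setIntegral_pos_iff_support_of_nonneg_ae]
  · have : Function.support (fun u : ℝ => Real.exp (-u ^ 2 / 2)) = univ := by
      ext u; simp [(Real.exp_pos _).ne']
    rw [this]; simp
  · exact Eventually.of_forall fun u => (Real.exp_pos _).le
  · exact integrable_exp_neg_sq_half.integrableOn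

lemma gtail_neg (x : ℝ) : gtail (-x) = √(2 * Real.pi) - gtail x := by
  have h1 : gtail (-x) = ∫ u in Iic x, Real.exp (-u ^ 2 / 2) := by
    unfold gtail
    rw [← integral_comp_neg_Iic]
    simp
  have h2 := intervalIntegral.integral_Iic_add_Ioi (b := x)
    (integrable_exp_neg_sq_half.integrableOn (s := Iic x))
    (integrable_exp_neg_sq_half.integrableOn (s := Ioi x))
  rw [integral_exp_neg_sq_half] at h2
  rw [h1]; unfold gtail; linarith

lemma hasDerivAt_gtail (x : ℝ) : HasDerivAt gtail (-Real.exp (-x ^ 2 / 2)) x := by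
  have hc : Continuous (fun u : ℝ => Real.exp (-u ^ 2 / 2)) := by fun_prop
  have h0 : gtail = fun x => gtail 0 - ∫ u in (0 : ℝ)..x, Real.exp (-u ^ 2 / 2) := by
    ext y
    have := intervalIntegral.integral_interval_add_Ioi (a := 0) (b := y)
      (integrable_exp_neg_sq_half.integrableOn (s := Ioi 0))
      (integrable_exp_neg_sq_half.integrableOn (s := Ioi y))
    unfold gtail; linarith
  rw [h0]
  have := (intervalIntegral.integral_hasDerivAt_right (hc.intervalIntegrable 0 x)
    hc.stronglyMeasurable.stronglyMeasurableAtFilter hc.continuousAt)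
  simpa using this.const_sub (gtail 0)

lemma tendsto_exp_neg_sq_half : Tendsto (fun u : ℝ => Real.exp (-u ^ 2 / 2)) atTop (𝓝 0) := by
  refine Real.tendsto_exp_atBot.comp ?_
  have : Tendsto (fun u : ℝ => u ^ 2 / 2) atTop atTop :=
    (tendsto_pow_atTop (by norm_num)).atTop_div_const (by norm_num)
  refine (tendsto_neg_atTop_atBot.comp this).congr fun u => ?_
  simp only [Function.comp]; ring

lemma hasDerivAt_exp_neg_sq_half (x : ℝ) :
    HasDerivAt (fun u : ℝ => Real.exp (-u ^ 2 / 2)) (-(x * Real.exp (-x ^ 2 / 2))) x := by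
  have h : HasDerivAt (fun u : ℝ => -u ^ 2 / 2) (-x) x := by
    have := ((hasDerivAt_pow 2 x).neg).div_const 2
    refine this.congr_deriv ?_
    simp; ring
  refine h.exp.congr_deriv ?_
  ring

lemma tendsto_gtail : Tendsto gtail atTop (𝓝 0) := by
  have h : Tendsto (fun x => gtail 0 - ∫ u in (0 : ℝ)..x, Real.exp (-u ^ 2 / 2)) atTop
      (𝓝 (gtail 0 - ∫ u in Ioi (0 : ℝ), Real.exp (-u ^ 2 / 2))) :=
    tendsto_const_nhds.sub (intervalIntegral_tendsto_integral_Ioi 0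
      integrable_exp_neg_sq_half.integrableOn tendsto_id)
  have h1 : gtail 0 - ∫ u in Ioi (0 : ℝ), Real.exp (-u ^ 2 / 2) = 0 := by simp [gtail]
  rw [h1] at h
  refine h.congr fun y => ?_
  have := intervalIntegral.integral_interval_add_Ioi (a := 0) (b := y)
      (integrable_exp_neg_sq_half.integrableOn (s := Ioi 0))
      (integrable_exp_neg_sq_half.integrableOn (s := Ioi y))
  unfold gtail; linarith

/-- A differentiable function tending to `0` at infinity with nonpositive derivative on a
right half-line is nonnegative there. -/
lemma nonneg_of_deriv_nonpos_of_tendsto {f f' : ℝ → ℝ} {a : ℝ}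
    (hf : ∀ x, HasDerivAt f (f' x) x) (hf' : ∀ x, a ≤ x → f' x ≤ 0)
    (hl : Tendsto f atTop (𝓝 0)) : 0 ≤ f a := by
  have hanti : AntitoneOn f (Ici a) := by
    refine antitoneOn_of_deriv_nonpos (convex_Ici a)
      (fun x _ => (hf x).continuousAt.continuousWithinAt)
      (fun x _ => (hf x).differentiableAt.differentiableWithinAt) fun x hx => ?_
    rw [interior_Ici] at hx
    rw [(hf x).deriv]
    exact hf' x (le_of_lt hx)
  refine le_of_tendsto hl ?_
  filter_upwards [eventually_ge_atTop a] with x hx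
  exact hanti self_mem_Ici hx hx

/-- With the factor `x > 0` frozen, `exp (-y²/2) - x * gtail y` decreases to `0` on `y ≥ x`, since
its derivative is `(x - y) exp (-y²/2)`. -/
lemma mul_gtail_le (x : ℝ) : x * gtail x ≤ Real.exp (-x ^ 2 / 2) := by
  rcases le_or_gt x 0 with hx | hx
  · exact (mul_nonpos_of_nonpos_of_nonneg hx (gtail_pos x).le).trans (Real.exp_pos _).le
  have hd : ∀ y, HasDerivAt (fun y => Real.exp (-y ^ 2 / 2) - x * gtail y)
      (-(y * Real.exp (-y ^ 2 / 2)) - x * -Real.exp (-y ^ 2 / 2)) y := fun y =>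
    (hasDerivAt_exp_neg_sq_half y).sub ((hasDerivAt_gtail y).const_mul x)
  have := nonneg_of_deriv_nonpos_of_tendsto (a := x) hd (fun y hy => by
    have := Real.exp_pos (-y ^ 2 / 2)
    nlinarith) (by simpa using tendsto_exp_neg_sq_half.sub (tendsto_gtail.const_mul x))
  linarith

/-- The difference `gtail y - y/(1+y²) exp (-y²/2)` decreases to `0` on the whole line: its
derivative is `-2/(1+y²)² exp (-y²/2)`. This is what makes `x * mills x` monotone. -/
lemma le_one_add_sq_mul_gtail (x : ℝ) : x * Real.exp (-x ^ 2 / 2) ≤ (1 + x ^ 2) * gtail x := by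
  have hpos : ∀ y : ℝ, 0 < 1 + y ^ 2 := fun y => by positivity
  have hd : ∀ y, HasDerivAt (fun y => gtail y - y / (1 + y ^ 2) * Real.exp (-y ^ 2 / 2))
      (-(2 / (1 + y ^ 2) ^ 2) * Real.exp (-y ^ 2 / 2)) y := fun y => by
    have h1 : HasDerivAt (fun y : ℝ => 1 + y ^ 2) (2 * y) y := by
      simpa using (hasDerivAt_pow 2 y).const_add 1
    have h2 := (hasDerivAt_id y).div h1 (hpos y).ne'
    refine ((hasDerivAt_gtail y).sub (h2.mul (hasDerivAt_exp_neg_sq_half y))).congr_deriv ?_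
    have := (hpos y).ne'
    simp only [id, Pi.div_apply]
    field_simp
    ring
  have hl : Tendsto (fun y : ℝ => y / (1 + y ^ 2) * Real.exp (-y ^ 2 / 2)) atTop (𝓝 0) := by
    refine squeeze_zero_norm (a := fun u => Real.exp (-u ^ 2 / 2)) (fun y => ?_)
      tendsto_exp_neg_sq_half
    rw [norm_mul, Real.norm_eq_abs, Real.norm_eq_abs, abs_of_pos (Real.exp_pos _)]
    refine mul_le_of_le_one_left (Real.exp_pos _).le ?_
    rw [abs_div, abs_of_pos (hpos y), div_le_one (hpos y)]
    nlinarith [sq_abs y, abs_nonneg y, sq_nonneg (|y| - 1)]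
  have := nonneg_of_deriv_nonpos_of_tendsto (a := x) hd (fun y _ => by
    have h1 := Real.exp_pos (-y ^ 2 / 2)
    have h2 : 0 < 2 / (1 + y ^ 2) ^ 2 := by have := hpos y; positivity
    nlinarith) (by simpa using tendsto_gtail.sub hl)
  have h3 : x / (1 + x ^ 2) * Real.exp (-x ^ 2 / 2) * (1 + x ^ 2) = x * Real.exp (-x ^ 2 / 2) := by
    have := (hpos x).ne'
    field_simp
  nlinarith [hpos x]

/-- The Mills ratio. -/
def mills (x : ℝ) : ℝ := Real.exp (x ^ 2 / 2) * gtail x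

lemma exp_mul_exp_neg_sq_half (x : ℝ) : Real.exp (x ^ 2 / 2) * Real.exp (-x ^ 2 / 2) = 1 := by
  rw [← Real.exp_add]; simp; ring

lemma mills_pos (x : ℝ) : 0 < mills x := mul_pos (Real.exp_pos _) (gtail_pos x)

lemma gtail_eq_mills (x : ℝ) : gtail x = Real.exp (-x ^ 2 / 2) * mills x := by
  rw [mills, ← mul_assoc, mul_comm (Real.exp (-x ^ 2 / 2)), exp_mul_exp_neg_sq_half, one_mul]

lemma mul_mills_le_one (x : ℝ) : x * mills x ≤ 1 := by
  have h1 := mul_le_mul_of_nonneg_left (mul_gtail_le x) (Real.exp_pos (x ^ 2 / 2)).le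
  rw [exp_mul_exp_neg_sq_half] at h1
  unfold mills; linarith

lemma le_one_add_sq_mul_mills (x : ℝ) : x ≤ (1 + x ^ 2) * mills x := by
  have h1 := mul_le_mul_of_nonneg_left (le_one_add_sq_mul_gtail x) (Real.exp_pos (x ^ 2 / 2)).le
  have h2 := exp_mul_exp_neg_sq_half x
  have h3 : Real.exp (x ^ 2 / 2) * (x * Real.exp (-x ^ 2 / 2)) = x := by
    rw [mul_left_comm, h2, mul_one]
  rw [h3] at h1
  unfold mills; linarith

lemma hasDerivAt_mills (x : ℝ) : HasDerivAt mills (x * mills x - 1) x := by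
  have h : HasDerivAt (fun u : ℝ => u ^ 2 / 2) x x := by
    refine ((hasDerivAt_pow 2 x).div_const 2).congr_deriv ?_
    simp
  refine (h.exp.mul (hasDerivAt_gtail x)).congr_deriv ?_
  have h2 := exp_mul_exp_neg_sq_half x
  unfold mills
  linear_combination -h2

lemma antitone_mills : Antitone mills :=
  antitone_of_deriv_nonpos (fun x => (hasDerivAt_mills x).differentiableAt) fun x => by
    rw [(hasDerivAt_mills x).deriv]; linarith [mul_mills_le_one x]

lemma monotone_mul_mills : Monotone fun x => x * mills x :=
  monotone_of_deriv_nonneg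
    (fun x => ((hasDerivAt_id x).mul (hasDerivAt_mills x)).differentiableAt) fun x => by
    have h := ((hasDerivAt_id x).mul (hasDerivAt_mills x)).deriv
    have h' : deriv (fun x => x * mills x) x = _ := h
    rw [h']
    simp only [id]
    linarith [le_one_add_sq_mul_mills x]

lemma mills_zero : mills 0 = √(2 * Real.pi) / 2 := by
  have := gtail_neg 0
  rw [neg_zero] at this
  simp only [mills]; norm_num; rw [← Real.sqrt_mul (by norm_num)]; linarith

lemma sqrt_two_pi_pos : 0 < √(2 * Real.pi) := by have := Real.pi_pos; positivity

lemma sqrt_two_pi_le : √(2 * Real.pi) ≤ 2.52 := by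
  rw [show (2.52 : ℝ) = √(2.52 ^ 2) by rw [Real.sqrt_sq (by norm_num)]]
  exact Real.sqrt_le_sqrt (by have := Real.pi_lt_d2; norm_num at *; linarith)

/-- The standard normal distribution function. -/
abbrev Phi (z : ℝ) : ℝ := cdf (gaussianReal 0 1) z

lemma one_sub_Phi (z : ℝ) : 1 - Phi z = gtail z / √(2 * Real.pi) := by
  have h1 : (gaussianReal 0 1).real (Ioi z) = 1 - Phi z := by
    rw [Phi, cdf_eq_real, ← probReal_compl_eq_one_sub measurableSet_Iic, compl_Iic]
  rw [← h1, measureReal_def, gaussianReal_apply_eq_integral _ one_ne_zero,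
    ENNReal.toReal_ofReal (integral_nonneg fun x => gaussianPDFReal_nonneg _ _ _)]
  unfold gtail gaussianPDFReal
  rw [integral_const_mul]
  simp
  ring

lemma Phi_eq (z : ℝ) : Phi z = gtail (-z) / √(2 * Real.pi) := by
  have := one_sub_Phi z
  rw [gtail_neg, sub_div, div_self sqrt_two_pi_pos.ne']
  linarith

lemma Phi_nonneg (z : ℝ) : 0 ≤ Phi z := cdf_nonneg _ _

lemma Phi_le_one (z : ℝ) : Phi z ≤ 1 := cdf_le_one _ _

lemma Phi_neg (z : ℝ) : Phi (-z) = 1 - Phi z := by rw [Phi_eq, one_sub_Phi, neg_neg]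

lemma one_sub_Phi_le {z : ℝ} (hz : 0 ≤ z) : 1 - Phi z ≤ Real.exp (-z ^ 2 / 2) / 2 := by
  rw [one_sub_Phi, gtail_eq_mills, div_le_iff₀ sqrt_two_pi_pos]
  have := antitone_mills hz
  rw [mills_zero] at this
  have h2 := Real.exp_pos (-z ^ 2 / 2)
  nlinarith

/-- This is `Φ(1-Φ) ≤ exp (-z²/2)/4`, which gives the sharp supremum `√(2π)/4` of the Stein
solution. The difference `D` of the two sides vanishes at `0` and at infinity, and `D' = exp (-x²/2)
b` with `b` convex on the half-line and `b 0 = 0`. So `D` first decreases and then increases, and is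
never positive. -/
lemma gtail_mul_gtail_neg_le_of_nonneg {z : ℝ} (hz : 0 ≤ z) :
    gtail z * gtail (-z) ≤ Real.pi / 2 * Real.exp (-z ^ 2 / 2) := by
  obtain ⟨s, hs⟩ : ∃ s, s = √(2 * Real.pi) := ⟨_, rfl⟩
  set b : ℝ → ℝ := fun x => 2 * gtail x - s + Real.pi / 2 * x with hb
  have hbd : ∀ x, HasDerivAt b (-2 * Real.exp (-x ^ 2 / 2) + Real.pi / 2) x := fun x => by
    refine ((((hasDerivAt_gtail x).const_mul 2).sub_const s).add
      ((hasDerivAt_id x).const_mul (Real.pi / 2))).congr_deriv ?_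
    ring
  have hb0 : b 0 = 0 := by
    have := gtail_neg 0
    rw [neg_zero] at this
    rw [← hs] at this; simp only [hb, mul_zero, add_zero]; linarith
  have hconv : ConvexOn ℝ (Ici 0) b := by
    refine MonotoneOn.convexOn_of_deriv (convex_Ici 0)
      (fun x _ => (hbd x).continuousAt.continuousWithinAt)
      (fun x _ => (hbd x).differentiableAt.differentiableWithinAt) ?_
    intro x hx y hy hxy
    rw [interior_Ici] at hx hy
    rw [(hbd x).deriv, (hbd y).deriv]
    have : Real.exp (-y ^ 2 / 2) ≤ Real.exp (-x ^ 2 / 2) := by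
      apply Real.exp_le_exp.2
      have : x ^ 2 ≤ y ^ 2 := pow_le_pow_left₀ (le_of_lt hx) hxy 2
      linarith
    linarith
  set D : ℝ → ℝ := fun x => gtail x * (s - gtail x) - Real.pi / 2 * Real.exp (-x ^ 2 / 2) with hD
  have hDd : ∀ x, HasDerivAt D (Real.exp (-x ^ 2 / 2) * b x) x := fun x => by
    refine (((hasDerivAt_gtail x).mul ((hasDerivAt_gtail x).const_sub s)).sub
      ((hasDerivAt_exp_neg_sq_half x).const_mul (Real.pi / 2))).congr_deriv ?_
    simp only [hb]; ring
  have hDl : Tendsto D atTop (𝓝 0) := by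
    simpa using (tendsto_gtail.mul (tendsto_gtail.const_sub s)).sub
      (tendsto_exp_neg_sq_half.const_mul (Real.pi / 2))
  have hD0 : D 0 = 0 := by
    have := gtail_neg 0
    rw [neg_zero, ← hs] at this
    have h2 : gtail 0 = s / 2 := by linarith
    have h3 : s ^ 2 = 2 * Real.pi := hs ▸ Real.sq_sqrt (by have := Real.pi_pos; positivity)
    simp only [hD, h2]
    norm_num
    nlinarith
  have key : D z ≤ 0 := by
    rcases eq_or_lt_of_le hz with rfl | hz0
    · exact hD0.le
    -- By convexity and `b 0 = 0`, `b z ≤ 0` forces `b ≤ 0` on `[0, z]`, so `D` has decreased from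
    -- `D 0 = 0`; and `b z > 0` forces `b > 0` beyond `z`, so `D` increases from `D z` to its limit
    -- `0`.
    rcases le_or_gt (b z) 0 with h | h
    · have hanti : AntitoneOn D (Icc 0 z) := by
        refine antitoneOn_of_deriv_nonpos (convex_Icc 0 z)
          (fun x _ => (hDd x).continuousAt.continuousWithinAt)
          (fun x _ => (hDd x).differentiableAt.differentiableWithinAt) fun x hx => ?_
        rw [interior_Icc] at hx
        rw [(hDd x).deriv]
        refine mul_nonpos_of_nonneg_of_nonpos (Real.exp_pos _).le ?_
        have := hconv.2 (show (0 : ℝ) ∈ Ici 0 from self_mem_Ici)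
          (show z ∈ Ici 0 from hz) (show 0 ≤ 1 - x / z by rw [sub_nonneg, div_le_one hz0]; exact hx.2.le)
          (show 0 ≤ x / z from div_nonneg hx.1.le hz) (by ring)
        simp only [smul_eq_mul, mul_zero, zero_add, hb0] at this
        rw [div_mul_cancel₀ _ hz0.ne'] at this
        exact this.trans (mul_nonpos_of_nonneg_of_nonpos (div_nonneg hx.1.le hz) h)
      have := hanti (left_mem_Icc.2 hz) (right_mem_Icc.2 hz) hz
      linarith
    · have := nonneg_of_deriv_nonpos_of_tendsto (f := fun x => -D x) (a := z)
        (fun x => (hDd x).neg) (fun x hx => ?_) (by simpa using hDl.neg)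
      · linarith
      · have hx0 : 0 < x := hz0.trans_le hx
        have := hconv.2 (show (0 : ℝ) ∈ Ici 0 from self_mem_Ici)
          (show x ∈ Ici 0 from hx0.le) (show 0 ≤ 1 - z / x by rw [sub_nonneg, div_le_one hx0]; exact hx)
          (show 0 ≤ z / x from div_nonneg hz hx0.le) (by ring)
        simp only [smul_eq_mul, mul_zero, zero_add, hb0] at this
        rw [div_mul_cancel₀ _ hx0.ne'] at this
        have h5 : 0 < z / x * b x := h.trans_le this
        have h6 : 0 < b x := pos_of_mul_pos_right h5 (div_nonneg hz hx0.le)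
        have := Real.exp_pos (-x ^ 2 / 2)
        nlinarith
  have := gtail_neg z
  rw [← hs] at this
  rw [this]
  simp only [hD] at key
  linarith

lemma gtail_mul_gtail_neg_le (z : ℝ) :
    gtail z * gtail (-z) ≤ Real.pi / 2 * Real.exp (-z ^ 2 / 2) := by
  rcases le_total 0 z with h | h
  · exact gtail_mul_gtail_neg_le_of_nonneg h
  · have := gtail_mul_gtail_neg_le_of_nonneg (neg_nonneg.2 h)
    rw [neg_neg, neg_sq] at this
    linarith

/-! ### Stein's equation for a half-line: the solution, its derivative and their bounds. -/

/-- The bounded solution of Stein's equation for the half-line `(-∞, z]`. -/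
def stein (z w : ℝ) : ℝ := if w ≤ z then (1 - Phi z) * mills (-w) else Phi z * mills w

/-- The indicator of `(-∞, z]`, centred under the standard normal law. -/
def centredInd (z w : ℝ) : ℝ := (if w ≤ z then 1 else 0) - Phi z

/-- The derivative of `stein z` off the point `z`. -/
def steinDeriv (z w : ℝ) : ℝ := w * stein z w + centredInd z w

/-- The two branches of `stein z` agree at `z`; this gives continuity and lets bounds pass from one
branch to the other. -/
lemma one_sub_Phi_mul_mills (z : ℝ) : (1 - Phi z) * mills (-z) = Phi z * mills z := by
  rw [one_sub_Phi, Phi_eq, mills, mills, neg_sq]; ring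

lemma stein_nonneg (z w : ℝ) : 0 ≤ stein z w := by
  unfold stein
  split_ifs
  · exact mul_nonneg (by linarith [Phi_le_one z]) (mills_pos _).le
  · exact mul_nonneg (Phi_nonneg z) (mills_pos _).le

/-- The Mills ratio is antitone, so `stein z` increases up to `z` and decreases afterwards. Its
value at `z` is at most `√(2π)/4 < 0.63` by the product bound for the two tails. -/
lemma stein_le (z w : ℝ) : stein z w ≤ 0.63 := by
  have h0 : Phi z * mills z ≤ 0.63 := by
    rw [Phi_eq, mills, div_mul_eq_mul_div, div_le_iff₀ sqrt_two_pi_pos]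
    have h1 := mul_le_mul_of_nonneg_left (gtail_mul_gtail_neg_le z) (Real.exp_pos (z ^ 2 / 2)).le
    rw [mul_left_comm (Real.exp (z ^ 2 / 2)) (Real.pi / 2), exp_mul_exp_neg_sq_half, mul_one] at h1
    have h3 : √(2 * Real.pi) ^ 2 = 2 * Real.pi :=
      Real.sq_sqrt (by have := Real.pi_pos; positivity)
    nlinarith [sqrt_two_pi_le, sqrt_two_pi_pos]
  unfold stein
  split_ifs with h
  · refine le_trans ?_ ((one_sub_Phi_mul_mills z).le.trans h0)
    exact mul_le_mul_of_nonneg_left (antitone_mills (neg_le_neg h)) (by linarith [Phi_le_one z])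
  · exact le_trans (mul_le_mul_of_nonneg_left (antitone_mills (not_le.1 h).le) (Phi_nonneg z)) h0

/-- On each side of `z` the function is a nonnegative multiple of `x * mills x` or of its reflection
`-(-x) * mills (-x)`, both monotone, and the two pieces join at `z`. -/
lemma monotone_mul_stein (z : ℝ) : Monotone fun w => w * stein z w := by
  have hP1 : 0 ≤ 1 - Phi z := by linarith [Phi_le_one z]
  have hP := Phi_nonneg z
  have hz : z * ((1 - Phi z) * mills (-z)) = z * (Phi z * mills z) := by
    rw [one_sub_Phi_mul_mills]
  intro a b hab
  have hm := monotone_mul_mills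
  simp only [stein]
  split_ifs with h1 h2 h2
  · have := mul_le_mul_of_nonneg_left (hm (neg_le_neg hab)) hP1
    simp only at this; linarith
  · have e1 := mul_le_mul_of_nonneg_left (hm (neg_le_neg h1)) hP1
    have e2 := mul_le_mul_of_nonneg_left (hm (not_le.1 h2).le) hP
    simp only at e1 e2; linarith
  · exact absurd (hab.trans h2) h1
  · have := mul_le_mul_of_nonneg_left (hm hab) hP
    simp only at this; linarith

/-- By monotonicity it is enough to look far to the right, where `x * mills x ≤ 1` applies. The
point `max w (z + 1)` is merely some point not below `w` and strictly beyond `z`, hence on the right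
branch. -/
lemma mul_stein_le (z w : ℝ) : w * stein z w ≤ Phi z := by
  have h1 : max w (z + 1) * stein z (max w (z + 1)) ≤ Phi z := by
    have h2 : z < max w (z + 1) := lt_max_of_lt_right (by linarith)
    rw [stein, if_neg (not_le.2 h2)]
    have := mul_mills_le_one (max w (z + 1))
    nlinarith [Phi_nonneg z]
  exact (monotone_mul_stein z (le_max_left w (z + 1))).trans h1

lemma le_mul_stein (z w : ℝ) : Phi z - 1 ≤ w * stein z w := by
  have h1 : Phi z - 1 ≤ min w z * stein z (min w z) := by
    rw [stein, if_pos (min_le_right w z)]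
    have := mul_mills_le_one (-min w z)
    nlinarith [Phi_le_one z]
  exact h1.trans (monotone_mul_stein z (min_le_left w z))

lemma abs_steinDeriv_le_one (z w : ℝ) : |steinDeriv z w| ≤ 1 := by
  rw [abs_le]
  have h1 := mul_stein_le z w
  have h2 := le_mul_stein z w
  have h3 := Phi_nonneg z
  have h4 := Phi_le_one z
  unfold steinDeriv centredInd
  split_ifs <;> constructor <;> linarith

lemma continuous_stein (z : ℝ) : Continuous (stein z) := by
  have hm : Continuous mills := continuous_iff_continuousAt.2 fun x =>
    (hasDerivAt_mills x).continuousAt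
  refine Continuous.if_le (by fun_prop) (by fun_prop) continuous_id continuous_const ?_
  intro x hx
  rw [hx, one_sub_Phi_mul_mills]

lemma hasDerivAt_stein {z w : ℝ} (h : w ≠ z) : HasDerivAt (stein z) (steinDeriv z w) w := by
  rcases lt_or_gt_of_ne h with h | h
  · have h1 : HasDerivAt (fun w => (1 - Phi z) * mills (-w)) (steinDeriv z w) w := by
      have h3 := (HasDerivAt.scomp w (hasDerivAt_mills (-w)) (hasDerivAt_neg w))
      refine (h3.const_mul (1 - Phi z)).congr_deriv ?_
      simp only [steinDeriv, centredInd, stein, if_pos h.le, smul_eq_mul]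
      ring
    refine h1.congr_of_eventuallyEq ?_
    filter_upwards [eventually_lt_nhds h] with x hx
    rw [stein, if_pos hx.le]
  · have h1 : HasDerivAt (fun w => Phi z * mills w) (steinDeriv z w) w := by
      refine ((hasDerivAt_mills w).const_mul (Phi z)).congr_deriv ?_
      simp only [steinDeriv, centredInd, stein, if_neg (not_le.2 h)]
      ring
    refine h1.congr_of_eventuallyEq ?_
    filter_upwards [eventually_gt_nhds h] with x hx
    rw [stein, if_neg (not_le.2 hx)]

lemma measurable_centredInd (z : ℝ) : Measurable (centredInd z) :=
  (Measurable.ite measurableSet_Iic measurable_const measurable_const).sub_const _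

lemma measurable_steinDeriv (z : ℝ) : Measurable (steinDeriv z) :=
  (measurable_id.mul (continuous_stein z).measurable).add (measurable_centredInd z)

lemma intervalIntegrable_of_bounded {f : ℝ → ℝ} (hf : Measurable f) {C : ℝ}
    (hC : ∀ x, |f x| ≤ C) (a b : ℝ) : IntervalIntegrable f volume a b :=
  (intervalIntegrable_const (c := C)).mono_fun hf.aestronglyMeasurable
    (Eventually.of_forall fun x => by
      simpa using (hC x).trans (le_abs_self C))

lemma integral_steinDeriv (z a b : ℝ) :
    ∫ t in a..b, steinDeriv z t = stein z b - stein z a :=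
  integral_eq_of_hasDerivAt_off_countable (stein z) (steinDeriv z) (countable_singleton z)
    (continuous_stein z).continuousOn (fun _ hx => hasDerivAt_stein hx.2)
    (intervalIntegrable_of_bounded (measurable_steinDeriv z) (abs_steinDeriv_le_one z) a b)

lemma stein_add_sub (z y x : ℝ) :
    stein z (y + x) - stein z y = ∫ t in (0 : ℝ)..x, steinDeriv z (y + t) := by
  rw [intervalIntegral.integral_comp_add_left (fun t => steinDeriv z t), integral_steinDeriv,
    add_zero]

lemma abs_stein_sub_le (z a b : ℝ) : |stein z b - stein z a| ≤ |b - a| := by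
  rw [← integral_steinDeriv]
  simpa using intervalIntegral.norm_integral_le_of_norm_le_const (C := 1)
    (f := steinDeriv z) (a := a) (b := b) (fun t _ => abs_steinDeriv_le_one z t)

/-- The values of `w * stein z w` lie in an interval of length one, so only `u ≤ z < v` is delicate.
There the indicator contributes one, but monotonicity makes the other term nonpositive. The bound
`|steinDeriv| ≤ 1` alone would give only `2`. -/
lemma steinDeriv_sub_le_one (z u v : ℝ) : steinDeriv z u - steinDeriv z v ≤ 1 := by
  have h1 := mul_stein_le z u
  have h2 := le_mul_stein z v
  have hm := monotone_mul_stein z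
  unfold steinDeriv centredInd
  split_ifs with h3 h4 h4
  · linarith
  · have := hm (h3.trans (not_le.1 h4).le)
    simp only at this; linarith
  · linarith
  · linarith

/-- Increments of `w ↦ w f_z(w)` on the right are controlled linearly. -/
lemma mul_stein_sub_le (z w u v : ℝ) (h : v ≤ u) :
    (w + u) * stein z (w + u) - (w + v) * stein z (w + v) ≤
      (|w| + 0.63) * (max u 0 + max (-v) 0) := by
  have hf := abs_stein_sub_le z (w + v) (w + u)
  -- The increment splits as `w (f(w+u) - f(w+v)) + u f(w+u) - v f(w+v)`: the Lipschitz bound serves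
  -- the first term, the supremum `0.63` the other two.
  rw [show w + u - (w + v) = u - v by ring, abs_of_nonneg (sub_nonneg.2 h)] at hf
  have h1 : w * (stein z (w + u) - stein z (w + v)) ≤ |w| * (u - v) := by
    refine (le_abs_self _).trans ?_
    rw [abs_mul]
    exact mul_le_mul_of_nonneg_left hf (abs_nonneg w)
  have h2 : u - v ≤ max u 0 + max (-v) 0 := by
    have := le_max_left u 0; have := le_max_left (-v) 0; linarith
  have h3 : u * stein z (w + u) ≤ 0.63 * max u 0 := by
    have := stein_le z (w + u); have := stein_nonneg z (w + u)
    have := le_max_left u 0; have := le_max_right u 0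
    nlinarith
  have h4 : -v * stein z (w + v) ≤ 0.63 * max (-v) 0 := by
    have := stein_le z (w + v); have := stein_nonneg z (w + v)
    have := le_max_left (-v) 0; have := le_max_right (-v) 0
    nlinarith
  have h5 := mul_le_mul_of_nonneg_left h2 (abs_nonneg w)
  nlinarith

/-! #### Exponential bounds for the solution -/

lemma mills_neg_le (w : ℝ) : mills (-w) ≤ 2.52 * Real.exp (w ^ 2 / 2) := by
  rw [mills, neg_sq, gtail_neg, mul_comm]
  refine mul_le_mul_of_nonneg_right ?_ (Real.exp_pos _).le
  linarith [gtail_pos w, sqrt_two_pi_le]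

/-- For `w > z/2` the right-hand exponentials multiply to at least one. For `|w| ≤ z/2` the Gaussian
factor of `1 - Φ z` beats `exp (w²/2) ≤ exp (z²/8)`, and the remaining `exp (-3z²/8)` is at most
`exp (1/6 - z/2)` by completing the square. For `w < -z/2` the Mills ratio at `-w` is bounded. -/
lemma stein_le_exp {z : ℝ} (hz : 0 ≤ z) (w : ℝ) :
    stein z w ≤ 2 * Real.exp (-z / 2) * Real.exp |w| := by
  have he : (1.19 : ℝ) ≥ Real.exp (1 / 6) := by
    have h := Real.exp_bound' (x := 1 / 6) (by norm_num) (by norm_num) (n := 4) (by norm_num)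
    norm_num [Finset.sum_range_succ, Nat.factorial] at h
    norm_num; linarith
  rcases le_or_gt w (z / 2) with h | h
  · have hP1 : 0 ≤ 1 - Phi z := by linarith [Phi_le_one z]
    rw [stein, if_pos (by linarith)]
    have h1 := one_sub_Phi_le hz
    have hm := mills_neg_le |w|
    have hma : mills (-w) ≤ mills (-|w|) := antitone_mills (neg_le_neg (le_abs_self w))
    rcases le_or_gt |w| (z / 2) with h' | h'
    · have h3 : Real.exp (-z ^ 2 / 2) * Real.exp (|w| ^ 2 / 2) ≤
          Real.exp (1 / 6) * Real.exp (-z / 2) := by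
        rw [← Real.exp_add, ← Real.exp_add]
        apply Real.exp_le_exp.2
        nlinarith [abs_nonneg w, sq_nonneg (z - 2 / 3)]
      have h4 : 1 ≤ Real.exp |w| := Real.one_le_exp (abs_nonneg w)
      calc (1 - Phi z) * mills (-w)
          ≤ (Real.exp (-z ^ 2 / 2) / 2) * (2.52 * Real.exp (|w| ^ 2 / 2)) := by
            refine mul_le_mul h1 (hma.trans hm) (mills_pos _).le (by positivity)
        _ ≤ 2 * Real.exp (-z / 2) * 1 := by
            have := Real.exp_pos (-z / 2)
            nlinarith
        _ ≤ _ := by gcongr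
    · have hw : w ≤ 0 := by
        by_contra hc
        rw [abs_of_pos (not_le.1 hc)] at h'
        linarith
      have h2 : mills (-w) ≤ 1.26 := by
        have := antitone_mills (neg_nonneg.2 hw)
        rw [mills_zero] at this
        linarith [sqrt_two_pi_le]
      have h3 : Real.exp (-z ^ 2 / 2) ≤ Real.exp (1 / 6) * Real.exp (-z / 2) := by
        rw [← Real.exp_add]
        apply Real.exp_le_exp.2
        nlinarith [sq_nonneg (z - 1 / 2)]
      have h4 : 1 ≤ Real.exp |w| := Real.one_le_exp (abs_nonneg w)
      calc (1 - Phi z) * mills (-w) ≤ (Real.exp (-z ^ 2 / 2) / 2) * 1.26 :=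
            mul_le_mul h1 h2 (mills_pos _).le (by positivity)
        _ ≤ 2 * Real.exp (-z / 2) * 1 := by
            have := Real.exp_pos (-z / 2)
            nlinarith
        _ ≤ _ := by gcongr
  · have h1 := stein_le z w
    have h2 : 1 ≤ Real.exp (-z / 2) * Real.exp |w| := by
      rw [← Real.exp_add]
      exact Real.one_le_exp (by linarith [le_abs_self w])
    nlinarith

/-- Same splitting at `z/2`. The factor `w` in the derivative is absorbed by `|w| ≤ 2 exp (|w|/2)`,
which raises the exponent from `|w|` to `3|w|/2`. -/
lemma abs_steinDeriv_le_exp {z : ℝ} (hz : 0 ≤ z) (w : ℝ) :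
    |steinDeriv z w| ≤ 6 * Real.exp (-z / 2) * Real.exp (3 / 2 * |w|) := by
  rcases le_or_gt w (z / 2) with h | h
  · have hP1 : 0 ≤ 1 - Phi z := by linarith [Phi_le_one z]
    rw [steinDeriv, centredInd, if_pos (by linarith)]
    have h1 := one_sub_Phi_le hz
    have h2 := stein_le_exp hz w
    have h5 : |w| ≤ 2 * Real.exp (|w| / 2) := by
      have := Real.add_one_le_exp (|w| / 2); linarith
    have h6 : Real.exp (3 / 2 * |w|) = Real.exp (|w| / 2) * Real.exp |w| := by
      rw [← Real.exp_add]; congr 1; ring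
    have h3 : Real.exp (-z ^ 2 / 2) ≤ 2 * Real.exp (-z / 2) := by
      have h8 : Real.exp (1 / 8) ≤ 2 := by
        have h := Real.exp_bound' (x := 1 / 8) (by norm_num) (by norm_num) (n := 4) (by norm_num)
        norm_num [Finset.sum_range_succ, Nat.factorial] at h
        linarith
      have : Real.exp (-z ^ 2 / 2) ≤ Real.exp (1 / 8) * Real.exp (-z / 2) := by
        rw [← Real.exp_add]
        apply Real.exp_le_exp.2
        nlinarith [sq_nonneg (z - 1 / 2)]
      nlinarith [Real.exp_pos (-z / 2)]
    have h4 : 1 ≤ Real.exp (3 / 2 * |w|) := Real.one_le_exp (by positivity)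
    have h7 : |w| * stein z w ≤ 4 * Real.exp (-z / 2) * Real.exp (3 / 2 * |w|) := by
      rw [h6]
      calc |w| * stein z w ≤ (2 * Real.exp (|w| / 2)) * (2 * Real.exp (-z / 2) * Real.exp |w|) :=
            mul_le_mul h5 h2 (stein_nonneg z w) (by positivity)
        _ = _ := by ring
    calc |w * stein z w + (1 - Phi z)| ≤ |w| * stein z w + (1 - Phi z) := by
          refine (abs_add_le _ _).trans ?_
          rw [abs_mul, abs_of_nonneg (stein_nonneg z w), abs_of_nonneg hP1]
      _ ≤ 4 * Real.exp (-z / 2) * Real.exp (3 / 2 * |w|) + Real.exp (-z / 2) * 1 := by linarith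
      _ ≤ 4 * Real.exp (-z / 2) * Real.exp (3 / 2 * |w|) +
          Real.exp (-z / 2) * Real.exp (3 / 2 * |w|) := by gcongr
      _ ≤ _ := by nlinarith [mul_pos (Real.exp_pos (-z / 2)) (Real.exp_pos (3 / 2 * |w|))]
  · have h1 := abs_steinDeriv_le_one z w
    have h2 : 1 ≤ Real.exp (-z / 2) * Real.exp (3 / 2 * |w|) := by
      rw [← Real.exp_add]
      exact Real.one_le_exp (by linarith [le_abs_self w, abs_nonneg w])
    nlinarith

lemma abs_mul_stein_sub_le_exp {z : ℝ} (hz : 0 ≤ z) (w u v : ℝ) (hu : |u| ≤ 1) (hv : |v| ≤ 1) :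
    |(w + u) * stein z (w + u) - (w + v) * stein z (w + v)| ≤
      200 * Real.exp (-z / 2) * Real.exp (2 * |w|) * |u - v| := by
  have e1 : Real.exp 1 ≤ 2.72 := by have := Real.exp_one_lt_d9; linarith
  have e2 : Real.exp (3 / 2) ≤ 7.4 := by
    have : Real.exp (3 / 2) ≤ Real.exp 2 := Real.exp_le_exp.2 (by norm_num)
    have h2 : Real.exp 2 = Real.exp 1 * Real.exp 1 := by rw [← Real.exp_add]; norm_num
    nlinarith [Real.exp_pos 1]
  have hw1 : ∀ t : ℝ, |t| ≤ 1 → |w + t| ≤ |w| + 1 := fun t ht => (abs_add_le w t).trans (by linarith)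
  have hf : |stein z (w + u) - stein z (w + v)| ≤
      6 * Real.exp (-z / 2) * Real.exp (3 / 2 * (|w| + 1)) * |u - v| := by
    rw [← integral_steinDeriv]
    have := intervalIntegral.norm_integral_le_of_norm_le_const (f := steinDeriv z)
      (a := w + v) (b := w + u) (C := 6 * Real.exp (-z / 2) * Real.exp (3 / 2 * (|w| + 1)))
      (fun t ht => by
        refine (abs_steinDeriv_le_exp hz t).trans ?_
        have : |t| ≤ |w| + 1 := by
          have h1 := uIoc_subset_uIcc ht
          rw [mem_uIcc] at h1
          have a1 := abs_le.1 hu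
          have a2 := abs_le.1 hv
          rw [abs_le]
          rcases h1 with h1 | h1 <;> constructor <;> linarith [neg_abs_le w, le_abs_self w]
        gcongr)
    rw [Real.norm_eq_abs] at this
    rwa [show w + u - (w + v) = u - v by ring] at this
  have hs : stein z (w + u) ≤ 2 * Real.exp (-z / 2) * Real.exp (|w| + 1) :=
    (stein_le_exp hz _).trans (by gcongr; exact hw1 u hu)
  -- Discrete product rule. The second factor `w + v` is again absorbed by `exp (|w|/2)`, whence the
  -- exponent `2|w|`.
  have hid : (w + u) * stein z (w + u) - (w + v) * stein z (w + v) =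
      (u - v) * stein z (w + u) + (w + v) * (stein z (w + u) - stein z (w + v)) := by ring
  have h5 : |w| + 1 ≤ 2 * Real.exp (|w| / 2) := by
    have := Real.add_one_le_exp (|w| / 2); linarith
  have h6 : Real.exp (2 * |w|) = Real.exp (|w| / 2) * Real.exp (3 / 2 * |w|) := by
    rw [← Real.exp_add]; congr 1; ring
  have h7 : Real.exp (3 / 2 * (|w| + 1)) = Real.exp (3 / 2 * |w|) * Real.exp (3 / 2) := by
    rw [← Real.exp_add]; congr 1; ring
  have h8 : Real.exp (|w| + 1) = Real.exp |w| * Real.exp 1 := Real.exp_add _ _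
  have h9 : Real.exp |w| ≤ Real.exp (2 * |w|) := Real.exp_le_exp.2 (by linarith [abs_nonneg w])
  rw [hid]
  calc |(u - v) * stein z (w + u) + (w + v) * (stein z (w + u) - stein z (w + v))|
      ≤ |u - v| * stein z (w + u) + |w + v| * |stein z (w + u) - stein z (w + v)| := by
        refine (abs_add_le _ _).trans ?_
        rw [abs_mul, abs_mul, abs_of_nonneg (stein_nonneg z _)]
    _ ≤ |u - v| * (2 * Real.exp (-z / 2) * (Real.exp (2 * |w|) * 2.72)) +
        (2 * Real.exp (|w| / 2)) *
          (6 * Real.exp (-z / 2) * (Real.exp (3 / 2 * |w|) * 7.4) * |u - v|) := by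
        refine add_le_add (mul_le_mul_of_nonneg_left (hs.trans ?_) (abs_nonneg _))
          (mul_le_mul ((hw1 v hv).trans h5) (hf.trans ?_) (abs_nonneg _) (by positivity))
        · rw [h8]; gcongr
        · rw [h7]; gcongr
    _ = (2 * 2.72 + 12 * 7.4) * Real.exp (-z / 2) * Real.exp (2 * |w|) * |u - v| := by
        rw [h6]; ring
    _ ≤ _ := by gcongr; norm_num

end NormalApprox

namespace NormalApprox

variable {Ω : Type*} [MeasurableSpace Ω] {μ : Measure Ω} {ι : Type*}

/-! ### Second moments -/

lemma MemLp.integrable_fun_mul {f g : Ω → ℝ} (hf : MemLp f 2 μ) (hg : MemLp g 2 μ) :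
    Integrable (fun ω => f ω * g ω) μ := MemLp.integrable_mul hf hg

lemma integral_mul_le_sqrt_mul_sqrt {f g : Ω → ℝ} (hf : MemLp f 2 μ) (hg : MemLp g 2 μ) :
    ∫ ω, f ω * g ω ∂μ ≤ √(∫ ω, f ω ^ 2 ∂μ) * √(∫ ω, g ω ^ 2 ∂μ) := by
  have h2 : ENNReal.ofReal 2 = 2 := by norm_num
  have h := integral_mul_le_Lp_mul_Lq_of_nonneg (μ := μ) (p := 2) (q := 2)
    (f := fun ω => |f ω|) (g := fun ω => |g ω|) Real.HolderConjugate.two_two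
    (Eventually.of_forall fun ω => abs_nonneg _) (Eventually.of_forall fun ω => abs_nonneg _)
    (by rw [h2]; exact hf.abs) (by rw [h2]; exact hg.abs)
  simp only [Real.rpow_two, sq_abs, ← Real.sqrt_eq_rpow] at h
  refine le_trans (integral_mono (MemLp.integrable_fun_mul hf hg)
    (MemLp.integrable_fun_mul hf.abs hg.abs) fun ω => ?_) h
  simp only [Pi.abs_apply]
  rw [← abs_mul]; exact le_abs_self _

lemma integral_abs_mul_abs_le {f g : Ω → ℝ} (hf : MemLp f 2 μ) (hg : MemLp g 2 μ) :
    ∫ ω, |f ω| * |g ω| ∂μ ≤ √(∫ ω, f ω ^ 2 ∂μ) * √(∫ ω, g ω ^ 2 ∂μ) := by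
  simpa using integral_mul_le_sqrt_mul_sqrt hf.abs hg.abs

lemma integral_abs_le_sqrt [IsProbabilityMeasure μ] {f : Ω → ℝ} (hf : MemLp f 2 μ) :
    ∫ ω, |f ω| ∂μ ≤ √(∫ ω, f ω ^ 2 ∂μ) := by
  simpa using integral_mul_le_sqrt_mul_sqrt hf.abs (memLp_const (1 : ℝ))

/-- Decoupling of a weight from a random variable, at the cost of a standard deviation. -/
lemma integral_mul_ge_of_variance [IsProbabilityMeasure μ] {G S : Ω → ℝ} (hG : MemLp G 2 μ)
    (hS : MemLp S 2 μ) :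
    (∫ ω, G ω ∂μ) * (∫ ω, S ω ∂μ) - √(∫ ω, G ω ^ 2 ∂μ) * √(Var[S; μ]) ≤
      ∫ ω, G ω * S ω ∂μ := by
  have hc : MemLp (fun ω => (∫ ω, S ω ∂μ) - S ω) 2 μ := (memLp_const _).sub hS
  have h := integral_mul_le_sqrt_mul_sqrt hG hc
  have h1 : ∫ ω, ((∫ ω, S ω ∂μ) - S ω) ^ 2 ∂μ = Var[S; μ] := by
    rw [variance_eq_integral hS.aestronglyMeasurable.aemeasurable]
    congr 1; ext ω; ring
  have h2 : ∫ ω, G ω * ((∫ ω, S ω ∂μ) - S ω) ∂μ =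
      (∫ ω, G ω ∂μ) * (∫ ω, S ω ∂μ) - ∫ ω, G ω * S ω ∂μ := by
    rw [← integral_mul_const, ← integral_sub ((hG.integrable (by norm_num)).mul_const _)
      (MemLp.integrable_fun_mul hG hS)]
    congr 1; ext ω; ring
  rw [h1, h2] at h
  linarith

/-! ### Independent families of square integrable random variables -/

/-- Independent, square integrable real random variables. -/
structure IsL2Family (ξ : ι → Ω → ℝ) (μ : Measure Ω) : Prop where
  measurable : ∀ i, Measurable (ξ i)
  memLp : ∀ i, MemLp (ξ i) 2 μ
  indep : iIndepFun ξ μ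

/-- The family with the `i`-th member replaced by `0`. -/
def omitAt [DecidableEq ι] (ξ : ι → Ω → ℝ) (i : ι) : ι → Ω → ℝ := Function.update ξ i 0

lemma sum_omitAt [Fintype ι] [DecidableEq ι] (ξ : ι → Ω → ℝ) (i : ι) (ω : Ω) :
    ∑ j, omitAt ξ i j ω = ∑ j, ξ j ω - ξ i ω := by
  have h1 : ∀ j, omitAt ξ i j ω = Function.update (fun j => ξ j ω) i 0 j := fun j => by
    by_cases h : j = i
    · subst h; simp [omitAt]
    · simp [omitAt, h]
  simp_rw [h1]
  rw [Finset.sum_update_of_mem (Finset.mem_univ i), ← Finset.erase_eq,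
    ← Finset.add_sum_erase _ _ (Finset.mem_univ i)]
  ring

lemma omitAt_cases [DecidableEq ι] (ξ : ι → Ω → ℝ) (i j : ι) :
    omitAt ξ i j = ξ j ∨ omitAt ξ i j = 0 := by
  by_cases h : j = i
  · right; subst h; simp [omitAt]
  · left; simp [omitAt, h]

namespace IsL2Family

lemma map {ξ : ι → Ω → ℝ} (h : IsL2Family ξ μ) {g : ι → ℝ → ℝ}
    (hg : ∀ i, Measurable (g i)) (hb : ∀ i x, |g i x| ≤ |x|) :
    IsL2Family (fun i ω => g i (ξ i ω)) μ where
  measurable i := (hg i).comp (h.measurable i)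
  memLp i := (h.memLp i).mono ((hg i).comp (h.measurable i)).aestronglyMeasurable
    (Eventually.of_forall fun _ => hb i _)
  indep := h.indep.comp g hg

/-- Putting zero in place of a member keeps the index type, so every statement about full sums
applies at once to sums with one summand left out. -/
lemma omitAt [DecidableEq ι] {ξ : ι → Ω → ℝ} (h : IsL2Family ξ μ) (i : ι) :
    IsL2Family (NormalApprox.omitAt ξ i) μ := by
  have h1 : NormalApprox.omitAt ξ i = fun j ω => (fun (j : ι) (x : ℝ) => if j = i then 0 else x)
      j (ξ j ω) := by
    ext j ω
    by_cases hj : j = i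
    · subst hj; simp [NormalApprox.omitAt]
    · simp [NormalApprox.omitAt, hj]
  rw [h1]
  refine h.map (fun j => ?_) fun j x => ?_
  · change Measurable fun x : ℝ => if j = i then (0 : ℝ) else x
    by_cases hj : j = i
    · simp only [hj, if_true]; exact measurable_const
    · simp only [hj, if_false]; exact measurable_id
  · by_cases hj : j = i <;> simp [hj]

variable [Fintype ι]

lemma measurable_sum {ξ : ι → Ω → ℝ} (h : IsL2Family ξ μ) : Measurable fun ω => ∑ i, ξ i ω :=
  Finset.measurable_fun_sum _ fun i _ => h.measurable i

lemma memLp_sum {ξ : ι → Ω → ℝ} (h : IsL2Family ξ μ) : MemLp (fun ω => ∑ i, ξ i ω) 2 μ :=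
  memLp_finsetSum _ fun i _ => h.memLp i

lemma measurable_sub {ξ : ι → Ω → ℝ} (h : IsL2Family ξ μ) (i : ι) :
    Measurable fun ω => ∑ j, ξ j ω - ξ i ω := h.measurable_sum.sub (h.measurable i)

lemma memLp_sub {ξ : ι → Ω → ℝ} (h : IsL2Family ξ μ) (i : ι) :
    MemLp (fun ω => ∑ j, ξ j ω - ξ i ω) 2 μ := h.memLp_sum.sub (h.memLp i)

lemma variance_sum [IsProbabilityMeasure μ] {ξ : ι → Ω → ℝ} (h : IsL2Family ξ μ) :
    Var[fun ω => ∑ i, ξ i ω; μ] = ∑ i, Var[ξ i; μ] := by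
  have := IndepFun.variance_sum (s := Finset.univ) (fun i _ => h.memLp i)
    (fun i _ j _ hij => h.indep.indepFun hij)
  rw [← this]
  congr 1; ext ω; simp

lemma integral_sum_sq [IsProbabilityMeasure μ] {ξ : ι → Ω → ℝ} (h : IsL2Family ξ μ)
    (h0 : ∀ i, ∫ ω, ξ i ω ∂μ = 0) :
    ∫ ω, (∑ i, ξ i ω) ^ 2 ∂μ = ∑ i, ∫ ω, ξ i ω ^ 2 ∂μ := by
  rw [← variance_of_integral_eq_zero h.measurable_sum.aemeasurable, h.variance_sum]
  · exact Finset.sum_congr rfl fun i _ =>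
      variance_of_integral_eq_zero (h.measurable i).aemeasurable (h0 i)
  · rw [integral_finsetSum _ fun i _ => (h.memLp i).integrable (by norm_num)]
    exact Finset.sum_eq_zero fun i _ => h0 i

lemma indepFun_rest {ξ : ι → Ω → ℝ} (h : IsL2Family ξ μ) (i : ι) :
    IndepFun (ξ i) (fun ω (j : {j // j ≠ i}) => ξ j ω) μ := by
  classical
  have h1 := h.indep.indepFun_finset {i} ({i}ᶜ : Finset ι) (by simp) h.measurable
  exact h1.comp (φ := fun x : (({i} : Finset ι) → ℝ) => x ⟨i, by simp⟩)
    (ψ := fun (x : (({i}ᶜ : Finset ι) → ℝ)) (j : {j // j ≠ i}) => x ⟨j, by simpa using j.2⟩)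
    (measurable_pi_apply _) (measurable_pi_lambda _ fun j => measurable_pi_apply _)

lemma sum_sub_eq_sum_rest (ξ : ι → Ω → ℝ) (i : ι) [Fintype {j // j ≠ i}] (ω : Ω) :
    ∑ j, ξ j ω - ξ i ω = ∑ j : {j // j ≠ i}, ξ j ω := by
  classical
  rw [← Finset.add_sum_erase _ _ (Finset.mem_univ i), add_sub_cancel_left]
  refine (Finset.sum_subtype _ (fun j => ?_) fun j => ξ j ω)
  simp

lemma indepFun_sub {ξ : ι → Ω → ℝ} (h : IsL2Family ξ μ) (i : ι) :
    IndepFun (ξ i) (fun ω => ∑ j, ξ j ω - ξ i ω) μ := by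
  classical
  have := (h.indepFun_rest i).comp measurable_id
    (ψ := fun x : {j // j ≠ i} → ℝ => ∑ j, x j)
    (Finset.measurable_fun_sum _ fun j _ => measurable_pi_apply j)
  refine this.congr (ae_eq_refl _) (Eventually.of_forall fun ω => ?_)
  simp only [Function.comp]
  rw [sum_sub_eq_sum_rest]

end IsL2Family

/-! ### Concentration in random intervals -/

/-- The piecewise linear function with slope one on `[-d, D + d]`, centred at `D / 2`. -/
def ramp (d D v : ℝ) : ℝ := max (-d) (min v (D + d)) - D / 2

lemma abs_ramp_le {d D v : ℝ} (hd : 0 ≤ d) (hD : 0 ≤ D) : |ramp d D v| ≤ D / 2 + d := by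
  have h1 : max (-d) (min v (D + d)) ≤ D + d := max_le (by linarith) (min_le_right _ _)
  have h2 := le_max_left (-d) (min v (D + d))
  rw [ramp, abs_le]
  constructor <;> linarith

/-- From a point of `[0, D]` a move by at most `d` stays in the zone of slope one, so an increment
`x` changes the ramp by at least `min d |x|` in the direction of `x`. Elsewhere monotonicity gives
the right sign. -/
lemma ramp_mul_sub {d D v : ℝ} (x : ℝ) (hd : 0 ≤ d) :
    (if 0 ≤ v ∧ v ≤ D then |x| * min d |x| else 0) ≤ x * (ramp d D v - ramp d D (v - x)) := by
  have hm : ∀ a b, a ≤ b → ramp d D a ≤ ramp d D b := fun a b hab =>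
    sub_le_sub_right (max_le_max le_rfl (min_le_min hab le_rfl)) _
  have hr : ∀ a, -d ≤ a → a ≤ D + d → ramp d D a = a - D / 2 := fun a h1 h2 => by
    rw [ramp, min_eq_left h2, max_eq_right h1]
  rcases le_total 0 x with hx | hx
  · split_ifs with h
    · rw [abs_of_nonneg hx]
      refine mul_le_mul_of_nonneg_left ?_ hx
      have h1 := hm (v - x) (v - min d x) (by linarith [min_le_right d x])
      rw [hr (v - min d x) (by linarith [min_le_left d x])
        (by linarith [le_min hd hx])] at h1
      rw [hr v (by linarith) (by linarith)]
      linarith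
    · exact mul_nonneg hx (sub_nonneg.2 (hm _ _ (by linarith)))
  · split_ifs with h
    · rw [abs_of_nonpos hx]
      have h1 := hm (v + min d (-x)) (v - x) (by linarith [min_le_right d (-x)])
      rw [hr (v + min d (-x)) (by linarith [le_min hd (neg_nonneg.2 hx)])
        (by linarith [min_le_left d (-x)])] at h1
      rw [hr v (by linarith) (by linarith)]
      nlinarith
    · exact mul_nonneg_of_nonpos_of_nonpos hx (sub_nonpos.2 (hm _ _ (by linarith)))

/-- Before centring, passing from `D` to a larger `D'` raises the ramp by something between `0` and
`D' - D`, since `a` lies in `[0, 1]`. Subtracting half the length makes this range symmetric, which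
is the source of the factor `1/2`. -/
lemma abs_ramp_sub_le {d D D' a v : ℝ} (ha0 : 0 ≤ a) (ha1 : a ≤ 1) :
    |ramp d D (v + a * D) - ramp d D' (v + a * D')| ≤ |D - D'| / 2 := by
  have key : ∀ D D' : ℝ, D ≤ D' →
      |ramp d D (v + a * D) - ramp d D' (v + a * D')| ≤ |D - D'| / 2 := by
    intro D D' h
    have e1 : a * D ≤ a * D' := mul_le_mul_of_nonneg_left h ha0
    have e2 : a * D' - a * D ≤ D' - D := by nlinarith
    have h1 : max (-d) (min (v + a * D) (D + d)) ≤ max (-d) (min (v + a * D') (D' + d)) :=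
      max_le_max le_rfl (min_le_min (by linarith) (by linarith))
    have h2 : max (-d) (min (v + a * D') (D' + d)) ≤
        max (-d) (min (v + a * D) (D + d)) + (D' - D) := by
      refine max_le (by linarith [le_max_left (-d) (min (v + a * D) (D + d))]) ?_
      have h3 : min (v + a * D') (D' + d) ≤ min (v + a * D) (D + d) + (D' - D) := by
        rw [← min_add_add_right]
        exact min_le_min (by linarith) (by linarith)
      linarith [le_max_right (-d) (min (v + a * D) (D + d))]
    rw [abs_of_nonpos (sub_nonpos.2 h), ramp, ramp, abs_le]
    constructor <;> linarith
  rcases le_total D D' with h | h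
  · exact key D D' h
  · rw [abs_sub_comm, abs_sub_comm D]; exact key D' D h

lemma measurable_ramp (d a z : ℝ) :
    Measurable fun p : ℝ × ℝ => ramp d p.1 (p.2 - z + a * p.1) := by
  unfold ramp; fun_prop

lemma truncProd_bounds {d : ℝ} (hd : 0 ≤ d) (x : ℝ) :
    0 ≤ |x| * min d |x| ∧ |x| * min d |x| ≤ d * |x| :=
  ⟨mul_nonneg (abs_nonneg _) (le_min hd (abs_nonneg _)), by
    rw [mul_comm d]; exact mul_le_mul_of_nonneg_left (min_le_left _ _) (abs_nonneg _)⟩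

lemma measurable_truncProd (d : ℝ) : Measurable fun x : ℝ => |x| * min d |x| := by fun_prop

/-! ### The truncated products `|ξ| min(d, |ξ|)`. -/

section Truncated

variable {ξ : ι → Ω → ℝ} {d : ℝ}

lemma memLp_truncProd (h : IsL2Family ξ μ) (hd : 0 ≤ d) (i : ι) : MemLp (fun ω => |ξ i ω| * min d |ξ i ω|) 2 μ := by
  refine MemLp.of_le_mul (g := ξ i) (c := d) (h.memLp i)
    ((measurable_truncProd d).comp (h.measurable i)).aestronglyMeasurable
    (Eventually.of_forall fun ω => ?_)
  rw [Real.norm_of_nonneg (truncProd_bounds hd _).1]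
  exact (truncProd_bounds hd _).2

lemma memLp_sum_truncProd [Fintype ι] (h : IsL2Family ξ μ) (hd : 0 ≤ d) : MemLp (fun ω => ∑ i, |ξ i ω| * min d |ξ i ω|) 2 μ :=
  memLp_finsetSum _ fun i _ => memLp_truncProd h hd i

lemma variance_sum_truncProd_le [Fintype ι] [IsProbabilityMeasure μ] (h : IsL2Family ξ μ)
    (hd : 0 ≤ d) :
    Var[fun ω => ∑ i, |ξ i ω| * min d |ξ i ω|; μ] ≤ d ^ 2 * ∑ i, ∫ ω, ξ i ω ^ 2 ∂μ := by
  have hY : IsL2Family (fun i ω => |ξ i ω| * min d |ξ i ω|) μ :=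
    { measurable := fun i => (measurable_truncProd d).comp (h.measurable i)
      memLp := memLp_truncProd h hd
      indep := h.indep.comp _ fun _ => measurable_truncProd d }
  rw [hY.variance_sum, Finset.mul_sum]
  refine Finset.sum_le_sum fun i _ => ?_
  refine (variance_le_expectation_sq (hY.measurable i).aestronglyMeasurable).trans ?_
  rw [← integral_const_mul]
  refine integral_mono (hY.memLp i).integrable_sq ((h.memLp i).integrable_sq.const_mul _)
    fun ω => ?_
  have hb := truncProd_bounds hd (ξ i ω)
  have := pow_le_pow_left₀ hb.1 hb.2 2
  rwa [mul_pow d, sq_abs] at this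

end Truncated

/-- Concentration of a sum of independent centred random variables in a random interval. -/
theorem measureReal_mul_le_of_randomInterval [Fintype ι] [IsProbabilityMeasure μ]
    {ξ : ι → Ω → ℝ} (h : IsL2Family ξ μ) (h0 : ∀ i, ∫ ω, ξ i ω ∂μ = 0)
    {D : Ω → ℝ} {D' : ι → Ω → ℝ} (hDm : Measurable D) (hD : MemLp D 2 μ)
    (hDm' : ∀ i, Measurable (D' i)) (hD' : ∀ i, MemLp (D' i) 2 μ)
    (hD0 : ∀ ω, 0 ≤ D ω) (hD0' : ∀ i ω, 0 ≤ D' i ω)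
    (hind : ∀ i, IndepFun (ξ i) (fun ω => (D' i ω, ∑ j, ξ j ω - ξ i ω)) μ)
    {d a : ℝ} (hd : 0 ≤ d) (ha0 : 0 ≤ a) (ha1 : a ≤ 1) (z : ℝ) :
    μ.real {ω | z - a * D ω ≤ ∑ j, ξ j ω ∧ ∑ j, ξ j ω ≤ z - a * D ω + D ω} *
        (∑ i, ∫ ω, |ξ i ω| * min d |ξ i ω| ∂μ) ≤
      1 / 2 * (∫ ω, |∑ j, ξ j ω| * D ω ∂μ) +
        1 / 2 * (∑ i, ∫ ω, |ξ i ω| * |D ω - D' i ω| ∂μ) +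
        2 * d * √(∑ i, ∫ ω, ξ i ω ^ 2 ∂μ) := by
  set W : Ω → ℝ := fun ω => ∑ j, ξ j ω with hW
  set A : Set Ω := {ω | z - a * D ω ≤ ∑ j, ξ j ω ∧ ∑ j, ξ j ω ≤ z - a * D ω + D ω} with hA
  set S : Ω → ℝ := fun ω => ∑ i, |ξ i ω| * min d |ξ i ω| with hS
  have hWm : Measurable W := h.measurable_sum
  have hW2 : MemLp W 2 μ := h.memLp_sum
  have hAm : MeasurableSet A := by
    refine (measurableSet_le ?_ hWm).inter (measurableSet_le hWm ?_) <;> fun_prop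
  have hS2 : MemLp S 2 μ := memLp_sum_truncProd h hd
  have hG2 : MemLp (A.indicator fun _ => (1 : ℝ)) 2 μ := (memLp_const 1).indicator hAm
  -- The indicator of `A` and `S` are dependent. Replacing `E (1_A S)` by `P(A) E S` costs one
  -- standard deviation of `S`, which is at most `d` times that of the sum because `S` has
  -- independent terms.
  have hlow := integral_mul_ge_of_variance hG2 hS2
  have hG1 : ∫ ω, A.indicator (fun _ => (1 : ℝ)) ω ∂μ = μ.real A := by
    rw [integral_indicator hAm]; simp
  have hGs : √(∫ ω, (A.indicator fun _ => (1 : ℝ)) ω ^ 2 ∂μ) ≤ 1 := by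
    rw [Real.sqrt_le_one]
    have : ∀ ω, (A.indicator (fun _ => (1 : ℝ)) ω) ^ 2 = A.indicator (fun _ => (1 : ℝ)) ω :=
      fun ω => by by_cases hω : ω ∈ A <;> simp [hω]
    simp_rw [this]
    rw [hG1]; exact measureReal_le_one
  have hvar : √(Var[S; μ]) ≤ d * √(∑ i, ∫ ω, ξ i ω ^ 2 ∂μ) := by
    refine (Real.sqrt_le_sqrt (variance_sum_truncProd_le h hd)).trans ?_
    rw [Real.sqrt_mul (sq_nonneg d), Real.sqrt_sq hd]
  have hSint : ∫ ω, S ω ∂μ = ∑ i, ∫ ω, |ξ i ω| * min d |ξ i ω| ∂μ :=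
    integral_finsetSum _ fun i _ => (memLp_truncProd h hd i).integrable (by norm_num)
  -- the function to which the exchange argument is applied
  have hR2 : ∀ {E Y : Ω → ℝ}, Measurable E → MemLp E 2 μ → (∀ ω, 0 ≤ E ω) → Measurable Y →
      MemLp (fun ω => ramp d (E ω) (Y ω - z + a * E ω)) 2 μ := fun {E Y} hEm hE hE0 hY => by
    refine MemLp.mono' (g := fun ω => E ω / 2 + d) ?_
      ((measurable_ramp d a z).comp (hEm.prodMk hY)).aestronglyMeasurable
      (Eventually.of_forall fun ω => abs_ramp_le hd (hE0 ω))
    have : MemLp (fun ω => 1 / 2 * E ω + d) 2 μ := (hE.const_mul (1 / 2)).add (memLp_const d)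
    convert this using 2
    ring
  have hfW := hR2 hDm hD hD0 hWm
  have hfi := fun i => hR2 hDm hD hD0 (h.measurable_sub i)
  have hfi' := fun i => hR2 (hDm' i) (hD' i) (hD0' i) (h.measurable_sub i)
  -- The right-hand side is `∑ ξ_i (f(W) - f(W - ξ_i))` for the ramp `f` attached to the random
  -- interval; on `A` each term is at least `|ξ_i| min(d, |ξ_i|)`, off `A` it is nonnegative.
  have hpt : ∀ ω, A.indicator (fun _ => (1 : ℝ)) ω * S ω ≤
      W ω * ramp d (D ω) (W ω - z + a * D ω) -
        ∑ i, ξ i ω * ramp d (D ω) (W ω - ξ i ω - z + a * D ω) := fun ω => by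
    have h1 : W ω * ramp d (D ω) (W ω - z + a * D ω) -
        ∑ i, ξ i ω * ramp d (D ω) (W ω - ξ i ω - z + a * D ω) =
        ∑ i, ξ i ω * (ramp d (D ω) (W ω - z + a * D ω) -
          ramp d (D ω) (W ω - z + a * D ω - ξ i ω)) := by
      simp only [mul_sub, Finset.sum_sub_distrib, ← Finset.sum_mul, hW]
      congr 2; ext i; congr 2; ring
    rw [h1, hS, Finset.mul_sum]
    refine Finset.sum_le_sum fun i _ => ?_
    refine le_trans (le_of_eq ?_) (ramp_mul_sub (ξ i ω) hd)
    have hiff : ω ∈ A ↔ 0 ≤ W ω - z + a * D ω ∧ W ω - z + a * D ω ≤ D ω := by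
      simp only [hA, hW, mem_ofPred_eq]
      constructor <;> rintro ⟨h1, h2⟩ <;> constructor <;> linarith
    by_cases hω : ω ∈ A
    · rw [if_pos (hiff.1 hω)]; simp [hω]
    · rw [if_neg (fun hc => hω (hiff.2 hc))]; simp [hω]
  have hintW := MemLp.integrable_fun_mul hW2 hfW
  have hinti := fun i => MemLp.integrable_fun_mul (h.memLp i) (hfi i)
  have hinti' := fun i => MemLp.integrable_fun_mul (h.memLp i) (hfi' i)
  have hup1 : ∫ ω, A.indicator (fun _ => (1 : ℝ)) ω * S ω ∂μ ≤
      ∫ ω, W ω * ramp d (D ω) (W ω - z + a * D ω) ∂μ -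
        ∑ i, ∫ ω, ξ i ω * ramp d (D ω) (W ω - ξ i ω - z + a * D ω) ∂μ := by
    rw [← integral_finsetSum _ fun i _ => hinti i,
      ← integral_sub hintW (integrable_finsetSum _ fun i _ => hinti i)]
    exact integral_mono (MemLp.integrable_fun_mul hG2 hS2)
      (hintW.sub (integrable_finsetSum _ fun i _ => hinti i)) hpt
  have hup2 : ∫ ω, W ω * ramp d (D ω) (W ω - z + a * D ω) ∂μ ≤
      1 / 2 * (∫ ω, |W ω| * D ω ∂μ) + d * √(∑ i, ∫ ω, ξ i ω ^ 2 ∂μ) := by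
    have e1 : ∫ ω, |W ω| ∂μ ≤ √(∑ i, ∫ ω, ξ i ω ^ 2 ∂μ) := by
      rw [← h.integral_sum_sq h0]; exact integral_abs_le_sqrt hW2
    have i1 : Integrable (fun ω => |W ω| * D ω) μ := MemLp.integrable_fun_mul hW2.abs hD
    have i2 : Integrable (fun ω => |W ω|) μ := (hW2.integrable (by norm_num)).abs
    calc ∫ ω, W ω * ramp d (D ω) (W ω - z + a * D ω) ∂μ
        ≤ ∫ ω, 1 / 2 * (|W ω| * D ω) + d * |W ω| ∂μ := by
          refine integral_mono hintW ((i1.const_mul _).add (i2.const_mul _)) fun ω => ?_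
          have := abs_ramp_le (v := W ω - z + a * D ω) hd (hD0 ω)
          calc W ω * ramp d (D ω) (W ω - z + a * D ω)
              ≤ |W ω| * |ramp d (D ω) (W ω - z + a * D ω)| := by
                rw [← abs_mul]; exact le_abs_self _
            _ ≤ |W ω| * (D ω / 2 + d) := mul_le_mul_of_nonneg_left this (abs_nonneg _)
            _ = _ := by ring
      _ = 1 / 2 * (∫ ω, |W ω| * D ω ∂μ) + d * ∫ ω, |W ω| ∂μ := by
          rw [integral_add (i1.const_mul _) (i2.const_mul _), integral_const_mul,
            integral_const_mul]
      _ ≤ _ := by gcongr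
  -- With `D' i` in place of `D` the integral vanishes, `ξ i` being centred and independent of the
  -- other factor. Only the change of the ramp under this replacement is paid for.
  have hup3 : ∀ i, -∫ ω, ξ i ω * ramp d (D ω) (W ω - ξ i ω - z + a * D ω) ∂μ ≤
      1 / 2 * ∫ ω, |ξ i ω| * |D ω - D' i ω| ∂μ := fun i => by
    have hz : ∫ ω, ξ i ω * ramp d (D' i ω) (W ω - ξ i ω - z + a * D' i ω) ∂μ = 0 := by
      have hi := (hind i).comp measurable_id (measurable_ramp d a z)
      have := hi.integral_fun_mul_eq_mul_integral
        (h.measurable i).aestronglyMeasurable (hfi' i).aestronglyMeasurable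
      simp only [Function.comp, id] at this
      rw [this, h0 i, zero_mul]
    have i1 : Integrable (fun ω => |ξ i ω| * |D ω - D' i ω|) μ :=
      MemLp.integrable_fun_mul (h.memLp i).abs (hD.sub (hD' i)).abs
    rw [← integral_const_mul, ← sub_zero (-∫ ω, _ ∂μ), ← neg_zero, ← hz, sub_neg_eq_add,
      neg_add_eq_sub, ← integral_sub (hinti' i) (hinti i)]
    refine integral_mono ((hinti' i).sub (hinti i)) (i1.const_mul _) fun ω => ?_
    have := abs_ramp_sub_le (d := d) (D := D' i ω) (D' := D ω) (v := W ω - ξ i ω - z) ha0 ha1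
    calc ξ i ω * ramp d (D' i ω) (W ω - ξ i ω - z + a * D' i ω) -
          ξ i ω * ramp d (D ω) (W ω - ξ i ω - z + a * D ω)
        ≤ |ξ i ω| * |ramp d (D' i ω) (W ω - ξ i ω - z + a * D' i ω) -
          ramp d (D ω) (W ω - ξ i ω - z + a * D ω)| := by
          rw [← abs_mul, ← mul_sub]; exact le_abs_self _
      _ ≤ |ξ i ω| * (|D' i ω - D ω| / 2) := mul_le_mul_of_nonneg_left this (abs_nonneg _)
      _ = _ := by rw [abs_sub_comm]; ring
  have hup4 := Finset.sum_le_sum fun i (_ : i ∈ Finset.univ) => hup3 i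
  rw [Finset.sum_neg_distrib, ← Finset.mul_sum] at hup4
  rw [hG1, hSint] at hlow
  have hV := mul_le_mul hGs hvar (Real.sqrt_nonneg _) zero_le_one
  rw [one_mul] at hV
  linarith

end NormalApprox

namespace NormalApprox

variable {Ω : Type*} [MeasurableSpace Ω] {μ : Measure Ω} {ι : Type*}

/-! ### Stein's identity for sums -/

lemma integral_comp_add_of_indepFun [IsProbabilityMeasure μ] {X Y : Ω → ℝ} (hX : Measurable X)
    (hY : Measurable Y) (hXY : IndepFun X Y μ) {F : ℝ → ℝ} (hF : Measurable F) {C : ℝ}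
    (hC : ∀ x, |F x| ≤ C) :
    ∫ ω, F (Y ω + X ω) ∂μ = ∫ ω, ∫ ω', F (Y ω' + X ω) ∂μ ∂μ := by
  have hp : μ.map (fun ω => (X ω, Y ω)) = (μ.map X).prod (μ.map Y) :=
    (indepFun_iff_map_prod_eq_prod_map_map hX.aemeasurable hY.aemeasurable).1 hXY
  have := Measure.isProbabilityMeasure_map (μ := μ) hX.aemeasurable
  have := Measure.isProbabilityMeasure_map (μ := μ) hY.aemeasurable
  have hm : Measurable fun p : ℝ × ℝ => F (p.2 + p.1) := hF.comp (by fun_prop)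
  have h1 : ∫ ω, F (Y ω + X ω) ∂μ = ∫ p, F (p.2 + p.1) ∂((μ.map X).prod (μ.map Y)) := by
    rw [← hp, integral_map (hX.prodMk hY).aemeasurable hm.aestronglyMeasurable]
  have hi : Integrable (fun p : ℝ × ℝ => F (p.2 + p.1)) ((μ.map X).prod (μ.map Y)) :=
    Integrable.of_bound hm.aestronglyMeasurable C (Eventually.of_forall fun p => hC _)
  have h2 : ∀ x, ∫ y, F (y + x) ∂(μ.map Y) = ∫ ω', F (Y ω' + x) ∂μ := fun x =>
    integral_map hY.aemeasurable (hF.comp (measurable_add_const x)).aestronglyMeasurable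
  rw [h1, integral_prod _ hi]
  simp_rw [h2]
  rw [integral_map hX.aemeasurable]
  have := hm.stronglyMeasurable.integral_prod_right' (ν := μ.map Y)
  simp_rw [h2] at this
  exact this.aestronglyMeasurable

lemma measurable_integral_comp_add [IsProbabilityMeasure μ] {Y : Ω → ℝ} (hY : Measurable Y)
    {F : ℝ → ℝ} (hF : Measurable F) : Measurable fun t => ∫ ω, F (Y ω + t) ∂μ := by
  have hm : Measurable fun p : ℝ × Ω => F (Y p.2 + p.1) := hF.comp (by fun_prop)
  exact (hm.stronglyMeasurable.integral_prod_right' (ν := μ)).measurable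

lemma abs_integral_le_of_bound [IsProbabilityMeasure μ] {f : Ω → ℝ} {C : ℝ}
    (hf : ∀ ω, |f ω| ≤ C) : |∫ ω, f ω ∂μ| ≤ C := by
  have := norm_integral_le_of_norm_le_const (μ := μ) (f := f) (C := C)
    (Eventually.of_forall fun ω => hf ω)
  simpa using this

/-- The expected increment of a function, in terms of the averaged derivative. -/
lemma integral_mul_increment [IsProbabilityMeasure μ] {X Y : Ω → ℝ} (hX : Measurable X)
    (hX2 : MemLp X 2 μ) (hY : Measurable Y) (hXY : IndepFun X Y μ) {f F : ℝ → ℝ}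
    (hf : Measurable f) (hF : Measurable F) (hF1 : ∀ x, |F x| ≤ 1)
    (hfF : ∀ y x, f (y + x) - f y = ∫ t in (0 : ℝ)..x, F (y + t)) :
    ∫ ω, X ω * (f (Y ω + X ω) - f (Y ω)) ∂μ =
      ∫ ω, X ω * (∫ t in (0 : ℝ)..X ω, (∫ ω', F (Y ω' + t) ∂μ)) ∂μ := by
  have hp : μ.map (fun ω => (X ω, Y ω)) = (μ.map X).prod (μ.map Y) :=
    (indepFun_iff_map_prod_eq_prod_map_map hX.aemeasurable hY.aemeasurable).1 hXY
  have := Measure.isProbabilityMeasure_map (μ := μ) hX.aemeasurable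
  have := Measure.isProbabilityMeasure_map (μ := μ) hY.aemeasurable
  have hm : Measurable fun p : ℝ × ℝ => p.1 * (f (p.2 + p.1) - f p.2) :=
    measurable_fst.mul ((hf.comp (by fun_prop)).sub (hf.comp measurable_snd))
  have h1 : ∫ ω, X ω * (f (Y ω + X ω) - f (Y ω)) ∂μ =
      ∫ p, p.1 * (f (p.2 + p.1) - f p.2) ∂((μ.map X).prod (μ.map Y)) := by
    rw [← hp, integral_map (hX.prodMk hY).aemeasurable hm.aestronglyMeasurable]
  have hinc : ∀ y x, |f (y + x) - f y| ≤ |x| := fun y x => by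
    rw [hfF]
    simpa using intervalIntegral.norm_integral_le_of_norm_le_const (C := 1)
      (f := fun t => F (y + t)) (a := 0) (b := x) (fun t _ => hF1 _)
  have hi : Integrable (fun p : ℝ × ℝ => p.1 * (f (p.2 + p.1) - f p.2))
      ((μ.map X).prod (μ.map Y)) := by
    rw [← hp, integrable_map_measure hm.aestronglyMeasurable (hX.prodMk hY).aemeasurable]
    refine hX2.integrable_sq.mono' (hm.comp (hX.prodMk hY)).aestronglyMeasurable
      (Eventually.of_forall fun ω => ?_)
    simp only [Function.comp, norm_mul, Real.norm_eq_abs]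
    calc |X ω| * |f (Y ω + X ω) - f (Y ω)| ≤ |X ω| * |X ω| :=
          mul_le_mul_of_nonneg_left (hinc _ _) (abs_nonneg _)
      _ = X ω ^ 2 := by rw [← sq, sq_abs]
  have h2 : ∀ x, ∫ y, F (y + x) ∂(μ.map Y) = ∫ ω', F (Y ω' + x) ∂μ := fun x =>
    integral_map hY.aemeasurable (hF.comp (measurable_add_const x)).aestronglyMeasurable
  have h3 : ∀ x, ∫ y, x * (f (y + x) - f y) ∂(μ.map Y) =
      x * (∫ t in (0 : ℝ)..x, (∫ ω', F (Y ω' + t) ∂μ)) := fun x => by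
    rw [integral_const_mul]
    simp_rw [hfF, ← h2]
    congr 1
    -- Finiteness makes the bounded integrand integrable for the product measure, so the averages
    -- over `Y` and over `t` can be exchanged.
    have : IsFiniteMeasure ((volume : Measure ℝ).restrict (uIoc 0 x)) :=
      ⟨by rw [Measure.restrict_apply_univ]; exact measure_Ioc_lt_top⟩
    rw [← intervalIntegral_integral_swap]
    refine Integrable.of_bound (C := 1) ?_ (Eventually.of_forall fun p => hF1 _)
    exact (hF.comp (by fun_prop : Measurable fun p : ℝ × ℝ => p.2 + p.1)).aestronglyMeasurable
  rw [h1, integral_prod _ hi]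
  simp_rw [h3]
  rw [integral_map hX.aemeasurable]
  have := hm.stronglyMeasurable.integral_prod_right' (ν := μ.map Y)
  simp_rw [h3] at this
  exact this.aestronglyMeasurable

/-- The averaged Stein derivative of the sum without its `i`-th summand. -/
def avgDeriv [Fintype ι] (μ : Measure Ω) (ξ : ι → Ω → ℝ) (z : ℝ) (i : ι) (t : ℝ) : ℝ :=
  ∫ ω, steinDeriv z (∑ j, ξ j ω - ξ i ω + t) ∂μ

section Identity

variable [Fintype ι] [IsProbabilityMeasure μ] {ξ : ι → Ω → ℝ}

lemma measurable_avgDeriv (h : IsL2Family ξ μ) (z : ℝ) (i : ι) :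
    Measurable (avgDeriv μ ξ z i) :=
  measurable_integral_comp_add (h.measurable_sub i) (measurable_steinDeriv z)

lemma abs_avgDeriv_le (z : ℝ) (i : ι) (t : ℝ) : |avgDeriv μ ξ z i t| ≤ 1 :=
  abs_integral_le_of_bound fun _ => abs_steinDeriv_le_one z _

lemma integrable_steinDeriv_comp {Y : Ω → ℝ} (hY : Measurable Y) (z : ℝ) :
    Integrable (fun ω => steinDeriv z (Y ω)) μ :=
  Integrable.of_bound ((measurable_steinDeriv z).comp hY).aestronglyMeasurable 1
    (Eventually.of_forall fun _ => abs_steinDeriv_le_one z _)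

lemma integral_steinDeriv_sum (h : IsL2Family ξ μ) (z : ℝ) (i : ι) :
    ∫ ω, steinDeriv z (∑ j, ξ j ω) ∂μ = ∫ ω, avgDeriv μ ξ z i (ξ i ω) ∂μ := by
  have := integral_comp_add_of_indepFun (h.measurable i) (h.measurable_sub i) (h.indepFun_sub i)
    (measurable_steinDeriv z) (abs_steinDeriv_le_one z)
  simp only [sub_add_cancel] at this
  exact this

lemma abs_stein_le (z w : ℝ) : |stein z w| ≤ 1 := by
  rw [abs_of_nonneg (stein_nonneg z w)]
  exact (stein_le z w).trans (by norm_num)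

lemma memLp_stein_comp {Y : Ω → ℝ} (hY : Measurable Y) (z : ℝ) :
    MemLp (fun ω => stein z (Y ω)) 2 μ :=
  MemLp.of_bound ((continuous_stein z).measurable.comp hY).aestronglyMeasurable 1
    (Eventually.of_forall fun _ => abs_stein_le z _)

lemma measurable_mul_primitive {R : ℝ → ℝ} (hR : Measurable R) {C : ℝ} (hC : ∀ x, |R x| ≤ C)
    {X : Ω → ℝ} (hX : Measurable X) : Measurable fun ω => X ω * ∫ t in (0 : ℝ)..X ω, R t := by
  refine hX.mul (Measurable.comp (g := fun x => ∫ t in (0 : ℝ)..x, R t) ?_ hX)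
  exact (intervalIntegral.continuous_primitive
    (fun a b => intervalIntegrable_of_bounded hR hC a b) 0).measurable

lemma integrable_mul_primitive {R : ℝ → ℝ} (hR : Measurable R) {C : ℝ} (hC : ∀ x, |R x| ≤ C)
    {X : Ω → ℝ} (hX : Measurable X) (hX2 : MemLp X 2 μ) :
    Integrable (fun ω => X ω * ∫ t in (0 : ℝ)..X ω, R t) μ := by
  refine (hX2.integrable_sq.const_mul C).mono'
    (measurable_mul_primitive hR hC hX).aestronglyMeasurable (Eventually.of_forall fun ω => ?_)
  have := intervalIntegral.norm_integral_le_of_norm_le_const (C := C)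
      (f := R) (a := 0) (b := X ω) (fun t _ => hC t)
  rw [sub_zero] at this
  rw [norm_mul, Real.norm_eq_abs]
  calc |X ω| * ‖∫ t in (0 : ℝ)..X ω, R t‖ ≤ |X ω| * (C * |X ω|) := by gcongr
    _ = C * X ω ^ 2 := by rw [← sq_abs]; ring

/-- The error of the normal approximation as a sum of local terms. -/
theorem measureReal_sub_Phi_eq (h : IsL2Family ξ μ) (z : ℝ) :
    μ.real {ω | ∑ j, ξ j ω ≤ z} - Phi z =
      ∑ i, ∫ ω, ξ i ω * (∫ t in (0 : ℝ)..ξ i ω,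
        ((∫ ω', steinDeriv z (∑ j, ξ j ω') ∂μ) - avgDeriv μ ξ z i t)) ∂μ +
      (1 - ∑ i, ∫ ω, ξ i ω ^ 2 ∂μ) * (∫ ω, steinDeriv z (∑ j, ξ j ω) ∂μ) -
      ∑ i, (∫ ω, ξ i ω ∂μ) * (∫ ω, stein z (∑ j, ξ j ω - ξ i ω) ∂μ) := by
  set W : Ω → ℝ := fun ω => ∑ j, ξ j ω with hW
  have hWm : Measurable W := h.measurable_sum
  set I : ℝ := ∫ ω, steinDeriv z (W ω) ∂μ with hI
  have hset : MeasurableSet {ω | W ω ≤ z} := measurableSet_le hWm measurable_const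
  have h1 : ∫ ω, centredInd z (W ω) ∂μ = μ.real {ω | W ω ≤ z} - Phi z := by
    have e : ∀ ω, centredInd z (W ω) = {ω | W ω ≤ z}.indicator (fun _ => (1 : ℝ)) ω - Phi z :=
      fun ω => by simp [centredInd, indicator]
    simp_rw [e]
    rw [integral_sub ((integrable_const _).indicator hset) (integrable_const _),
      integral_indicator hset]
    simp
  have hWf := MemLp.integrable_fun_mul h.memLp_sum (memLp_stein_comp hWm z)
  have h2 : ∫ ω, centredInd z (W ω) ∂μ = I - ∫ ω, W ω * stein z (W ω) ∂μ := by
    rw [hI, ← integral_sub (integrable_steinDeriv_comp hWm z) hWf]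
    congr 1; ext ω; simp only [steinDeriv, hW]; ring
  have i1 := fun i => MemLp.integrable_fun_mul (h.memLp i) (memLp_stein_comp hWm z)
  have i2 := fun i => MemLp.integrable_fun_mul (h.memLp i)
    (memLp_stein_comp (h.measurable_sub i) z)
  have h3 : ∫ ω, W ω * stein z (W ω) ∂μ = ∑ i, ∫ ω, ξ i ω * stein z (W ω) ∂μ := by
    rw [← integral_finsetSum _ fun i _ => i1 i]
    congr 1; ext ω; rw [hW, Finset.sum_mul]
  -- Neither centring nor unit variance is assumed here, so that truncated families are covered. The
  -- uncentred part appears as `E ξ_i` times an expectation independent of `ξ_i`.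
  have h4 : ∀ i, ∫ ω, ξ i ω * stein z (W ω) ∂μ =
      ∫ ω, ξ i ω * (∫ t in (0 : ℝ)..ξ i ω, avgDeriv μ ξ z i t) ∂μ +
        (∫ ω, ξ i ω ∂μ) * (∫ ω, stein z (W ω - ξ i ω) ∂μ) := fun i => by
    have e1 := integral_mul_increment (h.measurable i) (h.memLp i) (h.measurable_sub i)
      (h.indepFun_sub i) (continuous_stein z).measurable (measurable_steinDeriv z)
      (abs_steinDeriv_le_one z) (stein_add_sub z)
    have e2 := ((h.indepFun_sub i).comp measurable_id
      (continuous_stein z).measurable).integral_fun_mul_eq_mul_integral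
      (h.measurable i).aestronglyMeasurable
      (memLp_stein_comp (h.measurable_sub i) z).aestronglyMeasurable
    simp only [Function.comp, id] at e2
    rw [← e2]
    simp only [sub_add_cancel, mul_sub] at e1
    rw [integral_sub (i1 i) (i2 i)] at e1
    unfold avgDeriv
    linarith
  have h5 : ∀ i, ∫ ω, ξ i ω * (∫ t in (0 : ℝ)..ξ i ω, (I - avgDeriv μ ξ z i t)) ∂μ =
      (∫ ω, ξ i ω ^ 2 ∂μ) * I - ∫ ω, ξ i ω * (∫ t in (0 : ℝ)..ξ i ω, avgDeriv μ ξ z i t) ∂μ :=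
    fun i => by
    rw [← integral_mul_const, ← integral_sub ((h.memLp i).integrable_sq.mul_const _)
      (integrable_mul_primitive (measurable_avgDeriv h z i) (abs_avgDeriv_le z i)
        (h.measurable i) (h.memLp i))]
    congr 1; ext ω
    rw [intervalIntegral.integral_sub intervalIntegrable_const
      (intervalIntegrable_of_bounded (measurable_avgDeriv h z i) (abs_avgDeriv_le z i) _ _)]
    simp; ring
  rw [← h1, h2, h3]
  simp_rw [h4, h5]
  rw [Finset.sum_add_distrib, Finset.sum_sub_distrib, ← Finset.sum_mul]
  ring

end Identity

/-! ### The truncated third moment -/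

/-- `∑ E ξ² min(1, |ξ|)`. -/
def truncMoment [Fintype ι] (μ : Measure Ω) (ξ : ι → Ω → ℝ) : ℝ :=
  ∑ i, ∫ ω, ξ i ω ^ 2 * min 1 |ξ i ω| ∂μ

lemma integrable_sq_mul_min [IsProbabilityMeasure μ] {X : Ω → ℝ} (hX : Measurable X)
    (hX2 : MemLp X 2 μ) : Integrable (fun ω => X ω ^ 2 * min 1 |X ω|) μ :=
  hX2.integrable_sq.mono' (by fun_prop : Measurable _).aestronglyMeasurable
    (Eventually.of_forall fun ω => by
      rw [Real.norm_of_nonneg (by positivity)]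
      exact mul_le_of_le_one_right (sq_nonneg _) (min_le_left _ _))

lemma truncMoment_nonneg [Fintype ι] (ξ : ι → Ω → ℝ) : 0 ≤ truncMoment μ ξ :=
  Finset.sum_nonneg fun i _ => integral_nonneg fun ω => by positivity

/-- Needed because the windows `d` used below are multiples of this moment, and one divides by `d`.
-/
lemma truncMoment_pos [Fintype ι] [IsProbabilityMeasure μ] {ξ : ι → Ω → ℝ} (h : IsL2Family ξ μ)
    (hV : ∑ i, ∫ ω, ξ i ω ^ 2 ∂μ = 1) : 0 < truncMoment μ ξ := by
  refine lt_of_le_of_ne (truncMoment_nonneg ξ) fun h0 => ?_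
  have h1 := (Finset.sum_eq_zero_iff_of_nonneg fun i _ =>
    integral_nonneg fun ω => (by positivity : 0 ≤ ξ i ω ^ 2 * min 1 |ξ i ω|)).1 h0.symm
  have h2 : ∀ i, ∫ ω, ξ i ω ^ 2 ∂μ = 0 := fun i => by
    have h3 := (integral_eq_zero_iff_of_nonneg
      (fun ω => (by positivity : 0 ≤ ξ i ω ^ 2 * min 1 |ξ i ω|))
      (integrable_sq_mul_min (h.measurable i) (h.memLp i))).1 (h1 i (Finset.mem_univ i))
    refine integral_eq_zero_of_ae (h3.mono fun ω hω => ?_)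
    simp only [Pi.zero_apply, mul_eq_zero] at hω ⊢
    rcases hω with hω | hω
    · exact hω
    · have : |ξ i ω| = 0 := by
        rcases min_choice 1 |ξ i ω| with h4 | h4 <;> rw [h4] at hω
        · norm_num at hω
        · exact hω
      simp [abs_eq_zero.1 this]
  simp [h2] at hV

/-- Chebyshev's association inequality for `ξ²` and `min(1, |ξ|)`. -/
lemma integral_sq_mul_integral_min_le [IsProbabilityMeasure μ] {X : Ω → ℝ} (hX : Measurable X)
    (hX2 : MemLp X 2 μ) :
    (∫ ω, X ω ^ 2 ∂μ) * (∫ ω, min 1 |X ω| ∂μ) ≤ ∫ ω, X ω ^ 2 * min 1 |X ω| ∂μ := by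
  have hmi : Integrable (fun ω => min 1 |X ω|) μ :=
    Integrable.of_bound (by fun_prop : Measurable _).aestronglyMeasurable 1
      (Eventually.of_forall fun ω => by
        rw [Real.norm_of_nonneg (by positivity)]; exact min_le_left _ _)
  set b := ∫ ω, min 1 |X ω| ∂μ with hb
  have hb0 : 0 ≤ b := integral_nonneg fun ω => by positivity
  have hb1 : b ≤ 1 := by
    have := integral_mono hmi (integrable_const (1 : ℝ)) fun ω => min_le_left _ _
    simpa using this
  -- Expand `(x² - b²)(min 1 |x| - b) ≥ 0`, with `b = E min(1, |X|) ≤ 1`: both factors change sign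
  -- at `|x| = b`. After integration the terms in `b³` cancel, so no independent copy is needed.
  have hpt : ∀ ω, b * X ω ^ 2 + b ^ 2 * min 1 |X ω| - b ^ 3 ≤ X ω ^ 2 * min 1 |X ω| := fun ω => by
    have : 0 ≤ (X ω ^ 2 - b ^ 2) * (min 1 |X ω| - b) := by
      rw [← sq_abs (X ω)]
      rcases le_total b |X ω| with hc | hc
      · exact mul_nonneg (sub_nonneg.2 (pow_le_pow_left₀ hb0 hc 2))
          (sub_nonneg.2 (le_min hb1 hc))
      · exact mul_nonneg_of_nonpos_of_nonpos
          (sub_nonpos.2 (pow_le_pow_left₀ (abs_nonneg _) hc 2))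
          (sub_nonpos.2 ((min_le_right _ _).trans hc))
    nlinarith
  have i1 : Integrable (fun ω => b * X ω ^ 2) μ := hX2.integrable_sq.const_mul b
  have i2 : Integrable (fun ω => b ^ 2 * min 1 |X ω|) μ := hmi.const_mul _
  have := integral_mono ((i1.add i2).sub (integrable_const (b ^ 3)))
    (integrable_sq_mul_min hX hX2) hpt
  have e : ∫ ω, ((fun ω => b * X ω ^ 2) + fun ω => b ^ 2 * min 1 |X ω|) ω - b ^ 3 ∂μ =
      b * (∫ ω, X ω ^ 2 ∂μ) + b ^ 2 * b - b ^ 3 := by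
    rw [integral_sub (i1.add i2) (integrable_const _)]
    simp only [Pi.add_apply]
    rw [integral_add i1 i2, integral_const_mul, integral_const_mul]
    simp [hb]
  have h7 : b * (∫ ω, X ω ^ 2 ∂μ) + b ^ 2 * b - b ^ 3 ≤ ∫ ω, X ω ^ 2 * min 1 |X ω| ∂μ := by
    rw [← e]; exact this
  nlinarith

/-- For `|x| ≤ 1` this comes from `(|x| - 2d)² ≥ 0`, that is `|x| - x²/(4d) ≤ d`. For `|x| ≥ 1` the
left side is nonpositive because `1/(4d) ≥ 1`. Summed with total variance one and `d` half the
truncated moment, it yields the lower bound `1/2`. -/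
lemma sq_sub_le_truncProd {d : ℝ} (hd : 0 < d) (hd4 : d ≤ 1 / 4) (x : ℝ) :
    x ^ 2 - 1 / (4 * d) * (x ^ 2 * min 1 |x|) ≤ |x| * min d |x| := by
  rw [← sq_abs x]
  have h0 := abs_nonneg x
  set y := |x|
  have hk : 1 ≤ 1 / (4 * d) := by rw [le_div_iff₀ (by positivity)]; linarith
  rcases le_total y 1 with h1 | h1
  · rw [min_eq_right h1]
    have h2 : y - 1 / (4 * d) * y ^ 2 ≤ min d y := by
      refine le_min ?_ (by have : 0 ≤ 1 / (4 * d) * y ^ 2 := by positivity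
                           linarith)
      have : y - 1 / (4 * d) * y ^ 2 - d = -(1 / (4 * d)) * (y - 2 * d) ^ 2 := by
        field_simp; ring
      have h3 : 0 ≤ 1 / (4 * d) * (y - 2 * d) ^ 2 := by positivity
      linarith
    nlinarith
  · rw [min_eq_left h1]
    have : 0 ≤ y * min d y := mul_nonneg h0 (le_min hd.le h0)
    nlinarith [sq_nonneg y]

lemma sum_truncProd_ge [Fintype ι] [IsProbabilityMeasure μ] {ξ : ι → Ω → ℝ} (h : IsL2Family ξ μ)
    {d : ℝ} (hd : 0 < d) (hd4 : d ≤ 1 / 4) :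
    ∑ i, ∫ ω, ξ i ω ^ 2 ∂μ - 1 / (4 * d) * truncMoment μ ξ ≤
      ∑ i, ∫ ω, |ξ i ω| * min d |ξ i ω| ∂μ := by
  rw [truncMoment, Finset.mul_sum, ← Finset.sum_sub_distrib]
  refine Finset.sum_le_sum fun i _ => ?_
  have i1 := (integrable_sq_mul_min (h.measurable i) (h.memLp i)).const_mul (1 / (4 * d))
  rw [← integral_const_mul, ← integral_sub (h.memLp i).integrable_sq i1]
  exact integral_mono ((h.memLp i).integrable_sq.sub i1)
    ((memLp_truncProd h hd.le i).integrable (by norm_num))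
    fun ω => sq_sub_le_truncProd hd hd4 _

end NormalApprox

namespace NormalApprox

variable {Ω : Type*} [MeasurableSpace Ω] {μ : Measure Ω} {ι : Type*}

/-! ### The uniform Berry–Esseen bound -/

lemma sum_integral_omitAt [Fintype ι] [DecidableEq ι] (ξ : ι → Ω → ℝ) (i : ι) {g : ℝ → ℝ}
    (hg : g 0 = 0) :
    ∑ j, ∫ ω, g (omitAt ξ i j ω) ∂μ = ∑ j, ∫ ω, g (ξ j ω) ∂μ - ∫ ω, g (ξ i ω) ∂μ := by
  have h1 : ∀ j, ∫ ω, g (omitAt ξ i j ω) ∂μ =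
      Function.update (fun j => ∫ ω, g (ξ j ω) ∂μ) i 0 j := fun j => by
    by_cases h : j = i
    · subst h; simp [omitAt, hg]
    · simp [omitAt, h]
  simp_rw [h1]
  rw [Finset.sum_update_of_mem (Finset.mem_univ i), ← Finset.erase_eq,
    ← Finset.add_sum_erase _ _ (Finset.mem_univ i)]
  ring

lemma integral_omitAt_eq_zero [DecidableEq ι] {ξ : ι → Ω → ℝ} (h0 : ∀ i, ∫ ω, ξ i ω ∂μ = 0)
    (i j : ι) : ∫ ω, omitAt ξ i j ω ∂μ = 0 := by
  rcases omitAt_cases ξ i j with h | h <;> rw [h]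
  · exact h0 j
  · simp

/-- Concentration in a fixed interval. -/
lemma measureReal_mul_le_of_interval [Fintype ι] [IsProbabilityMeasure μ]
    {ξ : ι → Ω → ℝ} (h : IsL2Family ξ μ) (h0 : ∀ i, ∫ ω, ξ i ω ∂μ = 0)
    {d L : ℝ} (hd : 0 ≤ d) (hL : 0 ≤ L) (z : ℝ) :
    μ.real {ω | z ≤ ∑ j, ξ j ω ∧ ∑ j, ξ j ω ≤ z + L} * (∑ i, ∫ ω, |ξ i ω| * min d |ξ i ω| ∂μ) ≤
      √(∑ i, ∫ ω, ξ i ω ^ 2 ∂μ) * (L / 2 + 2 * d) := by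
  have := measureReal_mul_le_of_randomInterval h h0 (D := fun _ => L) (D' := fun _ _ => L)
    measurable_const (memLp_const L) (fun _ => measurable_const) (fun _ => memLp_const L)
    (fun _ => hL) (fun _ _ => hL)
    (fun i => (h.indepFun_sub i).comp measurable_id (ψ := fun x => (L, x))
      (by fun_prop)) hd le_rfl zero_le_one z
  simp only [zero_mul, sub_zero, sub_self, abs_zero, mul_zero, integral_zero,
    Finset.sum_const_zero, add_zero, integral_mul_const] at this
  have e1 : ∫ ω, |∑ j, ξ j ω| ∂μ ≤ √(∑ i, ∫ ω, ξ i ω ^ 2 ∂μ) := by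
    rw [← h.integral_sum_sq h0]; exact integral_abs_le_sqrt h.memLp_sum
  nlinarith

section Uniform

variable [Fintype ι] [IsProbabilityMeasure μ] {ξ : ι → Ω → ℝ}

/-- Concentration for the sum without one summand, with `d = b/2`. Removing `ξ i` lowers the
truncated products by at most `(b/2) r` and the standard deviation to at most `1 - r²/2`, where `r²
= E ξ_i²`. The second effect compensates the first up to the factor `1.02`, since `b ≤ 1/6.6`; a
uniform loss over all `r` would be too costly for the final constant. -/
lemma measureReal_sub_interval_le (h : IsL2Family ξ μ) (h0 : ∀ i, ∫ ω, ξ i ω ∂μ = 0)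
    (hV : ∑ i, ∫ ω, ξ i ω ^ 2 ∂μ = 1) (hb : truncMoment μ ξ ≤ 1 / 6.6) (i : ι) {L : ℝ}
    (hL : 0 ≤ L) (z : ℝ) :
    μ.real {ω | z ≤ ∑ j, ξ j ω - ξ i ω ∧ ∑ j, ξ j ω - ξ i ω ≤ z + L} ≤
      1.02 * (L + 2 * truncMoment μ ξ) := by
  classical
  set b := truncMoment μ ξ with hbdef
  have hb0 : 0 < b := truncMoment_pos h hV
  have hb' : b ≤ 0.1516 := hb.trans (by norm_num)
  have hc := measureReal_mul_le_of_interval (h.omitAt i) (integral_omitAt_eq_zero h0 i)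
    (d := b / 2) (by positivity) hL z
  simp only [sum_omitAt] at hc
  rw [sum_integral_omitAt ξ i (g := fun x => |x| * min (b / 2) |x|) (by simp),
    sum_integral_omitAt ξ i (g := fun x => x ^ 2) (by simp), hV] at hc
  have hS := sum_truncProd_ge h (d := b / 2) (by positivity) (by linarith)
  rw [hV, ← hbdef, show 1 / (4 * (b / 2)) * b = 1 / 2 by field_simp; norm_num] at hS
  set s := ∫ ω, ξ i ω ^ 2 ∂μ with hs
  have hs0 : 0 ≤ s := integral_nonneg fun ω => sq_nonneg _
  have hs1 : s ≤ 1 := by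
    rw [← hV]
    exact Finset.single_le_sum (f := fun i => ∫ ω, ξ i ω ^ 2 ∂μ)
      (fun j _ => integral_nonneg fun ω => sq_nonneg _) (Finset.mem_univ i)
  set r := √s with hr
  have hr0 : 0 ≤ r := Real.sqrt_nonneg s
  have hrs : r ^ 2 = s := Real.sq_sqrt hs0
  have hi : ∫ ω, |ξ i ω| * min (b / 2) |ξ i ω| ∂μ ≤ b / 2 * r := by
    calc ∫ ω, |ξ i ω| * min (b / 2) |ξ i ω| ∂μ ≤ ∫ ω, b / 2 * |ξ i ω| ∂μ :=
          integral_mono ((memLp_truncProd h (by positivity) i).integrable (by norm_num))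
            (((h.memLp i).integrable (by norm_num)).abs.const_mul _)
            fun ω => (truncProd_bounds (by positivity) _).2
      _ = b / 2 * ∫ ω, |ξ i ω| ∂μ := integral_const_mul _ _
      _ ≤ _ := by gcongr; exact integral_abs_le_sqrt (h.memLp i)
  have hsq : √(1 - s) ≤ 1 - s / 2 := by
    rw [Real.sqrt_le_iff]; constructor <;> nlinarith
  set P := μ.real {ω | z ≤ ∑ j, ξ j ω - ξ i ω ∧ ∑ j, ξ j ω - ξ i ω ≤ z + L} with hP
  have hP0 : 0 ≤ P := measureReal_nonneg
  have h1 : P * (1 / 2 * (1 - b * r)) ≤ (1 - s / 2) * (L / 2 + b) := by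
    calc P * (1 / 2 * (1 - b * r)) ≤ P * (∑ j, ∫ ω, |ξ j ω| * min (b / 2) |ξ j ω| ∂μ -
          ∫ ω, |ξ i ω| * min (b / 2) |ξ i ω| ∂μ) := by
          gcongr; linarith
      _ ≤ _ := hc
      _ ≤ (1 - s / 2) * (L / 2 + b) := by
          rw [show 2 * (b / 2) = b by ring]; gcongr
  have hr1 : r ≤ 1 := by nlinarith
  have h2 : 1 - s / 2 ≤ 1.02 * (1 - b * r) := by
    rw [← hrs]; nlinarith [sq_nonneg (r - 0.155)]
  have h3 : 0 < 1 - b * r := by nlinarith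
  have h4 : (1 - s / 2) * (L / 2 + b) ≤ 1.02 * (1 - b * r) * (L / 2 + b) := by gcongr
  have h5 : (P - 1.02 * (L + 2 * b)) * (1 - b * r) ≤ 0 := by nlinarith
  by_contra hcon
  have := mul_pos (sub_pos.2 (not_le.1 hcon)) h3
  linarith

/-- Increments of the averaged Stein derivative. -/
lemma avgDeriv_sub_le (h : IsL2Family ξ μ) (h0 : ∀ i, ∫ ω, ξ i ω ∂μ = 0)
    (hV : ∑ i, ∫ ω, ξ i ω ^ 2 ∂μ = 1) (hb : truncMoment μ ξ ≤ 1 / 6.6) (z : ℝ) (i : ι)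
    (x t : ℝ) :
    avgDeriv μ ξ z i x - avgDeriv μ ξ z i t ≤
      1.63 * (min 1 (max x 0) + max (-t) 0) + 1.02 * (max t 0 + min 1 (max (-x) 0)) +
        2.04 * truncMoment μ ξ := by
  have hb0 := truncMoment_nonneg (μ := μ) ξ
  have hYm := h.measurable_sub i
  set Y : Ω → ℝ := fun ω => ∑ j, ξ j ω - ξ i ω with hY
  have hint : ∀ u : ℝ, Integrable (fun ω => steinDeriv z (Y ω + u)) μ := fun u =>
    integrable_steinDeriv_comp (Y := fun ω => Y ω + u) (hYm.add_const u) z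
  have hdiff : avgDeriv μ ξ z i x - avgDeriv μ ξ z i t =
      ∫ ω, (steinDeriv z (Y ω + x) - steinDeriv z (Y ω + t)) ∂μ :=
    (integral_sub (hint x) (hint t)).symm
  have hone : avgDeriv μ ξ z i x - avgDeriv μ ξ z i t ≤ 1 := by
    rw [hdiff]
    calc _ ≤ ∫ ω, (1 : ℝ) ∂μ := integral_mono ((hint x).sub (hint t)) (integrable_const _)
          fun ω => steinDeriv_sub_le_one z _ _
      _ = 1 := by simp
  have p1 := le_max_right x 0
  have p2 := le_max_right (-x) 0
  have p3 := le_max_right t 0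
  have p4 := le_max_right (-t) 0
  have q1 : 0 ≤ min 1 (max x 0) := le_min zero_le_one p1
  have q2 : 0 ≤ min 1 (max (-x) 0) := le_min zero_le_one p2
  rcases le_or_gt 1 x with hx | hx
  · rw [min_eq_left (hx.trans (le_max_left x 0))]
    nlinarith
  rcases le_or_gt x (-1) with hx' | hx'
  · rw [min_eq_left (a := 1) (b := max (-x) 0) (le_trans (by linarith) (le_max_left (-x) 0))]
    nlinarith
  rw [min_eq_right (max_le hx.le zero_le_one), min_eq_right (max_le (by linarith) zero_le_one)]
  -- The two parts of the Stein derivative are monotone in opposite directions. If `t ≤ x` the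
  -- indicator part only helps, and `1.63` is `E|Y| + 0.63` with `E|Y| ≤ 1`. If `x < t` the part `w
  -- f(w)` only helps, and the indicator part is a probability handled by concentration.
  rcases le_or_gt t x with htx | htx
  · have hE : ∫ ω, |Y ω| ∂μ ≤ 1 := by
      classical
      refine (integral_abs_le_sqrt (h.memLp_sub i)).trans ?_
      rw [Real.sqrt_le_one]
      have := (h.omitAt i).integral_sum_sq (integral_omitAt_eq_zero h0 i)
      simp only [sum_omitAt] at this
      rw [this, sum_integral_omitAt ξ i (g := fun x => x ^ 2) (by simp), hV]
      have : 0 ≤ ∫ ω, ξ i ω ^ 2 ∂μ := integral_nonneg fun ω => sq_nonneg _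
      linarith
    have hYi : Integrable (fun ω => |Y ω|) μ := ((h.memLp_sub i).integrable (by norm_num)).abs
    have : avgDeriv μ ξ z i x - avgDeriv μ ξ z i t ≤ 1.63 * (max x 0 + max (-t) 0) := by
      rw [hdiff]
      calc _ ≤ ∫ ω, (|Y ω| + 0.63) * (max x 0 + max (-t) 0) ∂μ := by
            refine integral_mono ((hint x).sub (hint t))
              ((hYi.add (integrable_const _)).mul_const _) fun ω => ?_
            have h1 := mul_stein_sub_le z (Y ω) x t htx
            have h2 : centredInd z (Y ω + x) ≤ centredInd z (Y ω + t) := by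
              unfold centredInd
              split_ifs with c1 c2
              · rfl
              · exact absurd ((add_le_add_right htx _).trans c1) c2
              · linarith
              · rfl
            simp only [steinDeriv]
            linarith
        _ = ((∫ ω, |Y ω| ∂μ) + 0.63) * (max x 0 + max (-t) 0) := by
            rw [integral_mul_const, integral_add hYi (integrable_const _)]; simp
        _ ≤ 1.63 * (max x 0 + max (-t) 0) := by
            gcongr; linarith
    nlinarith
  · have hset : MeasurableSet {ω | z - t ≤ Y ω ∧ Y ω ≤ z - t + (t - x)} :=
      (measurableSet_le measurable_const hYm).inter (measurableSet_le hYm measurable_const)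
    have h1 : avgDeriv μ ξ z i x - avgDeriv μ ξ z i t ≤
        μ.real {ω | z - t ≤ Y ω ∧ Y ω ≤ z - t + (t - x)} := by
      rw [hdiff]
      calc _ ≤ ∫ ω, {ω | z - t ≤ Y ω ∧ Y ω ≤ z - t + (t - x)}.indicator (fun _ => (1 : ℝ)) ω ∂μ := by
            refine integral_mono ((hint x).sub (hint t)) ((integrable_const _).indicator hset)
              fun ω => ?_
            have h1 := monotone_mul_stein z (add_le_add_right htx.le (Y ω))
            simp only at h1
            simp only [steinDeriv, centredInd, indicator, mem_ofPred_eq]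
            split_ifs with c1 c2 c3 c3 c2 c3 c3 <;> try linarith
            exact absurd ⟨by linarith, by linarith⟩ c3
        _ = _ := by rw [integral_indicator hset]; simp
    have h2 := measureReal_sub_interval_le h h0 hV hb i (L := t - x) (by linarith) (z - t)
    have h3 : t - x ≤ max t 0 + max (-x) 0 := by
      linarith [le_max_left t 0, le_max_left (-x) 0]
    have h4 := h1.trans h2
    nlinarith

/-- A one-sided linear bound on `R`, together with `R ≤ 1`, controls `x ∫₀ˣ R`. -/
lemma mul_integral_le_of_linear {R : ℝ → ℝ} (hR : Measurable R) {C : ℝ} (hC : ∀ x, |R x| ≤ C)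
    {A : ℝ} (hA : 0 ≤ A) (h1 : ∀ t, R t ≤ 1) (h2 : ∀ t, R t ≤ A + 2 * |t|) (x : ℝ) :
    x * (∫ t in (0 : ℝ)..x, R t) ≤ A * x ^ 2 + x ^ 2 * min 1 |x| := by
  have key : ∀ {R : ℝ → ℝ}, Measurable R → (∀ x, |R x| ≤ C) → (∀ t, R t ≤ 1) →
      (∀ t, R t ≤ A + 2 * |t|) → ∀ {x : ℝ}, 0 ≤ x →
      x * (∫ t in (0 : ℝ)..x, R t) ≤ A * x ^ 2 + x ^ 2 * min 1 x := by
    intro R hR hC h1 h2 x hx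
    have hi := intervalIntegrable_of_bounded hR hC 0 x
    rcases le_total 1 x with hx1 | hx1
    · rw [min_eq_left hx1]
      have : ∫ t in (0 : ℝ)..x, R t ≤ ∫ t in (0 : ℝ)..x, (1 : ℝ) :=
        intervalIntegral.integral_mono_on hx hi intervalIntegrable_const fun t _ => h1 t
      rw [intervalIntegral.integral_const, smul_eq_mul, mul_one, sub_zero] at this
      nlinarith [mul_nonneg hA (sq_nonneg x)]
    · rw [min_eq_right hx1]
      have : ∫ t in (0 : ℝ)..x, R t ≤ ∫ t in (0 : ℝ)..x, (A + 2 * t) := by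
        refine intervalIntegral.integral_mono_on hx hi
          (Continuous.intervalIntegrable (by fun_prop) _ _) fun t ht => ?_
        have := h2 t
        rwa [abs_of_nonneg ht.1] at this
      have e : ∫ t in (0 : ℝ)..x, (A + 2 * t) = A * x + x ^ 2 := by
        rw [intervalIntegral.integral_add intervalIntegrable_const
          (Continuous.intervalIntegrable (by fun_prop) _ _), intervalIntegral.integral_const_mul,
          integral_id]
        simp; ring
      rw [e] at this
      nlinarith
  rcases le_total 0 x with hx | hx
  · rw [abs_of_nonneg hx]; exact key hR hC h1 h2 hx
  · have := key (R := fun t => R (-t)) (hR.comp measurable_neg) (fun x => hC _) (fun t => h1 _)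
      (fun t => by simpa using h2 (-t)) (neg_nonneg.2 hx)
    rw [intervalIntegral.integral_comp_neg (fun t => R t), neg_neg, neg_zero,
      intervalIntegral.integral_symm] at this
    rw [abs_of_nonpos hx]
    nlinarith

/-- Second moments against the truncated positive and negative parts of a centred variable. -/
lemma integral_sq_mul_parts_le {X : Ω → ℝ} (hX : Measurable X) (hX2 : MemLp X 2 μ)
    (h0 : ∫ ω, X ω ∂μ = 0) (hs1 : ∫ ω, X ω ^ 2 ∂μ ≤ 1) :
    (∫ ω, X ω ^ 2 ∂μ) * (1.63 * (∫ ω, min 1 (max (X ω) 0) ∂μ) +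
      1.02 * ∫ ω, min 1 (max (-X ω) 0) ∂μ) ≤ 1.42 * ∫ ω, X ω ^ 2 * min 1 |X ω| ∂μ := by
  have hX1 : Integrable X μ := hX2.integrable (by norm_num)
  have hb : ∀ f : ℝ → ℝ, Measurable f → (∀ x, 0 ≤ f x) →
      Integrable (fun ω => min 1 (f (X ω))) μ := fun f hf hf0 =>
    Integrable.of_bound ((measurable_const.min (hf.comp hX))).aestronglyMeasurable 1
      (Eventually.of_forall fun ω => by
        rw [Real.norm_of_nonneg (le_min zero_le_one (hf0 _))]; exact min_le_left _ _)
  have ip := hb (fun x => max x 0) (by fun_prop) fun x => le_max_right _ _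
  have iq := hb (fun x => max (-x) 0) (by fun_prop) fun x => le_max_right _ _
  have ie := hb (fun x => |x|) (by fun_prop) fun x => abs_nonneg _
  have im := integrable_sq_mul_min hX hX2
  set s := ∫ ω, X ω ^ 2 ∂μ with hs
  have hs0 : 0 ≤ s := integral_nonneg fun ω => sq_nonneg _
  set b := ∫ ω, X ω ^ 2 * min 1 |X ω| ∂μ with hbd
  set p := ∫ ω, min 1 (max (X ω) 0) ∂μ with hp
  set q := ∫ ω, min 1 (max (-X ω) 0) ∂μ with hq
  have hb0 : 0 ≤ b := integral_nonneg fun ω => by positivity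
  have hass : s * (∫ ω, min 1 |X ω| ∂μ) ≤ b := integral_sq_mul_integral_min_le hX hX2
  have he : p + q = ∫ ω, min 1 |X ω| ∂μ := by
    rw [hp, hq, ← integral_add ip iq]
    congr 1; ext ω
    rcases le_total 0 (X ω) with h | h
    · rw [max_eq_left h, max_eq_right (neg_nonpos.2 h), abs_of_nonneg h]; simp
    · rw [max_eq_right h, max_eq_left (neg_nonneg.2 h), abs_of_nonpos h]; simp
  -- Centring makes the truncated positive and negative parts nearly equal, so `1.63` and `1.02`
  -- enter through their mean: `1.63 p + 1.02 q = 1.325 (p + q) + 0.305 (p - q)`. This is how `1.42`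
  -- is reached in place of `1.63`.
  have hpq : p ≤ q + 1 / 4 * b := by
    have hpt : ∀ ω, min 1 (max (X ω) 0) ≤
        X ω + min 1 (max (-X ω) 0) + 1 / 4 * (X ω ^ 2 * min 1 |X ω|) := fun ω => by
      rcases le_total 0 (X ω) with h | h
      · rw [max_eq_left h, max_eq_right (neg_nonpos.2 h)]
        have : 0 ≤ X ω ^ 2 * min 1 |X ω| := by positivity
        have := min_le_right 1 (X ω)
        have e0 : min (1 : ℝ) 0 = 0 := by simp
        rw [abs_of_nonneg h] at *
        rw [e0]; linarith
      · rw [max_eq_right h, max_eq_left (neg_nonneg.2 h), abs_of_nonpos h]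
        rcases le_total 1 (-X ω) with h' | h'
        · rw [min_eq_left h']; simp; nlinarith [sq_nonneg (X ω + 2)]
        · rw [min_eq_right h']
          have : 0 ≤ X ω ^ 2 * -X ω := mul_nonneg (sq_nonneg _) (by linarith)
          simp; linarith
    have := integral_mono ip ((hX1.add iq).add (im.const_mul (1 / 4))) hpt
    have e : ∫ ω, (X ω + min 1 (max (-X ω) 0) + 1 / 4 * (X ω ^ 2 * min 1 |X ω|)) ∂μ =
        q + 1 / 4 * b := by
      calc _ = ∫ ω, (X ω + min 1 (max (-X ω) 0)) ∂μ +
            ∫ ω, 1 / 4 * (X ω ^ 2 * min 1 |X ω|) ∂μ :=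
            integral_add (hX1.add iq) (im.const_mul _)
        _ = q + 1 / 4 * b := by rw [integral_add hX1 iq, integral_const_mul, h0, zero_add]
    rw [← e]; exact this
  rw [← he] at hass
  have h6 : s * b ≤ b := mul_le_of_le_one_left hb0 hs1
  nlinarith

/-- The one-sided uniform Berry–Esseen bound. -/
lemma measureReal_sub_Phi_le (h : IsL2Family ξ μ) (h0 : ∀ i, ∫ ω, ξ i ω ∂μ = 0)
    (hV : ∑ i, ∫ ω, ξ i ω ^ 2 ∂μ = 1) (hb : truncMoment μ ξ ≤ 1 / 6.6) (z : ℝ) :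
    μ.real {ω | ∑ j, ξ j ω ≤ z} - Phi z ≤ 4.6 * truncMoment μ ξ := by
  have hb0 := truncMoment_nonneg (μ := μ) ξ
  rw [measureReal_sub_Phi_eq h z, hV, sub_self, zero_mul, add_zero]
  simp only [h0, zero_mul, Finset.sum_const_zero, sub_zero]
  set b := truncMoment μ ξ with hbd
  set s : ι → ℝ := fun i => ∫ ω, ξ i ω ^ 2 ∂μ with hs
  set β : ι → ℝ := fun i => ∫ ω, ξ i ω ^ 2 * min 1 |ξ i ω| ∂μ with hβ
  have hs1 : ∀ i, s i ≤ 1 := fun i => by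
    rw [← hV]
    exact Finset.single_le_sum (f := s)
      (fun j _ => integral_nonneg fun ω => sq_nonneg _) (Finset.mem_univ i)
  -- Here `2.42 = 1.42 + 1`: the constant part `A` of the bound on the integrand and its linear part
  -- `2|t|`. Together with `2.04` the total is `4.46`.
  have hterm : ∀ i, ∫ ω, ξ i ω * (∫ t in (0 : ℝ)..ξ i ω,
      ((∫ ω', steinDeriv z (∑ j, ξ j ω') ∂μ) - avgDeriv μ ξ z i t)) ∂μ ≤
      2.42 * β i + 2.04 * b * s i := fun i => by
    set A : ℝ := 1.63 * (∫ ω, min 1 (max (ξ i ω) 0) ∂μ) +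
      1.02 * (∫ ω, min 1 (max (-ξ i ω) 0) ∂μ) + 2.04 * b with hA
    have hbI : ∀ f : ℝ → ℝ, Measurable f → (∀ x, 0 ≤ f x) →
        Integrable (fun ω => min 1 (f (ξ i ω))) μ := fun f hf hf0 =>
      Integrable.of_bound ((measurable_const.min (hf.comp (h.measurable i)))).aestronglyMeasurable
        1 (Eventually.of_forall fun ω => by
          rw [Real.norm_of_nonneg (le_min zero_le_one (hf0 _))]; exact min_le_left _ _)
    have ip := hbI (fun x => max x 0) (by fun_prop) fun x => le_max_right _ _
    have iq := hbI (fun x => max (-x) 0) (by fun_prop) fun x => le_max_right _ _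
    have hA0 : 0 ≤ A := by
      have h1 : 0 ≤ ∫ ω, min 1 (max (ξ i ω) 0) ∂μ := integral_nonneg fun ω => by positivity
      have h2 : 0 ≤ ∫ ω, min 1 (max (-ξ i ω) 0) ∂μ := integral_nonneg fun ω => by positivity
      positivity
    have hRm : Measurable fun t => (∫ ω', steinDeriv z (∑ j, ξ j ω') ∂μ) - avgDeriv μ ξ z i t :=
      (measurable_avgDeriv h z i).const_sub _
    have hRC : ∀ t, |(∫ ω', steinDeriv z (∑ j, ξ j ω') ∂μ) - avgDeriv μ ξ z i t| ≤ 2 := fun t => by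
      have h1 : |∫ ω', steinDeriv z (∑ j, ξ j ω') ∂μ| ≤ 1 :=
        abs_integral_le_of_bound fun ω => abs_steinDeriv_le_one z _
      have := (abs_sub _ _).trans (add_le_add h1 (abs_avgDeriv_le (μ := μ) (ξ := ξ) z i t))
      linarith
    have hint : Integrable (fun ω => avgDeriv μ ξ z i (ξ i ω)) μ :=
      Integrable.of_bound
        ((measurable_avgDeriv h z i).comp (h.measurable i)).aestronglyMeasurable 1
        (Eventually.of_forall fun ω => abs_avgDeriv_le z i _)
    -- The full expectation is the average of `avgDeriv` over the law of `ξ i`, so its distance to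
    -- the value at `t` is an average of increments.
    have hRe : ∀ t, (∫ ω', steinDeriv z (∑ j, ξ j ω') ∂μ) - avgDeriv μ ξ z i t =
        ∫ ω, (avgDeriv μ ξ z i (ξ i ω) - avgDeriv μ ξ z i t) ∂μ := fun t => by
      rw [integral_steinDeriv_sum h z i, integral_sub hint (integrable_const _)]
      simp
    have hR1 : ∀ t, (∫ ω', steinDeriv z (∑ j, ξ j ω') ∂μ) - avgDeriv μ ξ z i t ≤ 1 := fun t => by
      have hi2 : ∀ Y : Ω → ℝ, Measurable Y → Integrable (fun ω => steinDeriv z (Y ω)) μ :=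
        fun Y hY => integrable_steinDeriv_comp hY z
      unfold avgDeriv
      rw [← integral_sub (hi2 _ h.measurable_sum) (hi2 _ ((h.measurable_sub i).add_const t))]
      calc _ ≤ ∫ ω, (1 : ℝ) ∂μ := integral_mono ((hi2 _ h.measurable_sum).sub
            (hi2 _ ((h.measurable_sub i).add_const t))) (integrable_const _)
            fun ω => steinDeriv_sub_le_one z _ _
        _ = 1 := by simp
    have hR2 : ∀ t, (∫ ω', steinDeriv z (∑ j, ξ j ω') ∂μ) - avgDeriv μ ξ z i t ≤ A + 2 * |t| :=
      fun t => by
      rw [hRe]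
      calc _ ≤ ∫ ω, (1.63 * min 1 (max (ξ i ω) 0) + 1.02 * min 1 (max (-ξ i ω) 0) +
            (1.63 * max (-t) 0 + 1.02 * max t 0 + 2.04 * b)) ∂μ := by
            refine integral_mono (hint.sub (integrable_const _))
              (((ip.const_mul _).add (iq.const_mul _)).add (integrable_const _)) fun ω => ?_
            have := avgDeriv_sub_le h h0 hV hb z i (ξ i ω) t
            simp only; linarith
        _ = A + (1.63 * max (-t) 0 + 1.02 * max t 0) := by
            calc _ = ∫ ω, (1.63 * min 1 (max (ξ i ω) 0) + 1.02 * min 1 (max (-ξ i ω) 0)) ∂μ +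
                  ∫ _, (1.63 * max (-t) 0 + 1.02 * max t 0 + 2.04 * b) ∂μ :=
                  integral_add ((ip.const_mul _).add (iq.const_mul _)) (integrable_const _)
              _ = _ := by
                  rw [integral_add (ip.const_mul _) (iq.const_mul _), integral_const_mul,
                    integral_const_mul, integral_const, probReal_univ, one_smul, hA]
                  ring
        _ ≤ A + 2 * |t| := by
            rcases le_total 0 t with ht | ht
            · rw [max_eq_left ht, max_eq_right (neg_nonpos.2 ht), abs_of_nonneg ht]; linarith
            · rw [max_eq_right ht, max_eq_left (neg_nonneg.2 ht), abs_of_nonpos ht]; linarith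
    have im := integrable_sq_mul_min (h.measurable i) (h.memLp i)
    calc _ ≤ ∫ ω, (A * ξ i ω ^ 2 + ξ i ω ^ 2 * min 1 |ξ i ω|) ∂μ :=
          integral_mono (integrable_mul_primitive hRm hRC (h.measurable i) (h.memLp i))
            (((h.memLp i).integrable_sq.const_mul _).add im)
            fun ω => mul_integral_le_of_linear hRm hRC hA0 hR1 hR2 _
      _ = A * s i + β i := by
          rw [integral_add ((h.memLp i).integrable_sq.const_mul _) im, integral_const_mul]
      _ ≤ _ := by
          have := integral_sq_mul_parts_le (h.measurable i) (h.memLp i) (h0 i) (hs1 i)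
          simp only [hs, hβ, hA] at *
          nlinarith
  calc _ ≤ ∑ i, (2.42 * β i + 2.04 * b * s i) := Finset.sum_le_sum fun i _ => hterm i
    _ = 2.42 * b + 2.04 * b * 1 := by
        rw [Finset.sum_add_distrib, ← Finset.mul_sum, ← Finset.mul_sum, hV]; rfl
    _ ≤ 4.6 * b := by linarith

lemma IsL2Family.neg (h : IsL2Family ξ μ) : IsL2Family (fun i ω => -ξ i ω) μ :=
  h.map (g := fun _ x => -x) (fun _ => measurable_neg) fun _ x => (abs_neg x).le

lemma truncMoment_neg (ξ : ι → Ω → ℝ) :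
    truncMoment μ (fun i ω => -ξ i ω) = truncMoment μ ξ := by
  simp [truncMoment]

/-- The uniform Berry–Esseen bound. -/
theorem abs_measureReal_sub_Phi_le (h : IsL2Family ξ μ) (h0 : ∀ i, ∫ ω, ξ i ω ∂μ = 0)
    (hV : ∑ i, ∫ ω, ξ i ω ^ 2 ∂μ = 1) (hb : truncMoment μ ξ ≤ 1 / 6.6) (z : ℝ) :
    |μ.real {ω | ∑ j, ξ j ω ≤ z} - Phi z| ≤ 4.6 * truncMoment μ ξ := by
  rw [abs_le]
  refine ⟨?_, measureReal_sub_Phi_le h h0 hV hb z⟩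
  -- The lower bound is the upper bound for `-W` at `-z`. A possible atom at `z` is harmless, since
  -- the closed half-lines cover the line and their probabilities add up to at least one.
  have h1 := measureReal_sub_Phi_le h.neg (fun i => by rw [integral_neg, h0 i, neg_zero])
    (by simpa using hV) (by rw [truncMoment_neg]; exact hb) (-z)
  rw [truncMoment_neg, Phi_neg] at h1
  simp only [Finset.sum_neg_distrib, neg_le_neg_iff] at h1
  have hset : MeasurableSet {ω | ∑ j, ξ j ω ≤ z} :=
    measurableSet_le h.measurable_sum measurable_const
  have h2 : 1 ≤ μ.real {ω | ∑ j, ξ j ω ≤ z} + μ.real {ω | z ≤ ∑ j, ξ j ω} := by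
    have e : μ.real (univ : Set Ω) = 1 := by simp
    rw [← e]
    refine (measureReal_mono ?_).trans (measureReal_union_le _ _)
    intro ω _
    rcases le_total (∑ j, ξ j ω) z with hc | hc
    · exact Or.inl hc
    · exact Or.inr hc
  linarith

/-- Comparison of two probabilities through the symmetric difference. -/
lemma abs_measureReal_sub_le {A B : Set Ω} (hA : MeasurableSet A) (hB : MeasurableSet B) {c : ℝ}
    (h1 : μ.real (A \ B) ≤ c) (h2 : μ.real (B \ A) ≤ c) : |μ.real A - μ.real B| ≤ c := by
  have e1 := measureReal_sdiff_add_inter (μ := μ) (s := A) hB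
  have e2 := measureReal_sdiff_add_inter (μ := μ) (s := B) hA
  rw [inter_comm B A] at e2
  have e3 : 0 ≤ μ.real (A \ B) := measureReal_nonneg
  have e4 : 0 ≤ μ.real (B \ A) := measureReal_nonneg
  rw [abs_le]
  constructor <;> linarith

/-- The uniform normal approximation of a perturbed sum of independent random variables. -/
theorem abs_measureReal_add_sub_Phi_le (h : IsL2Family ξ μ) (h0 : ∀ i, ∫ ω, ξ i ω ∂μ = 0)
    (hV : ∑ i, ∫ ω, ξ i ω ^ 2 ∂μ = 1) {T : Ω → ℝ} {T' : ι → Ω → ℝ} (hTm : Measurable T)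
    (hT : MemLp T 2 μ) (hTm' : ∀ i, Measurable (T' i)) (hT' : ∀ i, MemLp (T' i) 2 μ)
    (hind : ∀ i, IndepFun (ξ i) (fun ω => (T' i ω, ∑ j, ξ j ω - ξ i ω)) μ) (z : ℝ) :
    |μ.real {ω | ∑ j, ξ j ω + T ω ≤ z} - Phi z| ≤
      6.6 * truncMoment μ ξ + ∫ ω, |∑ j, ξ j ω| * |T ω| ∂μ +
        ∑ i, ∫ ω, |ξ i ω| * |T ω - T' i ω| ∂μ := by
  have n1 : 0 ≤ ∫ ω, |∑ j, ξ j ω| * |T ω| ∂μ := integral_nonneg fun ω => by positivity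
  have n2 : 0 ≤ ∑ i, ∫ ω, |ξ i ω| * |T ω - T' i ω| ∂μ :=
    Finset.sum_nonneg fun i _ => integral_nonneg fun ω => by positivity
  have hb0 := truncMoment_pos h hV
  rcases le_or_gt (truncMoment μ ξ) (1 / 6.6) with hb | hb
  · have hBE := abs_measureReal_sub_Phi_le h h0 hV hb z
    set b := truncMoment μ ξ with hbd
    have hb' : b ≤ 0.1516 := hb.trans (by norm_num)
    have hS := sum_truncProd_ge h (d := b / 2) (by positivity) (by linarith)
    rw [hV, ← hbd, show 1 / (4 * (b / 2)) * b = 1 / 2 by field_simp; norm_num] at hS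
    -- The interval is `[z, z + |T|]` for `a = 0` and `[z - |T|, z]` for `a = 1`, one for each half
    -- of the symmetric difference. With `d = b/2` the truncated products sum to at least `1/2`, so
    -- the error `2d` becomes `2b`, and `4.6 + 2 = 6.6`.
    have key : ∀ a : ℝ, 0 ≤ a → a ≤ 1 →
        μ.real {ω | z - a * |T ω| ≤ ∑ j, ξ j ω ∧ ∑ j, ξ j ω ≤ z - a * |T ω| + |T ω|} ≤
        (∫ ω, |∑ j, ξ j ω| * |T ω| ∂μ) + (∑ i, ∫ ω, |ξ i ω| * |T ω - T' i ω| ∂μ) + 2 * b := by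
      intro a ha0 ha1
      have hc := measureReal_mul_le_of_randomInterval h h0 (D := fun ω => |T ω|)
        (D' := fun i ω => |T' i ω|) (hTm.abs) hT.abs (fun i => (hTm' i).abs)
        (fun i => (hT' i).abs) (fun ω => abs_nonneg _) (fun i ω => abs_nonneg _)
        (fun i => (hind i).comp measurable_id (ψ := fun p : ℝ × ℝ => (|p.1|, p.2)) (by fun_prop))
        (d := b / 2) (by positivity) ha0 ha1 z
      rw [hV, Real.sqrt_one] at hc
      have h2 : ∑ i, ∫ ω, |ξ i ω| * |(|T ω| - |T' i ω|)| ∂μ ≤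
          ∑ i, ∫ ω, |ξ i ω| * |T ω - T' i ω| ∂μ := by
        refine Finset.sum_le_sum fun i _ => ?_
        refine integral_mono
          (MemLp.integrable_fun_mul (h.memLp i).abs (hT.abs.sub (hT' i).abs).abs)
          (MemLp.integrable_fun_mul (h.memLp i).abs (hT.sub (hT' i)).abs) fun ω => ?_
        exact mul_le_mul_of_nonneg_left (abs_abs_sub_abs_le _ _) (abs_nonneg _)
      have h3 : 0 ≤ μ.real {ω | z - a * |T ω| ≤ ∑ j, ξ j ω ∧
        ∑ j, ξ j ω ≤ z - a * |T ω| + |T ω|} := measureReal_nonneg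
      nlinarith
    have hcmp : |μ.real {ω | ∑ j, ξ j ω + T ω ≤ z} - μ.real {ω | ∑ j, ξ j ω ≤ z}| ≤
        (∫ ω, |∑ j, ξ j ω| * |T ω| ∂μ) + (∑ i, ∫ ω, |ξ i ω| * |T ω - T' i ω| ∂μ) + 2 * b := by
      have hTs : MeasurableSet {ω | ∑ j, ξ j ω + T ω ≤ z} :=
        measurableSet_le (h.measurable_sum.add hTm) measurable_const
      refine abs_measureReal_sub_le hTs
        (measurableSet_le h.measurable_sum measurable_const)
        ((measureReal_mono ?_).trans (key 0 le_rfl zero_le_one))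
        ((measureReal_mono ?_).trans (key 1 zero_le_one le_rfl))
      · rintro ω ⟨h1, h2⟩
        simp only [mem_ofPred_eq, not_le] at h1 h2 ⊢
        constructor <;> linarith [neg_abs_le (T ω)]
      · rintro ω ⟨h1, h2⟩
        simp only [mem_ofPred_eq, not_le] at h1 h2 ⊢
        constructor <;> linarith [le_abs_self (T ω)]
    rw [abs_le] at *
    constructor <;> linarith
  · have h1 : 1 ≤ 6.6 * truncMoment μ ξ := by
      rw [div_lt_iff₀ (by norm_num)] at hb; linarith
    have h2 : |μ.real {ω | ∑ j, ξ j ω + T ω ≤ z} - Phi z| ≤ 1 := by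
      have a1 : μ.real {ω | ∑ j, ξ j ω + T ω ≤ z} ≤ 1 := measureReal_le_one
      have a2 : 0 ≤ μ.real {ω | ∑ j, ξ j ω + T ω ≤ z} := measureReal_nonneg
      have a3 := Phi_nonneg z
      have a4 := Phi_le_one z
      rw [abs_le]; constructor <;> linarith
    linarith

end Uniform

end NormalApprox

namespace NormalApprox

variable {Ω : Type*} [MeasurableSpace Ω] {μ : Measure Ω} {ι : Type*}

/-! ### Bounded families and exponential moments -/

/-- Independent variables bounded by `1/2`, with small means and total second moment at
most one. -/
structure IsBoundedFamily [Fintype ι] (η : ι → Ω → ℝ) (e : ι → ℝ) (μ : Measure Ω) : Prop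
    extends IsL2Family η μ where
  bdd : ∀ i ω, |η i ω| ≤ 1 / 2
  mean : ∀ i, |∫ ω, η i ω ∂μ| ≤ e i
  sum_mean : ∑ i, e i ≤ 1 / 20
  sum_sq : ∑ i, ∫ ω, η i ω ^ 2 ∂μ ≤ 1

lemma memLp_comp_of_bounded [IsProbabilityMeasure μ] {f : ℝ → ℝ} (hf : Continuous f) {Y : Ω → ℝ}
    (hY : Measurable Y) {K : ℝ} (hK : ∀ ω, |Y ω| ≤ K) (p : ℝ≥0∞) :
    MemLp (fun ω => f (Y ω)) p μ := by
  obtain ⟨C, hC⟩ := (isCompact_Icc (a := -K) (b := K)).exists_bound_of_continuousOn hf.continuousOn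
  exact MemLp.of_bound (hf.measurable.comp hY).aestronglyMeasurable C
    (Eventually.of_forall fun ω => hC _ (abs_le.1 (hK ω)))

lemma exp_le_one_add_add_sq {x : ℝ} (hx : |x| ≤ 1) : Real.exp x ≤ 1 + x + x ^ 2 := by
  have := (abs_le.1 (Real.abs_exp_sub_one_sub_id_le hx)).2
  linarith

/-- Maximising `w² exp (-|w|)` gives `4 exp (-2) < 0.55`, and `exp (|w| + w) ≤ exp (2w) + 1`. It
reduces the second moment of `|W| exp (W/2)` to the exponential moment at `2`. -/
lemma sq_mul_exp_le (w : ℝ) : w ^ 2 * Real.exp w ≤ 0.55 * (Real.exp (2 * w) + 1) := by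
  have h1 : |w| / 2 ≤ Real.exp (|w| / 2 - 1) := by
    have := Real.add_one_le_exp (|w| / 2 - 1); linarith
  have h2 : w ^ 2 ≤ 4 * Real.exp (-2) * Real.exp |w| := by
    have h3 := pow_le_pow_left₀ (by positivity) h1 2
    rw [← Real.exp_nat_mul, div_pow, sq_abs] at h3
    have h4 : Real.exp (((2 : ℕ) : ℝ) * (|w| / 2 - 1)) = Real.exp (-2) * Real.exp |w| := by
      rw [← Real.exp_add]; congr 1; push_cast; ring
    rw [h4] at h3
    linarith
  have h5 : 4 * Real.exp (-2) ≤ 0.55 := by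
    have h6 : Real.exp (-2) * (Real.exp 1 * Real.exp 1) = 1 := by
      rw [← Real.exp_add, ← Real.exp_add]; norm_num
    have h7 := Real.exp_one_gt_d9
    have h8 := Real.exp_pos (-2)
    nlinarith [mul_pos h8 (Real.exp_pos 1)]
  have h9 : Real.exp |w| * Real.exp w ≤ Real.exp (2 * w) + 1 := by
    rw [← Real.exp_add]
    rcases le_total 0 w with h | h
    · rw [abs_of_nonneg h, ← two_mul]; linarith
    · rw [abs_of_nonpos h, neg_add_cancel, Real.exp_zero]; linarith [Real.exp_pos (2 * w)]
  calc w ^ 2 * Real.exp w ≤ (4 * Real.exp (-2) * Real.exp |w|) * Real.exp w := by gcongr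
    _ = (4 * Real.exp (-2)) * (Real.exp |w| * Real.exp w) := by ring
    _ ≤ 0.55 * (Real.exp (2 * w) + 1) := by gcongr

lemma exp_neg_mul_abs_le (w : ℝ) : Real.exp (2 * |w|) ≤ Real.exp (2 * w) + Real.exp (-2 * w) := by
  rcases le_total 0 w with h | h
  · rw [abs_of_nonneg h]; linarith [Real.exp_pos (-2 * w)]
  · rw [abs_of_nonpos h, mul_neg, ← neg_mul]; linarith [Real.exp_pos (2 * w)]

namespace IsBoundedFamily

variable [Fintype ι] {η : ι → Ω → ℝ} {e : ι → ℝ}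

lemma omitAt [DecidableEq ι] [IsProbabilityMeasure μ] (h : IsBoundedFamily η e μ) (i : ι) :
    IsBoundedFamily (NormalApprox.omitAt η i) e μ where
  toIsL2Family := h.toIsL2Family.omitAt i
  bdd j ω := by
    rcases omitAt_cases η i j with h1 | h1 <;> rw [h1]
    · exact h.bdd j ω
    · simp
  mean j := by
    rcases omitAt_cases η i j with h1 | h1 <;> rw [h1]
    · exact h.mean j
    · simpa using (abs_nonneg _).trans (h.mean j)
  sum_mean := h.sum_mean
  sum_sq := by
    rw [sum_integral_omitAt η i (g := fun x => x ^ 2) (by simp)]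
    have : 0 ≤ ∫ ω, η i ω ^ 2 ∂μ := integral_nonneg fun ω => sq_nonneg _
    linarith [h.sum_sq]

lemma abs_sum_le (h : IsBoundedFamily η e μ) (ω : Ω) :
    |∑ i, η i ω| ≤ Fintype.card ι * (1 / 2) := by
  refine (Finset.abs_sum_le_sum_abs _ _).trans ?_
  refine (Finset.sum_le_sum fun i _ => h.bdd i ω).trans ?_
  simp

lemma memLp_comp_sum [IsProbabilityMeasure μ] (h : IsBoundedFamily η e μ) {f : ℝ → ℝ}
    (hf : Continuous f) (p : ℝ≥0∞) : MemLp (fun ω => f (∑ i, η i ω)) p μ :=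
  memLp_comp_of_bounded hf h.measurable_sum h.abs_sum_le p

lemma memLp_comp_sub [IsProbabilityMeasure μ] (h : IsBoundedFamily η e μ) (i : ι) {f : ℝ → ℝ}
    (hf : Continuous f) (p : ℝ≥0∞) : MemLp (fun ω => f (∑ j, η j ω - η i ω)) p μ := by
  classical
  have := (h.omitAt i).memLp_comp_sum hf p
  simpa only [sum_omitAt] using this

/-- The moment generating function factorises, and `exp x ≤ 1 + x + x²` holds for `|x| ≤ 1`, which
is where `|l| ≤ 2` meets the bound `1/2` on the variables. The term `|l|/20` is the price of means
that need not vanish. -/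
lemma integral_exp_le [IsProbabilityMeasure μ] (h : IsBoundedFamily η e μ) {l : ℝ}
    (hl : |l| ≤ 2) :
    ∫ ω, Real.exp (l * ∑ i, η i ω) ∂μ ≤ Real.exp (l ^ 2 + |l| / 20) := by
  have h1 : ∫ ω, Real.exp (l * ∑ i, η i ω) ∂μ = ∏ i, mgf (η i) μ l := by
    have := h.indep.mgf_sum h.measurable Finset.univ (t := l)
    rw [← this, mgf]
    simp
  have h2 : ∀ i, mgf (η i) μ l ≤
      Real.exp (|l| * e i + l ^ 2 * ∫ ω, η i ω ^ 2 ∂μ) := fun i => by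
    have i1 : Integrable (η i) μ := (h.memLp i).integrable (by norm_num)
    have i2 := (h.memLp i).integrable_sq
    have i3 : Integrable (fun ω => Real.exp (l * η i ω)) μ :=
      (memLp_comp_of_bounded (f := fun x => Real.exp (l * x)) (by fun_prop) (h.measurable i)
        (h.bdd i) 1).integrable le_rfl
    calc mgf (η i) μ l ≤ ∫ ω, (1 + l * η i ω + l ^ 2 * η i ω ^ 2) ∂μ := by
          refine integral_mono i3 (((integrable_const _).add (i1.const_mul _)).add
            (i2.const_mul _)) fun ω => ?_
          have : |l * η i ω| ≤ 1 := by
            rw [abs_mul]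
            calc |l| * |η i ω| ≤ 2 * (1 / 2) :=
                  mul_le_mul hl (h.bdd i ω) (abs_nonneg _) (by norm_num)
              _ = 1 := by norm_num
          have := exp_le_one_add_add_sq this
          rwa [mul_pow] at this
      _ = 1 + l * ∫ ω, η i ω ∂μ + l ^ 2 * ∫ ω, η i ω ^ 2 ∂μ := by
          calc _ = ∫ ω, (1 + l * η i ω) ∂μ + ∫ ω, l ^ 2 * η i ω ^ 2 ∂μ :=
                integral_add ((integrable_const _).add (i1.const_mul _)) (i2.const_mul _)
            _ = _ := by
                rw [integral_add (integrable_const _) (i1.const_mul _), integral_const_mul,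
                  integral_const_mul]
                simp
      _ ≤ 1 + (|l| * e i + l ^ 2 * ∫ ω, η i ω ^ 2 ∂μ) := by
          have : l * ∫ ω, η i ω ∂μ ≤ |l| * e i := by
            refine (le_abs_self _).trans ?_
            rw [abs_mul]
            exact mul_le_mul_of_nonneg_left (h.mean i) (abs_nonneg _)
          linarith
      _ ≤ _ := by rw [add_comm]; exact Real.add_one_le_exp _
  rw [h1]
  calc ∏ i, mgf (η i) μ l ≤ ∏ i, Real.exp (|l| * e i + l ^ 2 * ∫ ω, η i ω ^ 2 ∂μ) :=
        Finset.prod_le_prod (fun i _ => mgf_nonneg) fun i _ => h2 i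
    _ = Real.exp (|l| * ∑ i, e i + l ^ 2 * ∑ i, ∫ ω, η i ω ^ 2 ∂μ) := by
        rw [← Real.exp_sum, Finset.sum_add_distrib, Finset.mul_sum, Finset.mul_sum]
    _ ≤ _ := by
        apply Real.exp_le_exp.2
        have := mul_le_mul_of_nonneg_left h.sum_mean (abs_nonneg l)
        have := mul_le_mul_of_nonneg_left h.sum_sq (sq_nonneg l)
        linarith

lemma integral_exp_two_le [IsProbabilityMeasure μ] (h : IsBoundedFamily η e μ) :
    ∫ ω, Real.exp (2 * ∑ i, η i ω) ∂μ ≤ 61 ∧ ∫ ω, Real.exp (-2 * ∑ i, η i ω) ∂μ ≤ 61 := by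
  have h1 : Real.exp (2 ^ 2 + 2 / 20) ≤ 61 := by
    have e1 : Real.exp 4 ≤ 54.6 := by
      have : Real.exp 4 = Real.exp 1 ^ 4 := by rw [← Real.exp_nat_mul]; norm_num
      rw [this]
      calc Real.exp 1 ^ 4 ≤ 2.7182818286 ^ 4 := by
            gcongr; exact Real.exp_one_lt_d9.le
        _ ≤ 54.6 := by norm_num
    have e2 : Real.exp (1 / 10) ≤ 1.11 := by
      have h := Real.exp_bound' (x := 1 / 10) (by norm_num) (by norm_num) (n := 3) (by norm_num)
      norm_num [Finset.sum_range_succ, Nat.factorial] at h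
      norm_num; linarith
    rw [show (2 : ℝ) ^ 2 + 2 / 20 = 4 + 1 / 10 by norm_num, Real.exp_add]
    nlinarith [Real.exp_pos 4, Real.exp_pos (1 / 10)]
  constructor
  · have := h.integral_exp_le (l := 2) (by norm_num)
    rw [abs_of_pos (by norm_num : (0 : ℝ) < 2)] at this
    exact this.trans h1
  · have := h.integral_exp_le (l := -2) (by norm_num)
    rw [abs_of_neg (by norm_num : (-2 : ℝ) < 0), neg_sq, neg_neg] at this
    exact this.trans h1

lemma integral_exp_one_le [IsProbabilityMeasure μ] (h : IsBoundedFamily η e μ) :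
    ∫ ω, Real.exp (∑ i, η i ω) ∂μ ≤ 2.89 := by
  have := h.integral_exp_le (l := 1) (by norm_num)
  simp only [one_mul] at this
  refine this.trans ?_
  have e2 : Real.exp (1 / 20) ≤ 1.06 := by
    have h := Real.exp_bound' (x := 1 / 20) (by norm_num) (by norm_num) (n := 3) (by norm_num)
    norm_num [Finset.sum_range_succ, Nat.factorial] at h
    norm_num; linarith
  rw [abs_one, one_pow, Real.exp_add]
  nlinarith [Real.exp_one_lt_d9, Real.exp_pos 1, Real.exp_pos (1 / 20)]

lemma integral_exp_abs_le [IsProbabilityMeasure μ] (h : IsBoundedFamily η e μ) :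
    ∫ ω, Real.exp (2 * |∑ i, η i ω|) ∂μ ≤ 122 := by
  have i0 := fun l : ℝ => (h.memLp_comp_sum (f := fun x => Real.exp (l * x))
    (by fun_prop) 1).integrable le_rfl
  have i1 := (h.memLp_comp_sum (f := fun x => Real.exp (2 * |x|)) (by fun_prop) 1).integrable le_rfl
  have := integral_mono i1 ((i0 2).add (i0 (-2))) fun ω => exp_neg_mul_abs_le _
  have h2 := h.integral_exp_two_le
  have e : ∫ ω, (Real.exp (2 * ∑ i, η i ω) + Real.exp (-2 * ∑ i, η i ω)) ∂μ ≤ 122 := by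
    rw [integral_add (i0 2) (i0 (-2))]; linarith
  exact this.trans e

lemma integral_sq_mul_exp_le [IsProbabilityMeasure μ] (h : IsBoundedFamily η e μ) :
    ∫ ω, (|∑ i, η i ω| * Real.exp ((∑ i, η i ω) / 2)) ^ 2 ∂μ ≤ 34.1 := by
  have i0 := (h.memLp_comp_sum (f := fun x => Real.exp (2 * x)) (by fun_prop) 1).integrable le_rfl
  have i1 := (h.memLp_comp_sum (f := fun x => (|x| * Real.exp (x / 2)) ^ 2)
    (by fun_prop) 1).integrable le_rfl
  have := integral_mono i1 ((i0.add (integrable_const 1)).const_mul 0.55) fun ω => ?_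
  · refine this.trans ?_
    have e : ∫ ω, 0.55 * (Real.exp (2 * ∑ i, η i ω) + 1) ∂μ ≤ 34.1 := by
      rw [integral_const_mul, integral_add i0 (integrable_const _)]
      simp only [integral_const, probReal_univ, one_smul]
      linarith [h.integral_exp_two_le.1]
    exact e
  · have := sq_mul_exp_le (∑ i, η i ω)
    have e2 : Real.exp ((∑ i, η i ω) / 2) ^ 2 = Real.exp (∑ i, η i ω) := by
      rw [← Real.exp_nat_mul]; congr 1; push_cast; ring
    simp only [mul_pow, sq_abs, e2]
    exact this

end IsBoundedFamily

/-! ### Exponentially weighted concentration -/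

/-- A nonnegative piecewise linear function with slope one on `[-d, D + d]`. -/
def posRamp (d D v : ℝ) : ℝ := max 0 (min (v + d) (D + 2 * d))

lemma posRamp_nonneg (d D v : ℝ) : 0 ≤ posRamp d D v := le_max_left _ _

lemma posRamp_le {d D : ℝ} (hd : 0 ≤ d) (hD : 0 ≤ D) (v : ℝ) : posRamp d D v ≤ D + 2 * d :=
  max_le (by linarith) (min_le_right _ _)

lemma posRamp_mono {d D a b : ℝ} (hab : a ≤ b) : posRamp d D a ≤ posRamp d D b :=
  max_le_max le_rfl (min_le_min (by linarith) le_rfl)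

lemma posRamp_eq {d D v : ℝ} (h1 : -d ≤ v) (h2 : v ≤ D + d) : posRamp d D v = v + d := by
  rw [posRamp, min_eq_left (by linarith), max_eq_right (by linarith)]

/-- This is `ramp` shifted by `D/2 + d`, so the two halves add up to Lipschitz constant one in the
length. -/
lemma abs_posRamp_sub_le {d D D' a v : ℝ} (ha0 : 0 ≤ a) (ha1 : a ≤ 1) :
    |posRamp d D (v + a * D) - posRamp d D' (v + a * D')| ≤ |D - D'| := by
  have h1 : posRamp d D (v + a * D) = ramp d D (v + a * D) + D / 2 + d := by
    rw [ramp, posRamp, sub_add_cancel, ← max_add_add_right, ← min_add_add_right]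
    congr 1
    · ring
    · congr 1; ring
  have h2 : posRamp d D' (v + a * D') = ramp d D' (v + a * D') + D' / 2 + d := by
    rw [ramp, posRamp, sub_add_cancel, ← max_add_add_right, ← min_add_add_right]
    congr 1
    · ring
    · congr 1; ring
  have h3 := abs_ramp_sub_le (d := d) (D := D) (D' := D') (v := v) ha0 ha1
  rw [h1, h2, abs_le] at *
  rcases abs_cases (D - D') with h | h <;> constructor <;> linarith [h3.1, h3.2]

/-- The ramp is taken nonnegative so that its product with `exp (w/2)` is still increasing. In the
zone of slope one the exponential factor may then be compared at the end giving the smaller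
increment. The factor `exp (-d/2) ≤ 1` is slack. -/
lemma expRamp_mul_sub {d D w c : ℝ} (x : ℝ) (hd : 0 ≤ d) :
    (if 0 ≤ w - c ∧ w - c ≤ D then Real.exp (-d / 2) * (Real.exp (w / 2) * (|x| * min d |x|))
      else 0) ≤
    x * (Real.exp (w / 2) * posRamp d D (w - c) -
      Real.exp ((w - x) / 2) * posRamp d D (w - x - c)) := by
  have hm : ∀ a b, a ≤ b → Real.exp (a / 2) * posRamp d D (a - c) ≤
      Real.exp (b / 2) * posRamp d D (b - c) := fun a b hab =>
    mul_le_mul (Real.exp_le_exp.2 (by linarith)) (posRamp_mono (by linarith))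
      (posRamp_nonneg _ _ _) (Real.exp_pos _).le
  have hed : Real.exp (-d / 2) ≤ 1 := Real.exp_le_one_iff.2 (by linarith)
  have hw := Real.exp_pos (w / 2)
  have hd0 := Real.exp_pos (-d / 2)
  rcases le_total 0 x with hx | hx
  · split_ifs with h
    · rw [abs_of_nonneg hx]
      have hm0 : 0 ≤ min d x := le_min hd hx
      have h1 := hm (w - x) (w - min d x) (by linarith [min_le_right d x])
      rw [posRamp_eq (v := w - min d x - c) (by linarith [min_le_left d x])
        (by linarith)] at h1
      rw [posRamp_eq (v := w - c) (by linarith) (by linarith)]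
      have h2 : Real.exp ((w - min d x) / 2) * (w - min d x - c + d) ≤
          Real.exp (w / 2) * (w - min d x - c + d) :=
        mul_le_mul_of_nonneg_right (Real.exp_le_exp.2 (by linarith))
          (by linarith [min_le_left d x])
      have h3 : Real.exp (-d / 2) * (Real.exp (w / 2) * min d x) ≤ Real.exp (w / 2) * min d x :=
        mul_le_of_le_one_left (by positivity) hed
      have h4 : Real.exp (-d / 2) * (Real.exp (w / 2) * min d x) ≤
          Real.exp (w / 2) * (w - c + d) - Real.exp ((w - x) / 2) * posRamp d D (w - x - c) := by
        linarith
      have := mul_le_mul_of_nonneg_left h4 hx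
      linarith
    · exact mul_nonneg hx (sub_nonneg.2 (hm _ _ (by linarith)))
  · split_ifs with h
    · rw [abs_of_nonpos hx]
      have hm0 : 0 ≤ min d (-x) := le_min hd (neg_nonneg.2 hx)
      have h1 := hm (w + min d (-x)) (w - x) (by linarith [min_le_right d (-x)])
      rw [posRamp_eq (v := w + min d (-x) - c) (by linarith)
        (by linarith [min_le_left d (-x)])] at h1
      rw [posRamp_eq (v := w - c) (by linarith) (by linarith)]
      have h2 : Real.exp (w / 2) * (w + min d (-x) - c + d) ≤
          Real.exp ((w + min d (-x)) / 2) * (w + min d (-x) - c + d) :=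
        mul_le_mul_of_nonneg_right (Real.exp_le_exp.2 (by linarith)) (by linarith)
      have h3 : Real.exp (-d / 2) * (Real.exp (w / 2) * min d (-x)) ≤
          Real.exp (w / 2) * min d (-x) := mul_le_of_le_one_left (by positivity) hed
      have h4 : Real.exp (-d / 2) * (Real.exp (w / 2) * min d (-x)) ≤
          Real.exp ((w - x) / 2) * posRamp d D (w - x - c) - Real.exp (w / 2) * (w - c + d) := by
        linarith
      have := mul_le_mul_of_nonneg_left h4 (neg_nonneg.2 hx)
      linarith
    · exact mul_nonneg_of_nonpos_of_nonpos hx (sub_nonpos.2 (hm _ _ (by linarith)))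

lemma measurable_expRamp (d a z : ℝ) :
    Measurable fun p : ℝ × ℝ => Real.exp (p.2 / 2) * posRamp d p.1 (p.2 - (z - a * p.1)) := by
  unfold posRamp; fun_prop

/-- Concentration in a random interval with an exponential gain in the location. -/
theorem measureReal_mul_exp_le_of_randomInterval [Fintype ι] [IsProbabilityMeasure μ]
    {η : ι → Ω → ℝ} {e : ι → ℝ} (h : IsBoundedFamily η e μ)
    {D : Ω → ℝ} {D' : ι → Ω → ℝ} {B : ℝ} (hDm : Measurable D)
    (hDm' : ∀ i, Measurable (D' i))
    (hD0 : ∀ ω, 0 ≤ D ω) (hD0' : ∀ i ω, 0 ≤ D' i ω) (hDB : ∀ ω, D ω ≤ B)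
    (hDB' : ∀ i ω, D' i ω ≤ B)
    (hind : ∀ i, IndepFun (η i) (fun ω => (D' i ω, ∑ j, η j ω - η i ω)) μ)
    {d a z z₀ : ℝ} (hd : 0 ≤ d) (hd1 : d ≤ 1 / 50) (ha0 : 0 ≤ a) (ha1 : a ≤ 1)
    (hz : ∀ ω, z₀ ≤ z - a * D ω)
    (hS : 4 / 5 ≤ ∑ i, ∫ ω, |η i ω| * min d |η i ω| ∂μ) :
    μ.real {ω | z - a * D ω ≤ ∑ j, η j ω ∧ ∑ j, η j ω ≤ z - a * D ω + D ω} *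
        Real.exp (z₀ / 2) ≤
      1.27 * (5.84 * √(∫ ω, D ω ^ 2 ∂μ) + 1.7 * √(∑ i, ∫ ω, (D ω - D' i ω) ^ 2 ∂μ) +
        (2 * (B + 2 * d) * ∑ i, e i) + 14 * d) := by
  classical
  set W : Ω → ℝ := fun ω => ∑ j, η j ω with hW
  set A : Set Ω := {ω | z - a * D ω ≤ ∑ j, η j ω ∧ ∑ j, η j ω ≤ z - a * D ω + D ω} with hA
  set S : Ω → ℝ := fun ω => ∑ i, |η i ω| * min d |η i ω| with hSd
  have hL := h.toIsL2Family
  have hWm : Measurable W := hL.measurable_sum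
  have hAm : MeasurableSet A := by
    refine (measurableSet_le ?_ hWm).inter (measurableSet_le hWm ?_) <;> fun_prop
  have hS2 : MemLp S 2 μ := memLp_sum_truncProd hL hd
  have hE2 : MemLp (fun ω => Real.exp (W ω / 2)) 2 μ :=
    h.memLp_comp_sum (f := fun x => Real.exp (x / 2)) (by fun_prop) 2
  have hEi2 : ∀ i, MemLp (fun ω => Real.exp ((W ω - η i ω) / 2)) 2 μ := fun i =>
    h.memLp_comp_sub i (f := fun x => Real.exp (x / 2)) (by fun_prop) 2
  have hsqE : ∀ x : ℝ, Real.exp (x / 2) ^ 2 = Real.exp x := fun x => by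
    rw [← Real.exp_nat_mul]; congr 1; push_cast; ring
  have hE1 : ∫ ω, Real.exp (W ω / 2) ^ 2 ∂μ ≤ 2.89 := by
    simp_rw [hsqE]; exact h.integral_exp_one_le
  have hEi1 : ∀ i, ∫ ω, Real.exp ((W ω - η i ω) / 2) ^ 2 ∂μ ≤ 2.89 := fun i => by
    simp_rw [hsqE]
    have := (h.omitAt i).integral_exp_one_le
    simpa only [sum_omitAt] using this
  have h17 : √2.89 = 1.7 := by
    rw [show (2.89 : ℝ) = 1.7 ^ 2 by norm_num, Real.sqrt_sq (by norm_num)]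
  have hG2 : MemLp (A.indicator fun ω => Real.exp (W ω / 2)) 2 μ := hE2.indicator hAm
  set G : ℝ := ∫ ω, A.indicator (fun ω => Real.exp (W ω / 2)) ω ∂μ with hG
  -- On `A` the sum is at least `z - a D ≥ z₀`, so the weight `exp (W/2)` is at least `exp (z₀/2)`;
  -- this is the exponential gain.
  have hG1 : μ.real A * Real.exp (z₀ / 2) ≤ G := by
    have e1 : μ.real A * Real.exp (z₀ / 2) =
        ∫ ω, A.indicator (fun _ => Real.exp (z₀ / 2)) ω ∂μ := by
      rw [integral_indicator hAm]; simp
    rw [e1]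
    refine integral_mono ((integrable_const _).indicator hAm) (hG2.integrable (by norm_num))
      fun ω => ?_
    refine indicator_le_indicator' fun hω => ?_
    refine Real.exp_le_exp.2 ?_
    have h1 := hz ω
    have h2 : z - a * D ω ≤ W ω := hω.1
    linarith
  have hG0 : 0 ≤ G := (mul_nonneg measureReal_nonneg (Real.exp_pos _).le).trans hG1
  have hGs : √(∫ ω, (A.indicator fun ω => Real.exp (W ω / 2)) ω ^ 2 ∂μ) ≤ 1.7 := by
    rw [← h17]
    refine Real.sqrt_le_sqrt (le_trans ?_ hE1)
    refine integral_mono hG2.integrable_sq hE2.integrable_sq fun ω => ?_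
    by_cases hω : ω ∈ A
    · simp [hω]
    · simp [hω]; positivity
  have hV1 : √(∑ i, ∫ ω, η i ω ^ 2 ∂μ) ≤ 1 := Real.sqrt_le_one.2 h.sum_sq
  have hvar : √(Var[S; μ]) ≤ d := by
    refine (Real.sqrt_le_sqrt (variance_sum_truncProd_le hL hd)).trans ?_
    rw [Real.sqrt_mul (sq_nonneg d), Real.sqrt_sq hd]
    exact mul_le_of_le_one_right hd hV1
  have hSint : ∫ ω, S ω ∂μ = ∑ i, ∫ ω, |η i ω| * min d |η i ω| ∂μ :=
    integral_finsetSum _ fun i _ => (memLp_truncProd hL hd i).integrable (by norm_num)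
  have hlow := integral_mul_ge_of_variance hG2 hS2
  have hlow2 : 4 / 5 * G - 1.7 * d ≤
      ∫ ω, A.indicator (fun ω => Real.exp (W ω / 2)) ω * S ω ∂μ := by
    rw [hSint] at hlow
    have e1 := mul_le_mul hGs hvar (Real.sqrt_nonneg _) (by norm_num)
    have e2 := mul_le_mul_of_nonneg_left hS hG0
    linarith
  -- the exchange argument
  have hD2 : MemLp D 2 μ := MemLp.of_bound hDm.aestronglyMeasurable B
    (Eventually.of_forall fun ω => by rw [Real.norm_of_nonneg (hD0 ω)]; exact hDB ω)
  have hD2' : ∀ i, MemLp (D' i) 2 μ := fun i => MemLp.of_bound (hDm' i).aestronglyMeasurable B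
    (Eventually.of_forall fun ω => by rw [Real.norm_of_nonneg (hD0' i ω)]; exact hDB' i ω)
  have hR2 : ∀ {E Y : Ω → ℝ}, Measurable E → (∀ ω, 0 ≤ E ω) → (∀ ω, E ω ≤ B) → Measurable Y →
      MemLp (fun ω => Real.exp (Y ω / 2)) 2 μ →
      MemLp (fun ω => Real.exp (Y ω / 2) * posRamp d (E ω) (Y ω - (z - a * E ω))) 2 μ :=
    fun {E Y} hEm hE0 hEB hY hY2 => by
    refine hY2.of_le_mul (c := B + 2 * d)
      ((measurable_expRamp d a z).comp (hEm.prodMk hY)).aestronglyMeasurable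
      (Eventually.of_forall fun ω => ?_)
    rw [norm_mul, mul_comm, Real.norm_of_nonneg (posRamp_nonneg _ _ _)]
    refine mul_le_mul_of_nonneg_right ?_ (norm_nonneg _)
    exact (posRamp_le hd (hE0 ω) _).trans (by linarith [hEB ω])
  have hfW := hR2 hDm hD0 hDB hWm hE2
  have hfi := fun i => hR2 hDm hD0 hDB (hL.measurable_sub i) (hEi2 i)
  have hfi' := fun i => hR2 (hDm' i) (hD0' i) (hDB' i) (hL.measurable_sub i) (hEi2 i)
  have hpt : ∀ ω, Real.exp (-d / 2) * (A.indicator (fun ω => Real.exp (W ω / 2)) ω * S ω) ≤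
      W ω * (Real.exp (W ω / 2) * posRamp d (D ω) (W ω - (z - a * D ω))) -
        ∑ i, η i ω * (Real.exp ((W ω - η i ω) / 2) *
          posRamp d (D ω) (W ω - η i ω - (z - a * D ω))) := fun ω => by
    have h1 : W ω * (Real.exp (W ω / 2) * posRamp d (D ω) (W ω - (z - a * D ω))) -
        ∑ i, η i ω * (Real.exp ((W ω - η i ω) / 2) *
          posRamp d (D ω) (W ω - η i ω - (z - a * D ω))) =
        ∑ i, η i ω * (Real.exp (W ω / 2) * posRamp d (D ω) (W ω - (z - a * D ω)) -
          Real.exp ((W ω - η i ω) / 2) * posRamp d (D ω) (W ω - η i ω - (z - a * D ω))) := by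
      simp only [mul_sub, Finset.sum_sub_distrib, ← Finset.sum_mul, hW]
    rw [h1, hSd, Finset.mul_sum, Finset.mul_sum]
    refine Finset.sum_le_sum fun i _ => ?_
    refine le_trans (le_of_eq ?_) (expRamp_mul_sub (D := D ω) (w := W ω) (c := z - a * D ω)
      (η i ω) hd)
    have hiff : ω ∈ A ↔ 0 ≤ W ω - (z - a * D ω) ∧ W ω - (z - a * D ω) ≤ D ω := by
      simp only [hA, hW, mem_ofPred_eq]
      constructor <;> rintro ⟨h1, h2⟩ <;> constructor <;> linarith
    by_cases hω : ω ∈ A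
    · rw [if_pos (hiff.1 hω)]; simp [hω]
    · rw [if_neg (fun hc => hω (hiff.2 hc))]; simp [hω]
  have hintW := MemLp.integrable_fun_mul hL.memLp_sum hfW
  have hinti := fun i => MemLp.integrable_fun_mul (hL.memLp i) (hfi i)
  have hinti' := fun i => MemLp.integrable_fun_mul (hL.memLp i) (hfi' i)
  have hup1 : Real.exp (-d / 2) * ∫ ω, A.indicator (fun ω => Real.exp (W ω / 2)) ω * S ω ∂μ ≤
      ∫ ω, W ω * (Real.exp (W ω / 2) * posRamp d (D ω) (W ω - (z - a * D ω))) ∂μ -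
        ∑ i, ∫ ω, η i ω * (Real.exp ((W ω - η i ω) / 2) *
          posRamp d (D ω) (W ω - η i ω - (z - a * D ω))) ∂μ := by
    rw [← integral_finsetSum _ fun i _ => hinti i,
      ← integral_sub hintW (integrable_finsetSum _ fun i _ => hinti i), ← integral_const_mul]
    exact integral_mono ((MemLp.integrable_fun_mul hG2 hS2).const_mul _)
      (hintW.sub (integrable_finsetSum _ fun i _ => hinti i)) hpt
  have hWE2 : MemLp (fun ω => |W ω| * Real.exp (W ω / 2)) 2 μ :=
    h.memLp_comp_sum (f := fun x => |x| * Real.exp (x / 2)) (by fun_prop) 2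
  have h584 : √(∫ ω, (|W ω| * Real.exp (W ω / 2)) ^ 2 ∂μ) ≤ 5.84 := by
    rw [Real.sqrt_le_iff]
    exact ⟨by norm_num, h.integral_sq_mul_exp_le.trans (by norm_num)⟩
  have hup2 : ∫ ω, W ω * (Real.exp (W ω / 2) * posRamp d (D ω) (W ω - (z - a * D ω))) ∂μ ≤
      5.84 * (√(∫ ω, D ω ^ 2 ∂μ) + 2 * d) := by
    have i1 := MemLp.integrable_fun_mul hWE2 hD2
    have i2 : Integrable (fun ω => |W ω| * Real.exp (W ω / 2)) μ := hWE2.integrable (by norm_num)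
    have c1 := integral_mul_le_sqrt_mul_sqrt hWE2 hD2
    have c2 : ∫ ω, |W ω| * Real.exp (W ω / 2) ∂μ ≤
        √(∫ ω, (|W ω| * Real.exp (W ω / 2)) ^ 2 ∂μ) := by
      simpa [abs_mul] using integral_abs_le_sqrt hWE2
    calc _ ≤ ∫ ω, (|W ω| * Real.exp (W ω / 2) * D ω + 2 * d * (|W ω| * Real.exp (W ω / 2))) ∂μ := by
          refine integral_mono hintW (i1.add (i2.const_mul _)) fun ω => ?_
          calc W ω * (Real.exp (W ω / 2) * posRamp d (D ω) (W ω - (z - a * D ω)))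
              ≤ |W ω| * (Real.exp (W ω / 2) * posRamp d (D ω) (W ω - (z - a * D ω))) :=
                mul_le_mul_of_nonneg_right (le_abs_self _)
                  (mul_nonneg (Real.exp_pos _).le (posRamp_nonneg _ _ _))
            _ ≤ |W ω| * (Real.exp (W ω / 2) * (D ω + 2 * d)) := by
                gcongr; exact posRamp_le hd (hD0 ω) _
            _ = _ := by ring
      _ = (∫ ω, |W ω| * Real.exp (W ω / 2) * D ω ∂μ) +
          2 * d * ∫ ω, |W ω| * Real.exp (W ω / 2) ∂μ := by
          rw [integral_add i1 (i2.const_mul _), integral_const_mul]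
      _ ≤ 5.84 * √(∫ ω, D ω ^ 2 ∂μ) + 2 * d * 5.84 := by
          gcongr
          · exact c1.trans (by gcongr)
          · exact c2.trans h584
      _ = _ := by ring
  -- Two costs: replacing `D` by `D' i`, and the mean of `η i`, which is only bounded by `e i`. The
  -- expectation of the weight against the ramp is at most `1.7 (B + 2d)`, rounded to `2 (B + 2d)`.
  have hup3 : ∀ i, -∫ ω, η i ω * (Real.exp ((W ω - η i ω) / 2) *
        posRamp d (D ω) (W ω - η i ω - (z - a * D ω))) ∂μ ≤
      1.7 * (√(∫ ω, η i ω ^ 2 ∂μ) * √(∫ ω, (D ω - D' i ω) ^ 2 ∂μ)) +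
        2 * (B + 2 * d) * e i := fun i => by
    have hI := (hind i).comp measurable_id (measurable_expRamp d a z)
    have hz := hI.integral_fun_mul_eq_mul_integral
        (h.measurable i).aestronglyMeasurable (hfi' i).aestronglyMeasurable
    simp only [Function.comp, id] at hz
    have hB : 0 ≤ B + 2 * d := by
      obtain ⟨ω⟩ := nonempty_of_isProbabilityMeasure μ
      linarith [hD0 ω, hDB ω]
    have he0 : 0 ≤ e i := (abs_nonneg _).trans (h.mean i)
    have hmean : |∫ ω, Real.exp ((W ω - η i ω) / 2) *
        posRamp d (D' i ω) (W ω - η i ω - (z - a * D' i ω)) ∂μ| ≤ 2 * (B + 2 * d) := by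
      have c1 := integral_abs_le_sqrt (hEi2 i)
      have c2 := Real.sqrt_le_sqrt (hEi1 i)
      rw [h17] at c2
      have i3 : Integrable (fun ω => Real.exp ((W ω - η i ω) / 2)) μ :=
        (hEi2 i).integrable (by norm_num)
      rw [abs_of_nonneg (integral_nonneg fun ω =>
        mul_nonneg (Real.exp_pos _).le (posRamp_nonneg _ _ _))]
      calc _ ≤ ∫ ω, Real.exp ((W ω - η i ω) / 2) * (B + 2 * d) ∂μ := by
            refine integral_mono ((hfi' i).integrable (by norm_num)) (i3.mul_const _) fun ω => ?_
            refine mul_le_mul_of_nonneg_left ?_ (Real.exp_pos _).le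
            exact (posRamp_le hd (hD0' i ω) _).trans (by linarith [hDB' i ω])
        _ = (∫ ω, Real.exp ((W ω - η i ω) / 2) ∂μ) * (B + 2 * d) := integral_mul_const _ _
        _ ≤ 2 * (B + 2 * d) := by
            refine mul_le_mul_of_nonneg_right ?_ hB
            have : ∫ ω, |Real.exp ((W ω - η i ω) / 2)| ∂μ =
              ∫ ω, Real.exp ((W ω - η i ω) / 2) ∂μ := by simp
            linarith
    have hz2 : -(∫ ω, η i ω * (Real.exp ((W ω - η i ω) / 2) *
        posRamp d (D' i ω) (W ω - η i ω - (z - a * D' i ω))) ∂μ) ≤ 2 * (B + 2 * d) * e i := by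
      rw [hz]
      refine (neg_le_abs _).trans ?_
      rw [abs_mul, mul_comm]
      exact mul_le_mul hmean (h.mean i) (abs_nonneg _) (by positivity)
    have hEη : MemLp (fun ω => |η i ω| * Real.exp ((W ω - η i ω) / 2)) 2 μ := by
      refine (hEi2 i).of_le_mul (c := 1 / 2) ?_ (Eventually.of_forall fun ω => ?_)
      · exact ((h.measurable i).abs.mul
          (Real.measurable_exp.comp ((hL.measurable_sub i).div_const 2))).aestronglyMeasurable
      · rw [norm_mul, norm_abs_eq_norm]
        exact mul_le_mul_of_nonneg_right (h.bdd i ω) (norm_nonneg _)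
    -- Independence of `η i` and the other summands keeps the factor `√(E η_i²)`, so a second
    -- Cauchy–Schwarz over `i` can be applied to the sum.
    have hEηsq : ∫ ω, (|η i ω| * Real.exp ((W ω - η i ω) / 2)) ^ 2 ∂μ =
        (∫ ω, η i ω ^ 2 ∂μ) * ∫ ω, Real.exp ((W ω - η i ω) / 2) ^ 2 ∂μ := by
      have hI2 := ((hL.indepFun_sub i).comp (φ := fun x => x ^ 2)
        (ψ := fun x => Real.exp (x / 2) ^ 2) (by fun_prop) (by fun_prop))
      have := hI2.integral_fun_mul_eq_mul_integral
        ((h.measurable i).pow_const 2).aestronglyMeasurable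
        (by
          have hc : Measurable fun x : ℝ => Real.exp (x / 2) ^ 2 := by fun_prop
          exact (hc.comp (hL.measurable_sub i)).aestronglyMeasurable)
      simp only [Function.comp] at this
      rw [← this]
      congr 1; ext ω; rw [mul_pow, sq_abs]
    have c3 := integral_mul_le_sqrt_mul_sqrt hEη (hD2.sub (hD2' i)).abs
    simp only [Pi.abs_apply, Pi.sub_apply, sq_abs] at c3
    rw [hEηsq, Real.sqrt_mul (integral_nonneg fun ω => sq_nonneg _)] at c3
    have c4 := Real.sqrt_le_sqrt (hEi1 i)
    rw [h17] at c4
    have i1 : Integrable (fun ω => |η i ω| * Real.exp ((W ω - η i ω) / 2) * |D ω - D' i ω|) μ :=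
      MemLp.integrable_fun_mul hEη (hD2.sub (hD2' i)).abs
    have c5 : ∫ ω, (η i ω * (Real.exp ((W ω - η i ω) / 2) *
        posRamp d (D' i ω) (W ω - η i ω - (z - a * D' i ω))) -
        η i ω * (Real.exp ((W ω - η i ω) / 2) *
        posRamp d (D ω) (W ω - η i ω - (z - a * D ω)))) ∂μ ≤
        ∫ ω, |η i ω| * Real.exp ((W ω - η i ω) / 2) * |D ω - D' i ω| ∂μ := by
      refine integral_mono ((hinti' i).sub (hinti i)) i1 fun ω => ?_
      have := abs_posRamp_sub_le (d := d) (D := D' i ω) (D' := D ω) (v := W ω - η i ω - z) ha0 ha1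
      have r1 : W ω - η i ω - (z - a * D' i ω) = W ω - η i ω - z + a * D' i ω := by ring
      have r2 : W ω - η i ω - (z - a * D ω) = W ω - η i ω - z + a * D ω := by ring
      simp only [r1, r2]
      rw [← mul_sub, ← mul_sub]
      refine (le_abs_self _).trans ?_
      rw [abs_mul, abs_mul, abs_of_pos (Real.exp_pos _), mul_assoc, abs_sub_comm (D ω)]
      gcongr
    rw [integral_sub (hinti' i) (hinti i)] at c5
    have c6 : √(∫ ω, η i ω ^ 2 ∂μ) * √(∫ ω, Real.exp ((W ω - η i ω) / 2) ^ 2 ∂μ) *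
        √(∫ ω, (D ω - D' i ω) ^ 2 ∂μ) ≤
        √(∫ ω, η i ω ^ 2 ∂μ) * 1.7 * √(∫ ω, (D ω - D' i ω) ^ 2 ∂μ) := by gcongr
    linarith
  have hup4 := Finset.sum_le_sum fun i (_ : i ∈ Finset.univ) => hup3 i
  rw [Finset.sum_neg_distrib, Finset.sum_add_distrib, ← Finset.mul_sum, ← Finset.mul_sum] at hup4
  have hcs : ∑ i, √(∫ ω, η i ω ^ 2 ∂μ) * √(∫ ω, (D ω - D' i ω) ^ 2 ∂μ) ≤
      √(∑ i, ∫ ω, (D ω - D' i ω) ^ 2 ∂μ) := by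
    have := Real.sum_sqrt_mul_sqrt_le (Finset.univ : Finset ι)
      (f := fun i => ∫ ω, η i ω ^ 2 ∂μ) (g := fun i => ∫ ω, (D ω - D' i ω) ^ 2 ∂μ)
      (fun i => integral_nonneg fun ω => sq_nonneg _)
      (fun i => integral_nonneg fun ω => sq_nonneg _)
    exact this.trans (mul_le_of_le_one_left (Real.sqrt_nonneg _) hV1)
  have hed : 0.99 ≤ Real.exp (-d / 2) := by
    have := Real.add_one_le_exp (-d / 2); norm_num; linarith
  have hed1 : Real.exp (-d / 2) ≤ 1 := Real.exp_le_one_iff.2 (by linarith)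
  -- The factor `1.27` exceeds `1/(0.99 · 4/5)`, and `14` exceeds `2 · 5.84 + 1.7`, the coefficients
  -- of `d` from the term with `W` and from the variance.
  have h9 := mul_le_mul_of_nonneg_left hlow2 (Real.exp_pos (-d / 2)).le
  have h10 : 0.99 * (4 / 5 * G) ≤ Real.exp (-d / 2) * (4 / 5 * G) := by gcongr
  have h11 : Real.exp (-d / 2) * (1.7 * d) ≤ 1.7 * d := mul_le_of_le_one_left (by positivity) hed1
  nlinarith [Real.sqrt_nonneg (∫ ω, D ω ^ 2 ∂μ)]

end NormalApprox

namespace NormalApprox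

variable {Ω : Type*} [MeasurableSpace Ω] {μ : Measure Ω} {ι : Type*}

/-! ### Exponential Berry–Esseen bound for truncated variables -/

/-- A bounded family which is close to having total second moment one, as measured by `b`. -/
structure IsNearUnitFamily [Fintype ι] (η : ι → Ω → ℝ) (e : ι → ℝ) (b : ℝ) (μ : Measure Ω) : Prop
    extends IsBoundedFamily η e μ where
  pos : 0 < b
  le : b ≤ 1 / 100
  sum_mean_le : ∑ i, e i ≤ 4 * b
  one_sub_le : 1 - ∑ i, ∫ ω, η i ω ^ 2 ∂μ ≤ 2 * b
  truncMoment_le : truncMoment μ η ≤ b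

namespace IsNearUnitFamily

variable [Fintype ι] [IsProbabilityMeasure μ] {η : ι → Ω → ℝ} {e : ι → ℝ} {b : ℝ}

/-- With the window `d = 2b` the loss `truncMoment / (4d)` is at most `1/8`, and the variance defect
is at most `2b ≤ 1/50`. -/
lemma sum_truncProd_ge (h : IsNearUnitFamily η e b μ) :
    0.85 ≤ ∑ i, ∫ ω, |η i ω| * min (2 * b) |η i ω| ∂μ := by
  have h1 := NormalApprox.sum_truncProd_ge h.toIsL2Family (d := 2 * b) (by linarith [h.pos])
    (by linarith [h.le])
  have h2 : 1 / (4 * (2 * b)) * truncMoment μ η ≤ 1 / 8 := by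
    have := h.pos
    rw [one_div_mul_eq_div, div_le_iff₀ (by positivity)]
    linarith [h.truncMoment_le]
  linarith [h.one_sub_le, h.le]

lemma sum_truncProd_omitAt_ge [DecidableEq ι] (h : IsNearUnitFamily η e b μ) (i : ι) :
    4 / 5 ≤ ∑ j, ∫ ω, |omitAt η i j ω| * min (2 * b) |omitAt η i j ω| ∂μ := by
  rw [sum_integral_omitAt η i (g := fun x => |x| * min (2 * b) |x|) (by simp)]
  have h1 : ∫ ω, |η i ω| * min (2 * b) |η i ω| ∂μ ≤ 1 / 100 := by
    refine (le_abs_self _).trans (abs_integral_le_of_bound fun ω => ?_)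
    have hb := h.pos
    rw [abs_of_nonneg (by positivity)]
    calc |η i ω| * min (2 * b) |η i ω| ≤ 1 / 2 * (2 * b) :=
          mul_le_mul (h.bdd i ω) (min_le_left _ _) (by positivity) (by norm_num)
      _ ≤ 1 / 100 := by linarith [h.le]
  linarith [h.sum_truncProd_ge]

/-- The weighted concentration inequality for an interval of fixed length, `D = D' = L` and `a = 0`.
Since `x ≤ 1/2`, the location is at least `z₀ = z - 1/2`, which costs `exp (1/4)`. -/
lemma measureReal_sub_interval_le (h : IsNearUnitFamily η e b μ) (i : ι) {z x L : ℝ}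
    (hx : x ≤ 1 / 2) (hL0 : 0 ≤ L) (hL1 : L ≤ 1) :
    μ.real {ω | z - x ≤ ∑ j, η j ω - η i ω ∧ ∑ j, η j ω - η i ω ≤ z - x + L} ≤
      (10 * L + 70 * b) * Real.exp (-z / 2) := by
  classical
  have hb := h.pos
  have hb1 := h.le
  have hc := measureReal_mul_exp_le_of_randomInterval (h.toIsBoundedFamily.omitAt i)
    (D := fun _ => L) (D' := fun _ _ => L) (B := 1) measurable_const (fun _ => measurable_const)
    (fun _ => hL0) (fun _ _ => hL0) (fun _ => hL1) (fun _ _ => hL1)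
    (fun j => ((h.toIsL2Family.omitAt i).indepFun_sub j).comp measurable_id
      (ψ := fun x => (L, x)) (by fun_prop)) (d := 2 * b) (a := 0) (z := z - x) (z₀ := z - 1 / 2)
    (by positivity) (by linarith) le_rfl zero_le_one (fun _ => by linarith)
    (h.sum_truncProd_omitAt_ge i)
  simp only [sum_omitAt, zero_mul, sub_zero, sub_self, ne_eq, OfNat.ofNat_ne_zero,
    not_false_eq_true, zero_pow, integral_zero, Finset.sum_const_zero, Real.sqrt_zero, mul_zero,
    add_zero, integral_const, probReal_univ, one_smul, Real.sqrt_sq hL0] at hc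
  set P := μ.real {ω | z - x ≤ ∑ j, η j ω - η i ω ∧ ∑ j, η j ω - η i ω ≤ z - x + L} with hP
  have e1 : Real.exp ((z - 1 / 2) / 2) * (Real.exp (1 / 4) * Real.exp (-z / 2)) = 1 := by
    rw [← Real.exp_add, ← Real.exp_add, Real.exp_eq_one_iff]; ring
  have e2 : Real.exp (1 / 4) ≤ 1.3 := by
    have h := Real.exp_bound' (x := 1 / 4) (by norm_num) (by norm_num) (n := 3) (by norm_num)
    norm_num [Finset.sum_range_succ, Nat.factorial] at h
    norm_num; linarith
  have e3 := Real.exp_pos (-z / 2)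
  have e4 : 2 * (1 + 2 * (2 * b)) * ∑ j, e j ≤ 10 * b := by
    calc 2 * (1 + 2 * (2 * b)) * ∑ j, e j ≤ 2 * (1 + 2 * (2 * b)) * (4 * b) := by
          gcongr; exact h.sum_mean_le
      _ ≤ 10 * b := by nlinarith
  calc P = P * Real.exp ((z - 1 / 2) / 2) * (Real.exp (1 / 4) * Real.exp (-z / 2)) := by
        rw [mul_assoc, e1, mul_one]
    _ ≤ (1.27 * (5.84 * L + 38 * b)) * (1.3 * Real.exp (-z / 2)) := by
        refine mul_le_mul (hc.trans ?_) (by gcongr) (by positivity) (by positivity)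
        linarith
    _ ≤ (10 * L + 70 * b) * Real.exp (-z / 2) := by nlinarith [mul_pos hb e3, mul_nonneg hL0 e3.le]

lemma integral_exp_abs_sub_le (h : IsNearUnitFamily η e b μ) (i : ι) :
    ∫ ω, Real.exp (2 * |∑ j, η j ω - η i ω|) ∂μ ≤ 122 := by
  classical
  simpa only [sum_omitAt] using (h.toIsBoundedFamily.omitAt i).integral_exp_abs_le

lemma integrable_exp_abs_sub (h : IsNearUnitFamily η e b μ) (i : ι) :
    Integrable (fun ω => Real.exp (2 * |∑ j, η j ω - η i ω|)) μ :=
  (h.toIsBoundedFamily.memLp_comp_sub i (f := fun x => Real.exp (2 * |x|))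
    (by fun_prop) 1).integrable le_rfl

/-- The smooth part of the Stein derivative has increments controlled by an exponential moment of
the sum, at most `122`, and the jump part is the probability of an interval of length `|x - t|`.
Constants may be crude here: they only affect the absolute constant of the nonuniform bound. -/
lemma avgDeriv_sub_le (h : IsNearUnitFamily η e b μ) (i : ι) {z : ℝ} (hz : 0 ≤ z) {x t : ℝ}
    (hx : |x| ≤ 1 / 2) (ht : |t| ≤ 1 / 2) :
    |avgDeriv μ η z i x - avgDeriv μ η z i t| ≤
      (25000 * |x - t| + 70 * b) * Real.exp (-z / 2) := by
  wlog hxt : t ≤ x generalizing x t with H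
  · rw [abs_sub_comm, abs_sub_comm x]; exact H ht hx (le_of_not_ge hxt)
  have hYm := h.measurable_sub i
  set Y : Ω → ℝ := fun ω => ∑ j, η j ω - η i ω with hY
  have hx' := abs_le.1 hx
  have ht' := abs_le.1 ht
  rw [abs_of_nonneg (sub_nonneg.2 hxt)]
  set S : Set Ω := {ω | z - x ≤ Y ω ∧ Y ω ≤ z - x + (x - t)} with hS
  have hSm : MeasurableSet S :=
    (measurableSet_le measurable_const hYm).inter (measurableSet_le hYm measurable_const)
  have hP := h.measureReal_sub_interval_le i (z := z) (x := x) (L := x - t) hx'.2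
    (sub_nonneg.2 hxt) (by linarith)
  have hint : ∀ u : ℝ, Integrable (fun ω => steinDeriv z (Y ω + u)) μ := fun u =>
    integrable_steinDeriv_comp (Y := fun ω => Y ω + u) (hYm.add_const u) z
  have hE := h.integrable_exp_abs_sub i
  have hpt : ∀ ω, |steinDeriv z (Y ω + x) - steinDeriv z (Y ω + t)| ≤
      200 * Real.exp (-z / 2) * (x - t) * Real.exp (2 * |Y ω|) + S.indicator (fun _ => 1) ω := by
    intro ω
    have h1 := abs_mul_stein_sub_le_exp hz (Y ω) x t (by linarith) (by linarith)
    rw [abs_of_nonneg (sub_nonneg.2 hxt)] at h1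
    have h2 : |centredInd z (Y ω + x) - centredInd z (Y ω + t)| ≤ S.indicator (fun _ => 1) ω := by
      unfold centredInd
      by_cases hω : ω ∈ S
      · rw [indicator_of_mem hω]
        split_ifs <;> rw [abs_le] <;> constructor <;> linarith
      · rw [indicator_of_notMem hω]
        by_cases h3 : Y ω + t ≤ z
        · have h4 : Y ω + x ≤ z := by
            by_contra h5
            exact hω ⟨by linarith, by linarith⟩
          simp [h3, h4]
        · have h4 : ¬ Y ω + x ≤ z := fun h5 => h3 (by linarith)
          simp [h3, h4]
    have h3 : steinDeriv z (Y ω + x) - steinDeriv z (Y ω + t) =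
        ((Y ω + x) * stein z (Y ω + x) - (Y ω + t) * stein z (Y ω + t)) +
          (centredInd z (Y ω + x) - centredInd z (Y ω + t)) := by
      unfold steinDeriv; ring
    rw [h3]
    refine (abs_add_le _ _).trans (add_le_add (h1.trans (le_of_eq (by ring))) h2)
  have hi2 : Integrable (S.indicator fun _ => (1 : ℝ)) μ := (integrable_const _).indicator hSm
  have h1 : avgDeriv μ η z i x - avgDeriv μ η z i t =
      ∫ ω, (steinDeriv z (Y ω + x) - steinDeriv z (Y ω + t)) ∂μ :=
    (integral_sub (hint x) (hint t)).symm
  rw [h1]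
  calc |∫ ω, (steinDeriv z (Y ω + x) - steinDeriv z (Y ω + t)) ∂μ|
      ≤ ∫ ω, |steinDeriv z (Y ω + x) - steinDeriv z (Y ω + t)| ∂μ := abs_integral_le_integral_abs
    _ ≤ ∫ ω, (200 * Real.exp (-z / 2) * (x - t) * Real.exp (2 * |Y ω|) +
          S.indicator (fun _ => 1) ω) ∂μ :=
        integral_mono ((hint x).sub (hint t)).abs ((hE.const_mul _).add hi2) hpt
    _ = 200 * Real.exp (-z / 2) * (x - t) * (∫ ω, Real.exp (2 * |Y ω|) ∂μ) + μ.real S := by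
        rw [integral_add (hE.const_mul _) hi2, integral_const_mul, integral_indicator_const _ hSm,
          smul_eq_mul, mul_one]
    _ ≤ 200 * Real.exp (-z / 2) * (x - t) * 122 +
          (10 * (x - t) + 70 * b) * Real.exp (-z / 2) := by
        have := sub_nonneg.2 hxt
        gcongr
        exact h.integral_exp_abs_sub_le i
    _ ≤ _ := by
        nlinarith [mul_nonneg (sub_nonneg.2 hxt) (Real.exp_pos (-z / 2)).le]

/-- The Berry–Esseen bound with an exponentially decaying factor. -/
theorem abs_measureReal_sub_Phi_le_exp (h : IsNearUnitFamily η e b μ) {z : ℝ} (hz : 0 ≤ z) :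
    |μ.real {ω | ∑ j, η j ω ≤ z} - Phi z| ≤ 60000 * b * Real.exp (-z / 2) := by
  have hb := h.pos
  set E := Real.exp (-z / 2) with hE
  have hE0 : 0 < E := Real.exp_pos _
  rw [measureReal_sub_Phi_eq h.toIsL2Family z]
  set I := ∫ ω, steinDeriv z (∑ j, η j ω) ∂μ with hI
  have hint : ∀ {Y : Ω → ℝ}, Measurable Y → Integrable (fun ω => steinDeriv z (Y ω)) μ :=
    fun hY => integrable_steinDeriv_comp hY z
  have hIle : |I| ≤ 732 * E := by
    have i1 := (h.memLp_comp_sum (f := fun x => Real.exp (2 * |x|)) (by fun_prop)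
      1).integrable le_rfl
    calc |I| ≤ ∫ ω, |steinDeriv z (∑ j, η j ω)| ∂μ := abs_integral_le_integral_abs
      _ ≤ ∫ ω, 6 * E * Real.exp (2 * |∑ j, η j ω|) ∂μ := by
          refine integral_mono (hint h.measurable_sum).abs (i1.const_mul _) fun ω => ?_
          refine (abs_steinDeriv_le_exp hz _).trans ?_
          refine mul_le_mul_of_nonneg_left (Real.exp_le_exp.2 ?_) (by positivity)
          linarith [abs_nonneg (∑ j, η j ω)]
      _ = 6 * E * ∫ ω, Real.exp (2 * |∑ j, η j ω|) ∂μ := integral_const_mul _ _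
      _ ≤ 6 * E * 122 := by gcongr; exact h.integral_exp_abs_le
      _ = _ := by ring
  have hf : ∀ i, |∫ ω, stein z (∑ j, η j ω - η i ω) ∂μ| ≤ 244 * E := fun i => by
    have i1 := h.integrable_exp_abs_sub i
    have i2 : Integrable (fun ω => stein z (∑ j, η j ω - η i ω)) μ :=
      (memLp_stein_comp (h.measurable_sub i) z).integrable (by norm_num)
    rw [abs_of_nonneg (integral_nonneg fun ω => stein_nonneg _ _)]
    calc _ ≤ ∫ ω, 2 * E * Real.exp (2 * |∑ j, η j ω - η i ω|) ∂μ := by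
          refine integral_mono i2 (i1.const_mul _) fun ω => ?_
          refine (stein_le_exp hz _).trans ?_
          refine mul_le_mul_of_nonneg_left (Real.exp_le_exp.2 ?_) (by positivity)
          linarith [abs_nonneg (∑ j, η j ω - η i ω)]
      _ = 2 * E * ∫ ω, Real.exp (2 * |∑ j, η j ω - η i ω|) ∂μ := integral_const_mul _ _
      _ ≤ 2 * E * 122 := by gcongr; exact h.integral_exp_abs_sub_le i
      _ = _ := by ring
  have hη1 : ∀ i, Integrable (η i) μ := fun i => (h.memLp i).integrable (by norm_num)
  have hR : ∀ i t, |t| ≤ 1 / 2 → |I - avgDeriv μ η z i t| ≤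
      (25000 * ((∫ ω, |η i ω| ∂μ) + |t|) + 70 * b) * E := fun i t ht => by
    have hm := measurable_avgDeriv h.toIsL2Family z i
    have i1 : Integrable (fun ω => avgDeriv μ η z i (η i ω)) μ :=
      Integrable.of_bound (hm.comp (h.measurable i)).aestronglyMeasurable 1
        (Eventually.of_forall fun ω => abs_avgDeriv_le z i _)
    have h1 : I - avgDeriv μ η z i t =
        ∫ ω, (avgDeriv μ η z i (η i ω) - avgDeriv μ η z i t) ∂μ := by
      rw [integral_sub i1 (integrable_const _), hI, integral_steinDeriv_sum h.toIsL2Family z i]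
      simp
    have i2 : Integrable (fun ω => 25000 * (|η i ω| + |t|) + 70 * b) μ :=
      (((hη1 i).abs.add (integrable_const _)).const_mul _).add (integrable_const _)
    rw [h1]
    calc _ ≤ ∫ ω, |avgDeriv μ η z i (η i ω) - avgDeriv μ η z i t| ∂μ :=
          abs_integral_le_integral_abs
      _ ≤ ∫ ω, (25000 * (|η i ω| + |t|) + 70 * b) * E ∂μ := by
          refine integral_mono (i1.sub (integrable_const _)).abs (i2.mul_const _) fun ω => ?_
          refine (h.avgDeriv_sub_le i hz (h.bdd i ω) ht).trans ?_
          gcongr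
          exact abs_sub _ _
      _ = _ := by
          rw [integral_mul_const]
          congr 1
          calc _ = ∫ ω, 25000 * (|η i ω| + |t|) ∂μ + ∫ ω, 70 * b ∂μ :=
                integral_add (((hη1 i).abs.add (integrable_const _)).const_mul _)
                  (integrable_const _)
            _ = _ := by
                rw [integral_const_mul, integral_add (hη1 i).abs (integrable_const _)]
                simp
  have hmin : ∀ i ω, min 1 |η i ω| = |η i ω| := fun i ω =>
    min_eq_right ((h.bdd i ω).trans (by norm_num))
  have hβi : ∀ i, Integrable (fun ω => η i ω ^ 2 * |η i ω|) μ := fun i => by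
    simpa only [hmin] using integrable_sq_mul_min (h.measurable i) (h.memLp i)
  have hT : ∀ i, |∫ ω, η i ω * (∫ t in (0 : ℝ)..η i ω, (I - avgDeriv μ η z i t)) ∂μ| ≤
      (50000 * (∫ ω, η i ω ^ 2 * |η i ω| ∂μ) + 70 * b * ∫ ω, η i ω ^ 2 ∂μ) * E := fun i => by
    have hm : Measurable fun t => I - avgDeriv μ η z i t :=
      (measurable_avgDeriv h.toIsL2Family z i).const_sub I
    have hbd : ∀ t, |I - avgDeriv μ η z i t| ≤ |I| + 1 := fun t =>
      (abs_sub _ _).trans (add_le_add le_rfl (abs_avgDeriv_le z i t))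
    have i1 := integrable_mul_primitive hm hbd (h.measurable i) (h.memLp i)
    have i2 := (h.memLp i).integrable_sq
    set A := ∫ ω, |η i ω| ∂μ with hA
    have hA0 : 0 ≤ A := integral_nonneg fun ω => abs_nonneg _
    have hpt : ∀ ω, |η i ω * (∫ t in (0 : ℝ)..η i ω, (I - avgDeriv μ η z i t))| ≤
        ((25000 * A + 70 * b) * η i ω ^ 2 + 25000 * (η i ω ^ 2 * |η i ω|)) * E := fun ω => by
      have := intervalIntegral.norm_integral_le_of_norm_le_const
        (C := (25000 * (A + |η i ω|) + 70 * b) * E)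
        (f := fun t => I - avgDeriv μ η z i t) (a := 0) (b := η i ω) (fun t ht => by
          have ht2 : |t| ≤ |η i ω| := by
            rw [uIoc] at ht
            rcases le_total 0 (η i ω) with h0 | h0
            · rw [min_eq_left h0, max_eq_right h0] at ht
              rw [abs_of_nonneg h0, abs_of_pos ht.1]; exact ht.2
            · rw [min_eq_right h0, max_eq_left h0] at ht
              rw [abs_of_nonpos h0, abs_of_nonpos ht.2]; linarith [ht.1]
          refine (hR i t (ht2.trans (h.bdd i ω))).trans ?_
          gcongr)
      rw [sub_zero] at this
      rw [abs_mul]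
      calc _ ≤ |η i ω| * ((25000 * (A + |η i ω|) + 70 * b) * E * |η i ω|) := by gcongr; exact this
        _ = _ := by rw [← sq_abs (η i ω)]; ring
    -- Chebyshev's association inequality turns the product of a second and a first moment into a
    -- third moment.
    have has : (∫ ω, η i ω ^ 2 ∂μ) * A ≤ ∫ ω, η i ω ^ 2 * |η i ω| ∂μ := by
      have := integral_sq_mul_integral_min_le (h.measurable i) (h.memLp i)
      simpa only [hmin] using this
    calc _ ≤ ∫ ω, |η i ω * (∫ t in (0 : ℝ)..η i ω, (I - avgDeriv μ η z i t))| ∂μ :=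
          abs_integral_le_integral_abs
      _ ≤ ∫ ω, ((25000 * A + 70 * b) * η i ω ^ 2 + 25000 * (η i ω ^ 2 * |η i ω|)) * E ∂μ :=
          integral_mono i1.abs (((i2.const_mul _).add ((hβi i).const_mul _)).mul_const _) hpt
      _ = ((25000 * A + 70 * b) * (∫ ω, η i ω ^ 2 ∂μ) +
            25000 * (∫ ω, η i ω ^ 2 * |η i ω| ∂μ)) * E := by
          rw [integral_mul_const, integral_add (i2.const_mul _) ((hβi i).const_mul _),
            integral_const_mul, integral_const_mul]
      _ ≤ _ := by
          refine mul_le_mul_of_nonneg_right ?_ hE0.le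
          linarith
  have hsum : ∑ i, ∫ ω, η i ω ^ 2 * |η i ω| ∂μ ≤ b := by
    have := h.truncMoment_le
    rw [truncMoment] at this
    simpa only [hmin] using this
  have t1 : |∑ i, ∫ ω, η i ω * (∫ t in (0 : ℝ)..η i ω, (I - avgDeriv μ η z i t)) ∂μ| ≤
      50070 * b * E := by
    refine (Finset.abs_sum_le_sum_abs _ _).trans ((Finset.sum_le_sum fun i _ => hT i).trans ?_)
    rw [← Finset.sum_mul, Finset.sum_add_distrib, ← Finset.mul_sum, ← Finset.mul_sum]
    refine mul_le_mul_of_nonneg_right ?_ hE0.le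
    have := mul_le_mul_of_nonneg_left h.sum_sq (by positivity : 0 ≤ 70 * b)
    linarith
  -- Truncation destroys unit variance and centring; this term and `t3` are the resulting
  -- corrections, both of order `b`.
  have t2 : |(1 - ∑ i, ∫ ω, η i ω ^ 2 ∂μ) * I| ≤ 2 * b * (732 * E) := by
    rw [abs_mul, abs_of_nonneg (by linarith [h.sum_sq])]
    exact mul_le_mul h.one_sub_le hIle (abs_nonneg _) (by positivity)
  have t3 : |∑ i, (∫ ω, η i ω ∂μ) * (∫ ω, stein z (∑ j, η j ω - η i ω) ∂μ)| ≤
      4 * b * (244 * E) := by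
    refine (Finset.abs_sum_le_sum_abs _ _).trans ?_
    calc _ ≤ ∑ i, e i * (244 * E) := by
          refine Finset.sum_le_sum fun i _ => ?_
          rw [abs_mul]
          exact mul_le_mul (h.mean i) (hf i) (abs_nonneg _) ((abs_nonneg _).trans (h.mean i))
      _ = (∑ i, e i) * (244 * E) := by rw [Finset.sum_mul]
      _ ≤ _ := by gcongr; exact h.sum_mean_le
  refine (abs_sub _ _).trans ((add_le_add ((abs_add_le _ _).trans (add_le_add t1 t2)) t3).trans ?_)
  nlinarith [mul_pos hb hE0]

end IsNearUnitFamily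

/-! ### Truncation -/

/-- Truncation at level `1/2`. -/
def trunc (x : ℝ) : ℝ := if |x| ≤ 1 / 2 then x else 0

lemma measurable_trunc : Measurable trunc :=
  Measurable.ite (measurableSet_le measurable_id.abs measurable_const) measurable_id
    measurable_const

lemma abs_trunc_le (x : ℝ) : |trunc x| ≤ |x| := by
  unfold trunc; split_ifs
  · rfl
  · simp

lemma abs_trunc_le_half (x : ℝ) : |trunc x| ≤ 1 / 2 := by
  unfold trunc; split_ifs with h
  · exact h
  · norm_num

/-- The difference vanishes unless `|x| > 1/2`, and then `|x| min(1, |x|) ≥ 1/4`. For centred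
variables it bounds the mean of the truncated one. -/
lemma abs_sub_trunc_le (x : ℝ) : |x - trunc x| ≤ 4 * (x ^ 2 * min 1 |x|) := by
  unfold trunc; split_ifs with h
  · simp; positivity
  · rw [sub_zero, ← sq_abs x]
    push Not at h
    rcases le_total 1 |x| with h1 | h1
    · rw [min_eq_left h1]; nlinarith
    · rw [min_eq_right h1]
      nlinarith [mul_pos (abs_pos.2 (fun h2 => by simp [h2] at h; linarith : x ≠ 0))
        (abs_pos.2 (fun h2 => by simp [h2] at h; linarith : x ≠ 0))]

lemma sq_sub_sq_trunc_le (x : ℝ) : x ^ 2 - trunc x ^ 2 ≤ 2 * (x ^ 2 * min 1 |x|) := by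
  unfold trunc; split_ifs with h
  · simp; positivity
  · push Not at h
    have : 1 / 2 ≤ min 1 |x| := le_min (by norm_num) h.le
    nlinarith [sq_nonneg x]

lemma trunc_sq_mul_min_le (x : ℝ) : trunc x ^ 2 * min 1 |trunc x| ≤ x ^ 2 * min 1 |x| := by
  have h := abs_trunc_le x
  have h2 := sq_le_sq.2 h
  gcongr

/-- Truncating a centred normalized family with small truncated third moment. -/
lemma IsL2Family.isNearUnitFamily_trunc [Fintype ι] [IsProbabilityMeasure μ] {ξ : ι → Ω → ℝ}
    (h : IsL2Family ξ μ) (h0 : ∀ i, ∫ ω, ξ i ω ∂μ = 0) (hV : ∑ i, ∫ ω, ξ i ω ^ 2 ∂μ = 1)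
    (hb : truncMoment μ ξ ≤ 1 / 100) :
    IsNearUnitFamily (fun i ω => trunc (ξ i ω))
      (fun i => 4 * ∫ ω, ξ i ω ^ 2 * min 1 |ξ i ω| ∂μ) (truncMoment μ ξ) μ := by
  have hη := h.map (g := fun _ => trunc) (fun _ => measurable_trunc) fun _ => abs_trunc_le
  have i1 := fun i => integrable_sq_mul_min (h.measurable i) (h.memLp i)
  have hs : ∀ i, ∫ ω, trunc (ξ i ω) ^ 2 ∂μ ≤ ∫ ω, ξ i ω ^ 2 ∂μ := fun i =>
    integral_mono (hη.memLp i).integrable_sq (h.memLp i).integrable_sq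
      fun ω => sq_le_sq.2 (abs_trunc_le _)
  have he : ∑ i, 4 * ∫ ω, ξ i ω ^ 2 * min 1 |ξ i ω| ∂μ = 4 * truncMoment μ ξ := by
    rw [truncMoment, Finset.mul_sum]
  refine ⟨⟨hη, fun i ω => abs_trunc_le_half _, fun i => ?_, ?_, ?_⟩, truncMoment_pos h hV, hb,
    he.le, ?_, ?_⟩
  · have j1 := (h.memLp i).integrable (by norm_num : (1 : ℝ≥0∞) ≤ 2)
    have j2 := (hη.memLp i).integrable (by norm_num : (1 : ℝ≥0∞) ≤ 2)
    have h1 : ∫ ω, trunc (ξ i ω) ∂μ = -∫ ω, (ξ i ω - trunc (ξ i ω)) ∂μ := by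
      rw [integral_sub j1 j2, h0 i]; ring
    rw [h1, abs_neg, ← integral_const_mul]
    exact abs_integral_le_integral_abs.trans
      (integral_mono (j1.sub j2).abs ((i1 i).const_mul 4) fun ω => abs_sub_trunc_le _)
  · rw [he]; linarith
  · exact (Finset.sum_le_sum fun i _ => hs i).trans hV.le
  · rw [← hV, ← Finset.sum_sub_distrib, truncMoment, Finset.mul_sum]
    refine Finset.sum_le_sum fun i _ => ?_
    rw [← integral_sub (h.memLp i).integrable_sq (hη.memLp i).integrable_sq, ← integral_const_mul]
    exact integral_mono ((h.memLp i).integrable_sq.sub (hη.memLp i).integrable_sq)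
      ((i1 i).const_mul 2) fun ω => sq_sub_sq_trunc_le _
  · refine Finset.sum_le_sum fun i _ => ?_
    exact integral_mono (integrable_sq_mul_min (hη.measurable i) (hη.memLp i)) (i1 i)
      fun ω => trunc_sq_mul_min_le _

end NormalApprox

namespace NormalApprox

variable {Ω : Type*} [MeasurableSpace Ω] {μ : Measure Ω} {ι : Type*}

/-! ### Absolute moments of order `p` -/

/-- The left side is `|x|²` for `|x| ≥ 1` and `|x|³` for `|x| ≤ 1`, and `p` lies between these
exponents. -/
lemma sq_mul_min_le_rpow {p : ℝ} (hp : 2 < p) (hp3 : p ≤ 3) (x : ℝ) :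
    x ^ 2 * min 1 |x| ≤ |x| ^ p := by
  rw [← sq_abs x]
  rcases (abs_nonneg x).eq_or_lt with h | h
  · rw [← h, Real.zero_rpow (by linarith)]; simp
  rcases le_total 1 |x| with h1 | h1
  · rw [min_eq_left h1, mul_one, ← Real.rpow_two]
    exact Real.rpow_le_rpow_of_exponent_le h1 hp.le
  · rw [min_eq_right h1, ← pow_succ, ← Real.rpow_natCast]
    exact Real.rpow_le_rpow_of_exponent_ge h h1 (by norm_num; exact hp3)

/-- The signed power `w |w| ^ (p - 2)`. -/
def signedPow (p w : ℝ) : ℝ := w * |w| ^ (p - 2)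

lemma measurable_signedPow (p : ℝ) : Measurable (signedPow p) := by
  unfold signedPow; fun_prop

lemma mul_signedPow {p : ℝ} (hp : 2 < p) (w : ℝ) : w * signedPow p w = |w| ^ p := by
  rw [signedPow, ← mul_assoc, ← pow_two, ← sq_abs, ← Real.rpow_two,
    ← Real.rpow_add_of_nonneg (abs_nonneg w) (by norm_num) (by linarith)]
  congr 1; ring

lemma abs_signedPow {p : ℝ} (hp : 2 < p) (w : ℝ) : |signedPow p w| = |w| ^ (p - 1) := by
  rw [signedPow, abs_mul, abs_of_nonneg (Real.rpow_nonneg (abs_nonneg w) _)]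
  nth_rewrite 1 [← Real.rpow_one |w|]
  rw [← Real.rpow_add_of_nonneg (abs_nonneg w) (by norm_num) (by linarith)]
  congr 1; ring

lemma mul_rpow_le_of_le {q A B : ℝ} (hq0 : 0 < q) (hq1 : q ≤ 1) (hA : 0 ≤ A) (hAB : A ≤ B) :
    A * B ^ q ≤ A ^ q * B := by
  rcases hA.eq_or_lt with h | h
  · rw [← h, Real.zero_rpow hq0.ne']; simp
  have hB : 0 < B := h.trans_le hAB
  have h1 : A ^ (1 - q) ≤ B ^ (1 - q) := Real.rpow_le_rpow hA hAB (by linarith)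
  calc A * B ^ q = A ^ (1 - q) * (A ^ q * B ^ q) := by
        rw [← mul_assoc, ← Real.rpow_add h]; simp
    _ ≤ B ^ (1 - q) * (A ^ q * B ^ q) := by gcongr
    _ = A ^ q * B := by
        rw [mul_left_comm, ← Real.rpow_add hB]; simp

/-- A derivative-free mean value estimate: for `q ≤ 1` the power has increments at most `|A - B| B ^
(q - 1)`, up to multiplication by `B`, even when `A` or `B` is zero. -/
lemma mul_abs_rpow_sub_le {q A B : ℝ} (hq0 : 0 < q) (hq1 : q ≤ 1) (hA : 0 ≤ A) (hB : 0 ≤ B) :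
    B * |A ^ q - B ^ q| ≤ |A - B| * B ^ q := by
  rcases le_total A B with h | h
  · rw [abs_of_nonpos (sub_nonpos.2 (Real.rpow_le_rpow hA h hq0.le)), abs_of_nonpos (by linarith)]
    have := mul_rpow_le_of_le hq0 hq1 hA h
    linarith
  · rw [abs_of_nonneg (sub_nonneg.2 (Real.rpow_le_rpow hB h hq0.le)), abs_of_nonneg (by linarith)]
    have := mul_rpow_le_of_le hq0 hq1 hB h
    linarith

lemma rpow_le_one_add_sq {q w : ℝ} (hq0 : 0 < q) (hq1 : q ≤ 1) : |w| ^ q ≤ 1 + w ^ 2 := by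
  rcases le_total |w| 1 with h | h
  · have := Real.rpow_le_one (abs_nonneg w) h hq0.le
    linarith [sq_nonneg w]
  · have h1 := Real.rpow_le_rpow_of_exponent_le h hq1
    rw [Real.rpow_one] at h1
    rw [← sq_abs w]
    nlinarith

lemma abs_signedPow_sub_le {p : ℝ} (hp : 2 < p) (hp3 : p ≤ 3) (w x : ℝ) :
    |x * (signedPow p (w + x) - signedPow p w)| ≤ 2 * (x ^ 2 * (1 + w ^ 2)) + |x| ^ p := by
  have hq0 : 0 < p - 2 := by linarith
  have hq1 : p - 2 ≤ 1 := by linarith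
  have e : signedPow p (w + x) - signedPow p w =
      x * |w + x| ^ (p - 2) + w * (|w + x| ^ (p - 2) - |w| ^ (p - 2)) := by
    unfold signedPow; ring
  have h1 := mul_abs_rpow_sub_le hq0 hq1 (abs_nonneg (w + x)) (abs_nonneg w)
  have h2 : |(|w + x| - |w|)| ≤ |x| := by
    simpa using abs_abs_sub_abs_le_abs_sub (w + x) w
  have h3 : |w + x| ^ (p - 2) ≤ |w| ^ (p - 2) + |x| ^ (p - 2) :=
    (Real.rpow_le_rpow (abs_nonneg _) (abs_add_le w x) hq0.le).trans
      (Real.rpow_add_le_add_rpow (abs_nonneg _) (abs_nonneg _) hq0.le hq1)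
  have h4 := rpow_le_one_add_sq (w := w) hq0 hq1
  have h5 : |x| ^ p = |x| * (|x| * |x| ^ (p - 2)) := by
    rw [← mul_assoc, ← pow_two, ← Real.rpow_two,
      ← Real.rpow_add_of_nonneg (abs_nonneg x) (by norm_num) (by linarith)]
    congr 1; ring
  have hw0 : 0 ≤ |w| ^ (p - 2) := Real.rpow_nonneg (abs_nonneg w) _
  have hx := abs_nonneg x
  calc |x * (signedPow p (w + x) - signedPow p w)|
      ≤ |x| * (|x| * |w + x| ^ (p - 2) + |w| * |(|w + x| ^ (p - 2) - |w| ^ (p - 2))|) := by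
        rw [abs_mul, e]
        refine mul_le_mul_of_nonneg_left ((abs_add_le _ _).trans (le_of_eq ?_)) hx
        rw [abs_mul, abs_mul, abs_of_nonneg (Real.rpow_nonneg (abs_nonneg (w + x)) _)]
    _ ≤ |x| * (|x| * (|w| ^ (p - 2) + |x| ^ (p - 2)) + |x| * |w| ^ (p - 2)) := by
        exact mul_le_mul_of_nonneg_left (add_le_add (mul_le_mul_of_nonneg_left h3 hx)
          (h1.trans (mul_le_mul_of_nonneg_right h2 hw0))) hx
    _ = 2 * (x ^ 2 * |w| ^ (p - 2)) + |x| ^ p := by rw [h5, ← sq_abs x]; ring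
    _ ≤ _ := by gcongr

/-- A crude Young inequality, replacing both factors by the larger one; it serves integrability
only. -/
lemma abs_mul_rpow_le {p : ℝ} (hp : 2 < p) (a w : ℝ) :
    |a| * |w| ^ (p - 1) ≤ |a| ^ p + |w| ^ p := by
  have key : ∀ c : ℝ, 0 ≤ c → c * c ^ (p - 1) = c ^ p := fun c hc => by
    nth_rewrite 1 [← Real.rpow_one c]
    rw [← Real.rpow_add_of_nonneg hc (by norm_num) (by linarith)]
    congr 1; ring
  have h1 : 0 ≤ |a| ^ p := Real.rpow_nonneg (abs_nonneg a) _
  have h2 : 0 ≤ |w| ^ p := Real.rpow_nonneg (abs_nonneg w) _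
  rcases le_total |a| |w| with h | h
  · calc |a| * |w| ^ (p - 1) ≤ |w| * |w| ^ (p - 1) := by gcongr
      _ = |w| ^ p := key _ (abs_nonneg w)
      _ ≤ _ := by linarith
  · calc |a| * |w| ^ (p - 1) ≤ |a| * |a| ^ (p - 1) := by gcongr; linarith
      _ = |a| ^ p := key _ (abs_nonneg a)
      _ ≤ _ := by linarith

/-- An independent centred family with total variance at most one and finite absolute moments of
order `p ∈ (2, 3]`. -/
structure IsMomentFamily [Fintype ι] (ξ : ι → Ω → ℝ) (p : ℝ) (μ : Measure Ω) : Prop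
    extends IsL2Family ξ μ where
  two_lt : 2 < p
  le_three : p ≤ 3
  centred : ∀ i, ∫ ω, ξ i ω ∂μ = 0
  sum_sq : ∑ i, ∫ ω, ξ i ω ^ 2 ∂μ ≤ 1
  integrable : ∀ i, Integrable (fun ω => |ξ i ω| ^ p) μ

/-- The sum of the absolute moments of order `p`. -/
def absMoment [Fintype ι] (μ : Measure Ω) (ξ : ι → Ω → ℝ) (p : ℝ) : ℝ :=
  ∑ i, ∫ ω, |ξ i ω| ^ p ∂μ

lemma integrable_abs_rpow_iff {p : ℝ} (hp : 0 < p) {X : Ω → ℝ} (hX : Measurable X) :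
    Integrable (fun ω => |X ω| ^ p) μ ↔ MemLp X (ENNReal.ofReal p) μ := by
  rw [← integrable_norm_rpow_iff hX.aestronglyMeasurable (by simpa using hp) ENNReal.ofReal_ne_top,
    ENNReal.toReal_ofReal hp.le]
  rfl

lemma measureReal_abs_ge_le [IsFiniteMeasure μ] {p : ℝ} (hp : 0 < p) {X : Ω → ℝ}
    (hX : Integrable (fun ω => |X ω| ^ p) μ) {t : ℝ} (ht : 0 < t) :
    μ.real {ω | t ≤ |X ω|} ≤ (∫ ω, |X ω| ^ p ∂μ) / t ^ p := by
  rw [le_div_iff₀ (Real.rpow_pos_of_pos ht p), mul_comm]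
  refine le_trans ?_ (mul_meas_ge_le_integral_of_nonneg (Eventually.of_forall fun ω =>
    Real.rpow_nonneg (abs_nonneg (X ω)) p) hX (t ^ p))
  refine mul_le_mul_of_nonneg_left (measureReal_mono fun ω hω => ?_) (by positivity)
  exact Real.rpow_le_rpow ht.le hω hp.le

namespace IsMomentFamily

variable [Fintype ι] {ξ : ι → Ω → ℝ} {p : ℝ}

lemma pos (h : IsMomentFamily ξ p μ) : 0 < p := by linarith [h.two_lt]

lemma absMoment_nonneg (ξ : ι → Ω → ℝ) (p : ℝ) : 0 ≤ absMoment μ ξ p :=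
  Finset.sum_nonneg fun _ _ => integral_nonneg fun _ => Real.rpow_nonneg (abs_nonneg _) _

lemma integral_nonneg_rpow (X : Ω → ℝ) (p : ℝ) : 0 ≤ ∫ ω, |X ω| ^ p ∂μ :=
  integral_nonneg fun _ => Real.rpow_nonneg (abs_nonneg _) _

lemma truncMoment_le [IsProbabilityMeasure μ] (h : IsMomentFamily ξ p μ) :
    truncMoment μ ξ ≤ absMoment μ ξ p :=
  Finset.sum_le_sum fun i _ => integral_mono (integrable_sq_mul_min (h.measurable i) (h.memLp i))
    (h.integrable i) fun ω => sq_mul_min_le_rpow h.two_lt h.le_three _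

lemma omitAt [DecidableEq ι] [IsProbabilityMeasure μ] (h : IsMomentFamily ξ p μ) (i : ι) :
    IsMomentFamily (NormalApprox.omitAt ξ i) p μ where
  toIsL2Family := h.toIsL2Family.omitAt i
  two_lt := h.two_lt
  le_three := h.le_three
  centred := integral_omitAt_eq_zero h.centred i
  sum_sq := by
    rw [sum_integral_omitAt ξ i (g := fun x => x ^ 2) (by simp)]
    have : 0 ≤ ∫ ω, ξ i ω ^ 2 ∂μ := integral_nonneg fun ω => sq_nonneg _
    linarith [h.sum_sq]
  integrable j := by
    rcases omitAt_cases ξ i j with h1 | h1 <;> rw [h1]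
    · exact h.integrable j
    · simp [Real.zero_rpow h.pos.ne']

lemma absMoment_omitAt_le [DecidableEq ι] (h : IsMomentFamily ξ p μ) (i : ι) :
    absMoment μ (NormalApprox.omitAt ξ i) p ≤ absMoment μ ξ p := by
  rw [absMoment, sum_integral_omitAt ξ i (g := fun x => |x| ^ p)
    (by simp [Real.zero_rpow h.pos.ne'])]
  exact sub_le_self _ (integral_nonneg_rpow (μ := μ) (ξ i) p)

lemma neg [IsProbabilityMeasure μ] (h : IsMomentFamily ξ p μ) :
    IsMomentFamily (fun i ω => -ξ i ω) p μ where
  toIsL2Family := h.toIsL2Family.neg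
  two_lt := h.two_lt
  le_three := h.le_three
  centred i := by rw [integral_neg, h.centred i, neg_zero]
  sum_sq := by simpa using h.sum_sq
  integrable i := by simpa using h.integrable i

lemma integrable_sum (h : IsMomentFamily ξ p μ) :
    Integrable (fun ω => |∑ i, ξ i ω| ^ p) μ := by
  rw [integrable_abs_rpow_iff h.pos h.measurable_sum]
  exact memLp_finsetSum _ fun i _ => (integrable_abs_rpow_iff h.pos (h.measurable i)).1
    (h.integrable i)

lemma integrable_sub (h : IsMomentFamily ξ p μ) (i : ι) :
    Integrable (fun ω => |∑ j, ξ j ω - ξ i ω| ^ p) μ := by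
  rw [integrable_abs_rpow_iff h.pos (h.measurable_sub i)]
  exact ((integrable_abs_rpow_iff h.pos h.measurable_sum).1 h.integrable_sum).sub
    ((integrable_abs_rpow_iff h.pos (h.measurable i)).1 (h.integrable i))

lemma integral_sub_sq_le [IsProbabilityMeasure μ] (h : IsMomentFamily ξ p μ) (i : ι) :
    ∫ ω, (∑ j, ξ j ω - ξ i ω) ^ 2 ∂μ ≤ 1 := by
  classical
  have := (h.omitAt i).toIsL2Family.integral_sum_sq (h.omitAt i).centred
  simp only [sum_omitAt] at this
  rw [this]
  exact (h.omitAt i).sum_sq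

/-- A moment inequality of Rosenthal type. -/
lemma integral_abs_sum_rpow_le [IsProbabilityMeasure μ] (h : IsMomentFamily ξ p μ) :
    ∫ ω, |∑ i, ξ i ω| ^ p ∂μ ≤ 4 + absMoment μ ξ p := by
  have hp := h.two_lt
  set W : Ω → ℝ := fun ω => ∑ i, ξ i ω with hW
  have hint : ∀ i (Y : Ω → ℝ), Measurable Y → Integrable (fun ω => |Y ω| ^ p) μ →
      Integrable (fun ω => ξ i ω * signedPow p (Y ω)) μ := fun i Y hY hYp =>
    ((h.integrable i).add hYp).mono'
      ((h.measurable i).mul ((measurable_signedPow p).comp hY)).aestronglyMeasurable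
      (Eventually.of_forall fun ω => by
        rw [norm_mul, Real.norm_eq_abs, Real.norm_eq_abs, abs_signedPow hp]
        exact abs_mul_rpow_le hp _ _)
  have h1 : ∀ ω, |W ω| ^ p = ∑ i, ξ i ω * signedPow p (W ω) := fun ω => by
    rw [← mul_signedPow hp, ← Finset.sum_mul]
  have h2 : ∀ i, ∫ ω, ξ i ω * signedPow p (W ω) ∂μ ≤
      4 * (∫ ω, ξ i ω ^ 2 ∂μ) + ∫ ω, |ξ i ω| ^ p ∂μ := fun i => by
    -- Writing `|W|^p = ∑ ξ_i · signedPow p W`, the signed power of the sum without `ξ_i` may be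
    -- subtracted in each term. What remains is of second order in `ξ_i`, and `E (1 + (W - ξ_i)²) ≤
    -- 2` gives the constant `4`.
    have hz : ∫ ω, ξ i ω * signedPow p (W ω - ξ i ω) ∂μ = 0 := by
      have := ((h.indepFun_sub i).comp measurable_id (measurable_signedPow p))
      rw [show ∫ ω, ξ i ω * signedPow p (W ω - ξ i ω) ∂μ = _ from
        this.integral_fun_mul_eq_mul_integral (h.measurable i).aestronglyMeasurable
        ((measurable_signedPow p).comp (h.measurable_sub i)).aestronglyMeasurable]
      simp [h.centred i]
    have i1 := hint i W h.measurable_sum h.integrable_sum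
    have i2 := hint i (fun ω => W ω - ξ i ω) (h.measurable_sub i) (h.integrable_sub i)
    have hsq := ((h.indepFun_sub i).comp (φ := fun x => x ^ 2) (ψ := fun x => 1 + x ^ 2)
      (by fun_prop) (by fun_prop))
    have j1 : Integrable (fun ω => 1 + (W ω - ξ i ω) ^ 2) μ :=
      (integrable_const 1).add (h.memLp_sub i).integrable_sq
    have i3 : Integrable (fun ω => ξ i ω ^ 2 * (1 + (W ω - ξ i ω) ^ 2)) μ :=
      hsq.integrable_mul (h.memLp i).integrable_sq j1
    have e3 : ∫ ω, ξ i ω ^ 2 * (1 + (W ω - ξ i ω) ^ 2) ∂μ ≤ 2 * ∫ ω, ξ i ω ^ 2 ∂μ := by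
      rw [show ∫ ω, ξ i ω ^ 2 * (1 + (W ω - ξ i ω) ^ 2) ∂μ = _ from
        hsq.integral_fun_mul_eq_mul_integral
        (h.memLp i).integrable_sq.aestronglyMeasurable j1.aestronglyMeasurable]
      have e4 : ∫ ω, (1 + (W ω - ξ i ω) ^ 2) ∂μ ≤ 2 := by
        rw [integral_add (integrable_const 1) (h.memLp_sub i).integrable_sq]
        have := h.integral_sub_sq_le i
        simp only [integral_const, probReal_univ, one_smul]
        linarith
      have e5 : 0 ≤ ∫ ω, ξ i ω ^ 2 ∂μ := integral_nonneg fun ω => sq_nonneg _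
      simp only [Function.comp_def]
      nlinarith
    calc ∫ ω, ξ i ω * signedPow p (W ω) ∂μ
        = ∫ ω, (ξ i ω * signedPow p (W ω) - ξ i ω * signedPow p (W ω - ξ i ω)) ∂μ := by
          rw [integral_sub i1 i2, hz, sub_zero]
      _ ≤ ∫ ω, (2 * (ξ i ω ^ 2 * (1 + (W ω - ξ i ω) ^ 2)) + |ξ i ω| ^ p) ∂μ := by
          refine integral_mono (i1.sub i2) ((i3.const_mul 2).add (h.integrable i)) fun ω => ?_
          have := abs_signedPow_sub_le hp h.le_three (W ω - ξ i ω) (ξ i ω)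
          rw [sub_add_cancel] at this
          calc _ = ξ i ω * (signedPow p (W ω) - signedPow p (W ω - ξ i ω)) := by ring
            _ ≤ _ := (le_abs_self _).trans this
      _ = 2 * (∫ ω, ξ i ω ^ 2 * (1 + (W ω - ξ i ω) ^ 2) ∂μ) + ∫ ω, |ξ i ω| ^ p ∂μ := by
          rw [integral_add (i3.const_mul 2) (h.integrable i), integral_const_mul]
      _ ≤ _ := by linarith
  rw [integral_congr_ae (Eventually.of_forall h1),
    integral_finsetSum _ fun i _ => hint i W h.measurable_sum h.integrable_sum]
  refine (Finset.sum_le_sum fun i _ => h2 i).trans ?_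
  rw [Finset.sum_add_distrib, ← Finset.mul_sum, absMoment]
  linarith [h.sum_sq]

lemma integral_abs_sub_rpow_le [IsProbabilityMeasure μ] (h : IsMomentFamily ξ p μ) (i : ι) :
    ∫ ω, |∑ j, ξ j ω - ξ i ω| ^ p ∂μ ≤ 4 + absMoment μ ξ p := by
  classical
  have := (h.omitAt i).integral_abs_sum_rpow_le
  simp only [sum_omitAt] at this
  linarith [h.absMoment_omitAt_le i]

lemma measureReal_half_lt_le [IsProbabilityMeasure μ] (h : IsMomentFamily ξ p μ) (i : ι) :
    μ.real {ω | 1 / 2 < |ξ i ω|} ≤ 8 * ∫ ω, |ξ i ω| ^ p ∂μ := by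
  have h1 := measureReal_abs_ge_le h.pos (h.integrable i) (t := 1 / 2) (by norm_num)
  have h2 : 1 / 8 ≤ ((1 / 2 : ℝ)) ^ p := by
    have := Real.rpow_le_rpow_of_exponent_ge (x := (1 / 2 : ℝ)) (by norm_num) (by norm_num)
      h.le_three
    refine le_trans (le_of_eq ?_) this
    norm_num
  have h3 : μ.real {ω | 1 / 2 < |ξ i ω|} ≤ μ.real {ω | 1 / 2 ≤ |ξ i ω|} :=
    measureReal_mono (fun ω hω => le_of_lt (mem_ofPred_eq ▸ hω)) (measure_ne_top μ _)
  refine h3.trans (h1.trans ?_)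
  rw [div_le_iff₀ (by positivity)]
  nlinarith [integral_nonneg_rpow (μ := μ) (ξ i) p]

/-- Large values of the sum in the presence of a large summand. -/
lemma measureReal_le_sum_and_large_le [IsProbabilityMeasure μ] (h : IsMomentFamily ξ p μ)
    (hb : absMoment μ ξ p ≤ 1) {x : ℝ} (hx : 0 < x) :
    μ.real {ω | x ≤ ∑ j, ξ j ω ∧ ∃ i, 1 / 2 < |ξ i ω|} ≤
      41 * absMoment μ ξ p / (x / 2) ^ p := by
  have hx2 : 0 < x / 2 := by linarith
  have hxp : 0 < (x / 2) ^ p := Real.rpow_pos_of_pos hx2 p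
  set W : Ω → ℝ := fun ω => ∑ i, ξ i ω with hW
  have key : ∀ i, μ.real {ω | x ≤ W ω ∧ 1 / 2 < |ξ i ω|} ≤
      41 * (∫ ω, |ξ i ω| ^ p ∂μ) / (x / 2) ^ p := fun i => by
    -- Either the large summand carries half of `x`, or the rest does, and the rest is independent
    -- of `ξ i`. Markov's inequality gives `1 + 8 · 5 = 41`, with `8` from the level `1/2` and `5`
    -- from the moment bound `4 + 1`.
    have hsub : {ω | x ≤ W ω ∧ 1 / 2 < |ξ i ω|} ⊆ {ω | x / 2 ≤ |ξ i ω|} ∪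
        ({ω | 1 / 2 < |ξ i ω|} ∩ {ω | x / 2 ≤ |W ω - ξ i ω|}) := by
      rintro ω ⟨h1, h2⟩
      by_cases h3 : x / 2 ≤ |ξ i ω|
      · exact Or.inl h3
      · refine Or.inr ⟨h2, ?_⟩
        have h4 := le_abs_self (ξ i ω)
        have h5 := le_abs_self (W ω - ξ i ω)
        simp only [mem_ofPred_eq]
        push Not at h3
        linarith
    have hI : μ.real ({ω | 1 / 2 < |ξ i ω|} ∩ {ω | x / 2 ≤ |W ω - ξ i ω|}) =
        μ.real {ω | 1 / 2 < |ξ i ω|} * μ.real {ω | x / 2 ≤ |W ω - ξ i ω|} := by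
      have := (h.indepFun_sub i).measure_inter_preimage_eq_mul {y | 1 / 2 < |y|} {y | x / 2 ≤ |y|}
        (measurableSet_lt measurable_const measurable_id.abs)
        (measurableSet_le measurable_const measurable_id.abs)
      simp only [measureReal_def]
      rw [← ENNReal.toReal_mul]
      exact congrArg ENNReal.toReal this
    have h1 := measureReal_abs_ge_le h.pos (h.integrable i) hx2
    have h2 := measureReal_abs_ge_le h.pos (h.integrable_sub i) hx2
    have h3 := h.measureReal_half_lt_le i
    have h4 := h.integral_abs_sub_rpow_le i
    have h5 := integral_nonneg_rpow (μ := μ) (ξ i) p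
    set c := ∫ ω, |ξ i ω| ^ p ∂μ
    calc μ.real {ω | x ≤ W ω ∧ 1 / 2 < |ξ i ω|}
        ≤ μ.real {ω | x / 2 ≤ |ξ i ω|} +
          μ.real {ω | 1 / 2 < |ξ i ω|} * μ.real {ω | x / 2 ≤ |W ω - ξ i ω|} := by
          rw [← hI]
          exact (measureReal_mono hsub (measure_ne_top μ _)).trans (measureReal_union_le _ _)
      _ ≤ c / (x / 2) ^ p + 8 * c * (5 / (x / 2) ^ p) := by
          gcongr
          exact h2.trans (by gcongr; linarith)
      _ = _ := by ring
  have hsub : {ω | x ≤ W ω ∧ ∃ i, 1 / 2 < |ξ i ω|} ⊆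
      ⋃ i ∈ Finset.univ, {ω | x ≤ W ω ∧ 1 / 2 < |ξ i ω|} := by
    rintro ω ⟨h1, i, h2⟩
    simp only [mem_iUnion]
    exact ⟨i, Finset.mem_univ i, h1, h2⟩
  refine (measureReal_mono hsub (measure_ne_top μ _)).trans ((measureReal_biUnion_finset_le _ _).trans
    ((Finset.sum_le_sum fun i _ => key i).trans (le_of_eq ?_)))
  rw [absMoment, Finset.mul_sum, Finset.sum_div]

/-- Large values of the truncated sum in the presence of a large summand. -/
lemma measureReal_le_sum_trunc_and_large_le [IsProbabilityMeasure μ] (h : IsMomentFamily ξ p μ)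
    {e : ι → ℝ} (hη : IsBoundedFamily (fun i ω => trunc (ξ i ω)) e μ) (x : ℝ) :
    μ.real {ω | x ≤ ∑ j, trunc (ξ j ω) ∧ ∃ i, 1 / 2 < |ξ i ω|} ≤
      24 * absMoment μ ξ p * Real.exp (-x) := by
  classical
  set η : ι → Ω → ℝ := fun i ω => trunc (ξ i ω) with hηdef
  have key : ∀ i, μ.real {ω | x ≤ ∑ j, η j ω ∧ 1 / 2 < |ξ i ω|} ≤
      24 * (∫ ω, |ξ i ω| ^ p ∂μ) * Real.exp (-x) := fun i => by
    have hsub : {ω | x ≤ ∑ j, η j ω ∧ 1 / 2 < |ξ i ω|} ⊆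
        ({ω | 1 / 2 < |ξ i ω|} ∩ {ω | x ≤ ∑ j, η j ω - η i ω}) := by
      rintro ω ⟨h1, h2⟩
      refine ⟨h2, ?_⟩
      -- A large summand is truncated to zero, so the truncated sum equals the sum of the others and
      -- is independent of the event that `ξ i` is large.
      have : η i ω = 0 := if_neg (not_le.2 h2)
      simpa [this] using h1
    have hind : IndepFun (ξ i) (fun ω => ∑ j, η j ω - η i ω) μ := by
      refine ((h.indepFun_rest i).comp measurable_id
        (ψ := fun y : {j // j ≠ i} → ℝ => ∑ j, trunc (y j)) ?_).congr (ae_eq_refl _)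
        (Eventually.of_forall fun ω => ?_)
      · exact Finset.measurable_fun_sum _ fun j _ => measurable_trunc.comp (measurable_pi_apply j)
      · simp only [Function.comp]
        rw [IsL2Family.sum_sub_eq_sum_rest]
    have hI : μ.real ({ω | 1 / 2 < |ξ i ω|} ∩ {ω | x ≤ ∑ j, η j ω - η i ω}) =
        μ.real {ω | 1 / 2 < |ξ i ω|} * μ.real {ω | x ≤ ∑ j, η j ω - η i ω} := by
      have := hind.measure_inter_preimage_eq_mul {y | 1 / 2 < |y|} {y | x ≤ y}
        (measurableSet_lt measurable_const measurable_id.abs)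
        (measurableSet_le measurable_const measurable_id)
      simp only [measureReal_def]
      rw [← ENNReal.toReal_mul]
      exact congrArg ENNReal.toReal this
    have hE : μ.real {ω | x ≤ ∑ j, η j ω - η i ω} ≤ 2.89 * Real.exp (-x) := by
      have h1 := (hη.omitAt i).integral_exp_one_le
      simp only [sum_omitAt] at h1
      have h2 := mul_meas_ge_le_integral_of_nonneg (μ := μ)
        (f := fun ω => Real.exp (∑ j, η j ω - η i ω))
        (Eventually.of_forall fun ω => (Real.exp_pos _).le)
        ((hη.memLp_comp_sub i Real.continuous_exp 1).integrable le_rfl) (Real.exp x)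
      simp only [Real.exp_le_exp] at h2
      rw [Real.exp_neg, ← div_eq_mul_inv, le_div_iff₀ (Real.exp_pos x), mul_comm]
      exact h2.trans h1
    have h3 := h.measureReal_half_lt_le i
    have h5 := integral_nonneg_rpow (μ := μ) (ξ i) p
    calc _ ≤ μ.real {ω | 1 / 2 < |ξ i ω|} * μ.real {ω | x ≤ ∑ j, η j ω - η i ω} := by
          rw [← hI]; exact measureReal_mono hsub (measure_ne_top μ _)
      _ ≤ (8 * ∫ ω, |ξ i ω| ^ p ∂μ) * (2.89 * Real.exp (-x)) := by gcongr
      _ ≤ _ := by nlinarith [mul_nonneg h5 (Real.exp_pos (-x)).le]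
  have hsub : {ω | x ≤ ∑ j, η j ω ∧ ∃ i, 1 / 2 < |ξ i ω|} ⊆
      ⋃ i ∈ Finset.univ, {ω | x ≤ ∑ j, η j ω ∧ 1 / 2 < |ξ i ω|} := by
    rintro ω ⟨h1, i, h2⟩
    simp only [mem_iUnion]
    exact ⟨i, Finset.mem_univ i, h1, h2⟩
  refine (measureReal_mono hsub (measure_ne_top μ _)).trans ((measureReal_biUnion_finset_le _ _).trans
    ((Finset.sum_le_sum fun i _ => key i).trans (le_of_eq ?_)))
  rw [absMoment, Finset.mul_sum, Finset.sum_mul]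

end IsMomentFamily

end NormalApprox

namespace NormalApprox

variable {Ω : Type*} [MeasurableSpace Ω] {μ : Measure Ω} {ι : Type*}

/-! ### Perturbed sums -/

/-- A normalized sum of independent variables perturbed by `T`, where `T' i` approximates `T` and
is independent of the `i`-th summand jointly with the other summands. -/
structure IsPerturbedSum [Fintype ι] (ξ : ι → Ω → ℝ) (p : ℝ) (T : Ω → ℝ) (T' : ι → Ω → ℝ)
    (a : ℝ) (μ : Measure Ω) : Prop extends IsMomentFamily ξ p μ where
  unit : ∑ i, ∫ ω, ξ i ω ^ 2 ∂μ = 1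
  measurable_pert : Measurable T
  memLp_pert : MemLp T 2 μ
  measurable_approx : ∀ i, Measurable (T' i)
  memLp_approx : ∀ i, MemLp (T' i) 2 μ
  indep_approx : ∀ i, IndepFun (ξ i) (fun ω => (T' i ω, fun j : {j // j ≠ i} => ξ j ω)) μ
  nonneg : 0 ≤ a
  integral_sq_le : ∫ ω, T ω ^ 2 ∂μ ≤ a ^ 2
  sum_integral_sq_le : ∑ i, ∫ ω, (T ω - T' i ω) ^ 2 ∂μ ≤ a ^ 2

/-- The nonuniform error bound. -/
def tailBound (a b p z : ℝ) : ℝ :=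
  9 * a ^ 2 / (1 + |z|) ^ 2 + 13.5 * Real.exp (-|z| / 3) * a + 10 ^ 9 * b / (1 + |z|) ^ p

lemma tailBound_neg (a b p z : ℝ) : tailBound a b p (-z) = tailBound a b p z := by
  simp [tailBound]

lemma continuous_tailBound (a b p : ℝ) : Continuous (tailBound a b p) := by
  have h1 : ∀ z : ℝ, 0 < 1 + |z| := fun z => by positivity
  unfold tailBound
  refine ((continuous_const.div (by fun_prop) fun z => (pow_pos (h1 z) 2).ne').add
    (by fun_prop)).add (continuous_const.div ?_ fun z => (Real.rpow_pos_of_pos (h1 z) p).ne')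
  exact (by fun_prop : Continuous fun z : ℝ => 1 + |z|).rpow_const fun z => Or.inl (h1 z).ne'

/-- One term of the exponential series at `(1+z)/3` dominates `(1+z)⁴ ≥ (1+z)^(1+p)`. This converts
all exponential decay attached to the moment term into the required power. -/
lemma one_add_mul_exp_le {p z : ℝ} (hp3 : p ≤ 3) (hz : 0 ≤ z) :
    (1 + z) * Real.exp (-z / 3) ≤ 2800 / (1 + z) ^ p := by
  have h1 : (1 + z) ^ p ≤ (1 + z) ^ 3 := by
    rw [← Real.rpow_natCast]
    exact Real.rpow_le_rpow_of_exponent_le (by linarith) (by norm_num; exact hp3)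
  have h2 := Real.pow_div_factorial_le_exp ((1 + z) / 3) (by positivity) 4
  have e : Real.exp ((1 + z) / 3) * Real.exp (-z / 3) = Real.exp (1 / 3) := by
    rw [← Real.exp_add]; congr 1; ring
  have e1 : Real.exp (1 / 3) ≤ 1.4 := by
    have h := Real.exp_bound' (x := 1 / 3) (by norm_num) (by norm_num) (n := 4) (by norm_num)
    norm_num [Finset.sum_range_succ, Nat.factorial] at h
    norm_num; linarith
  have h0 : 0 < 1 + z := by linarith
  rw [le_div_iff₀ (Real.rpow_pos_of_pos h0 p)]
  have hE := Real.exp_pos (-z / 3)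
  calc (1 + z) * Real.exp (-z / 3) * (1 + z) ^ p
      ≤ (1 + z) * Real.exp (-z / 3) * (1 + z) ^ 3 := by gcongr
    _ = 1944 * (((1 + z) / 3) ^ 4 / 24 * Real.exp (-z / 3)) := by ring
    _ ≤ 1944 * (Real.exp ((1 + z) / 3) * Real.exp (-z / 3)) := by
        gcongr
        simpa [Nat.factorial] using h2
    _ ≤ 2800 := by rw [e]; linarith

lemma exp_le_div_rpow {p z : ℝ} (hp3 : p ≤ 3) (hz : 0 ≤ z) :
    Real.exp (-z / 3) ≤ 2800 / (1 + z) ^ p := by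
  refine le_trans ?_ (one_add_mul_exp_le hp3 hz)
  nlinarith [Real.exp_pos (-z / 3)]

lemma div_rpow_le {p z c : ℝ} (hp0 : 0 < p) (hp3 : p ≤ 3) (hz : 0 ≤ z) {k : ℝ} (hk : 1 ≤ k)
    (hc : (1 + z) / k ≤ c) : 1 / c ^ p ≤ k ^ 3 / (1 + z) ^ p := by
  have h0 : 0 < 1 + z := by linarith
  have hk0 : 0 < k := by linarith
  have h1 : ((1 + z) / k) ^ p ≤ c ^ p := Real.rpow_le_rpow (by positivity) hc hp0.le
  rw [Real.div_rpow h0.le hk0.le] at h1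
  have h2 : k ^ p ≤ k ^ 3 := by
    rw [← Real.rpow_natCast]
    exact Real.rpow_le_rpow_of_exponent_le hk (by norm_num; exact hp3)
  have h3 := Real.rpow_pos_of_pos h0 p
  have h4 := Real.rpow_pos_of_pos hk0 p
  calc 1 / c ^ p ≤ 1 / ((1 + z) ^ p / k ^ p) := one_div_le_one_div_of_le (by positivity) h1
    _ = k ^ p / (1 + z) ^ p := one_div_div _ _
    _ ≤ _ := by gcongr

namespace IsPerturbedSum

variable [Fintype ι] [IsProbabilityMeasure μ] {ξ : ι → Ω → ℝ} {p : ℝ} {T : Ω → ℝ}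
  {T' : ι → Ω → ℝ} {a : ℝ}

lemma neg (h : IsPerturbedSum ξ p T T' a μ) :
    IsPerturbedSum (fun i ω => -ξ i ω) p (fun ω => -T ω) (fun i ω => -T' i ω) a μ where
  toIsMomentFamily := h.toIsMomentFamily.neg
  unit := by simpa using h.unit
  measurable_pert := h.measurable_pert.neg
  memLp_pert := h.memLp_pert.neg
  measurable_approx i := (h.measurable_approx i).neg
  memLp_approx i := (h.memLp_approx i).neg
  indep_approx i := (h.indep_approx i).comp measurable_neg
    (ψ := fun x : ℝ × ({j // j ≠ i} → ℝ) => (-x.1, fun j => -x.2 j)) (by fun_prop)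
  nonneg := h.nonneg
  integral_sq_le := by simpa using h.integral_sq_le
  sum_integral_sq_le := by
    refine le_trans (le_of_eq ?_) h.sum_integral_sq_le
    refine Finset.sum_congr rfl fun i _ => integral_congr_ae (Eventually.of_forall fun ω => ?_)
    simp only; ring

/-- Applied with `f` the identity and with `f = trunc`. The second use is why independence is
required from the family of the other summands and not only from their sum. -/
lemma indep_sub (h : IsPerturbedSum ξ p T T' a μ) (i : ι) {f : ℝ → ℝ} (hf : Measurable f) :
    IndepFun (ξ i) (fun ω => (T' i ω, ∑ j, f (ξ j ω) - f (ξ i ω))) μ := by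
  classical
  refine ((h.indep_approx i).comp measurable_id
    (ψ := fun x : ℝ × ({j // j ≠ i} → ℝ) => (x.1, ∑ j, f (x.2 j))) ?_).congr (ae_eq_refl _)
    (Eventually.of_forall fun ω => ?_)
  · exact measurable_fst.prodMk (Finset.measurable_fun_sum _ fun j _ =>
      hf.comp ((measurable_pi_apply j).comp measurable_snd))
  · simp only [Function.comp]
    rw [IsL2Family.sum_sub_eq_sum_rest (fun i ω => f (ξ i ω))]

/-- The uniform bound. -/
theorem abs_measureReal_sub_Phi_le (h : IsPerturbedSum ξ p T T' a μ) (z : ℝ) :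
    |μ.real {ω | ∑ j, ξ j ω + T ω ≤ z} - Phi z| ≤ 2 * a + 6.6 * absMoment μ ξ p := by
  have h1 := abs_measureReal_add_sub_Phi_le h.toIsL2Family h.centred h.unit h.measurable_pert
    h.memLp_pert h.measurable_approx h.memLp_approx (fun i => h.indep_sub i measurable_id) z
  have h2 : ∫ ω, |∑ j, ξ j ω| * |T ω| ∂μ ≤ a := by
    refine (integral_abs_mul_abs_le h.memLp_sum h.memLp_pert).trans ?_
    rw [h.toIsL2Family.integral_sum_sq h.centred, h.unit, Real.sqrt_one, one_mul]
    exact Real.sqrt_le_iff.2 ⟨h.nonneg, h.integral_sq_le⟩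
  have h3 : ∑ i, ∫ ω, |ξ i ω| * |T ω - T' i ω| ∂μ ≤ a := by
    have e1 : ∑ i, ∫ ω, |ξ i ω| * |T ω - T' i ω| ∂μ ≤
        ∑ i, √(∫ ω, ξ i ω ^ 2 ∂μ) * √(∫ ω, (T ω - T' i ω) ^ 2 ∂μ) :=
      Finset.sum_le_sum fun i _ =>
        integral_abs_mul_abs_le (h.memLp i) (h.memLp_pert.sub (h.memLp_approx i))
    have e2 := Real.sum_sqrt_mul_sqrt_le Finset.univ (f := fun i => ∫ ω, ξ i ω ^ 2 ∂μ)
      (g := fun i => ∫ ω, (T ω - T' i ω) ^ 2 ∂μ)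
      (fun i => integral_nonneg fun ω => sq_nonneg _)
      (fun i => integral_nonneg fun ω => sq_nonneg _)
    rw [h.unit, Real.sqrt_one, one_mul] at e2
    exact e1.trans (e2.trans (Real.sqrt_le_iff.2 ⟨h.nonneg, h.sum_integral_sq_le⟩))
  linarith [h.truncMoment_le]

/-- Chebyshev's inequality; cutting at a third of `z + 1` is the origin of the constant `9`. -/
lemma measureReal_lt_abs_le (h : IsPerturbedSum ξ p T T' a μ) {z : ℝ} (hz : 0 ≤ z) :
    μ.real {ω | (z + 1) / 3 < |T ω|} ≤ 9 * a ^ 2 / (1 + z) ^ 2 := by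
  have h1 := mul_meas_ge_le_integral_of_nonneg (μ := μ) (f := fun ω => T ω ^ 2)
    (Eventually.of_forall fun ω => sq_nonneg _) h.memLp_pert.integrable_sq (((z + 1) / 3) ^ 2)
  have h2 : μ.real {ω | (z + 1) / 3 < |T ω|} ≤ μ.real {ω | ((z + 1) / 3) ^ 2 ≤ T ω ^ 2} :=
    measureReal_mono (fun ω hω => by
      have h3 : (z + 1) / 3 < |T ω| := hω
      have : ((z + 1) / 3) ^ 2 ≤ |T ω| ^ 2 := pow_le_pow_left₀ (by positivity) h3.le 2
      rwa [sq_abs] at this) (measure_ne_top μ _)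
  rw [le_div_iff₀ (by positivity)]
  have h3 := h.integral_sq_le
  nlinarith [mul_le_mul_of_nonneg_left h2 (sq_nonneg (z + 1))]

/-- Concentration of the truncated sum in an interval governed by the perturbation. -/
lemma measureReal_interval_le (h : IsPerturbedSum ξ p T T' a μ)
    (hb : truncMoment μ ξ ≤ 1 / 100) {z : ℝ} (hz : 2 ≤ z) {α : ℝ} (hα0 : 0 ≤ α) (hα1 : α ≤ 1) :
    μ.real {ω | z - α * min |T ω| ((z + 1) / 3) ≤ ∑ j, trunc (ξ j ω) ∧
      ∑ j, trunc (ξ j ω) ≤ z - α * min |T ω| ((z + 1) / 3) + min |T ω| ((z + 1) / 3)} ≤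
      13.5 * Real.exp (-z / 3) * a + 48 * truncMoment μ ξ * ((1 + z) * Real.exp (-z / 3)) := by
  have hη := h.toIsL2Family.isNearUnitFamily_trunc h.centred h.unit hb
  set b := truncMoment μ ξ with hbdef
  have hb0 := hη.pos
  set B := (z + 1) / 3 with hB
  have hB0 : 0 ≤ B := by positivity
  have hmin0 : ∀ x : ℝ, 0 ≤ min |x| B := fun x => le_min (abs_nonneg x) hB0
  have hlip : ∀ x y : ℝ, (min |x| B - min |y| B) ^ 2 ≤ (x - y) ^ 2 := fun x y => by
    refine sq_le_sq.2 ((abs_min_sub_min_le_max |x| B |y| B).trans ?_)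
    rw [sub_self, abs_zero]
    exact max_le (abs_abs_sub_abs_le_abs_sub x y) (abs_nonneg _)
  have hc := measureReal_mul_exp_le_of_randomInterval hη.toIsBoundedFamily
    (D := fun ω => min |T ω| B) (D' := fun i ω => min |T' i ω| B) (B := B)
    (h.measurable_pert.abs.min measurable_const)
    (fun i => (h.measurable_approx i).abs.min measurable_const)
    (fun ω => hmin0 _) (fun i ω => hmin0 _) (fun ω => min_le_right _ _)
    (fun i ω => min_le_right _ _)
    (fun i => (h.indep_sub i measurable_trunc).comp measurable_trunc
      (ψ := fun x : ℝ × ℝ => (min |x.1| B, x.2)) (by fun_prop))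
    -- The interval has length at most `(z+1)/3`, so it lies to the right of `z - (z+1)/3 =
    -- (2z-1)/3`. Half of this in the exponent is `z/3 - 1/6`, which explains the rate `exp (-z/3)`.
    (d := 2 * b) (a := α) (z := z) (z₀ := (2 * z - 1) / 3) (by positivity) (by linarith) hα0 hα1
    (fun ω => by
      have h1 : α * min |T ω| B ≤ 1 * B :=
        mul_le_mul hα1 (min_le_right _ _) (hmin0 _) zero_le_one
      rw [hB] at *
      linarith) (le_trans (by norm_num) hη.sum_truncProd_ge)
  set P := μ.real {ω | z - α * min |T ω| B ≤ ∑ j, trunc (ξ j ω) ∧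
      ∑ j, trunc (ξ j ω) ≤ z - α * min |T ω| B + min |T ω| B} with hP
  have hDm : MemLp (fun ω => min |T ω| B) 2 μ :=
    h.memLp_pert.mono (h.measurable_pert.abs.min measurable_const).aestronglyMeasurable
      (Eventually.of_forall fun ω => by
        rw [Real.norm_of_nonneg (hmin0 _)]; exact min_le_left _ _)
  have hDm' : ∀ i, MemLp (fun ω => min |T' i ω| B) 2 μ := fun i =>
    (h.memLp_approx i).mono
      ((h.measurable_approx i).abs.min measurable_const).aestronglyMeasurable
      (Eventually.of_forall fun ω => by
        rw [Real.norm_of_nonneg (hmin0 _)]; exact min_le_left _ _)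
  have s1 : √(∫ ω, min |T ω| B ^ 2 ∂μ) ≤ a := by
    refine Real.sqrt_le_iff.2 ⟨h.nonneg, le_trans ?_ h.integral_sq_le⟩
    refine integral_mono hDm.integrable_sq h.memLp_pert.integrable_sq fun ω => ?_
    rw [← sq_abs (T ω)]
    exact pow_le_pow_left₀ (hmin0 _) (min_le_left _ _) 2
  have s2 : √(∑ i, ∫ ω, (min |T ω| B - min |T' i ω| B) ^ 2 ∂μ) ≤ a := by
    refine Real.sqrt_le_iff.2 ⟨h.nonneg, le_trans ?_ h.sum_integral_sq_le⟩
    exact Finset.sum_le_sum fun i _ => integral_mono (hDm.sub (hDm' i)).integrable_sq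
      (h.memLp_pert.sub (h.memLp_approx i)).integrable_sq fun ω => hlip _ _
  have s3 : 2 * (B + 2 * (2 * b)) * ∑ i, 4 * ∫ ω, ξ i ω ^ 2 * min 1 |ξ i ω| ∂μ ≤
      2 * (B + 2 * (2 * b)) * (4 * b) := by
    gcongr; exact hη.sum_mean_le
  have e1 : Real.exp ((2 * z - 1) / 3 / 2) * (Real.exp (1 / 6) * Real.exp (-z / 3)) = 1 := by
    rw [← Real.exp_add, ← Real.exp_add, Real.exp_eq_one_iff]; ring
  have e2 : Real.exp (1 / 6) ≤ 1.19 := by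
    have h := Real.exp_bound' (x := 1 / 6) (by norm_num) (by norm_num) (n := 3) (by norm_num)
    norm_num [Finset.sum_range_succ, Nat.factorial] at h
    norm_num; linarith
  have e3 := Real.exp_pos (-z / 3)
  have s4 : 2 * (B + 2 * (2 * b)) * (4 * b) ≤ (2.8 * z + 3) * b := by
    rw [hB]; nlinarith [hη.le]
  have hz0 : 0 ≤ z := by linarith
  have ha := h.nonneg
  calc P = P * Real.exp ((2 * z - 1) / 3 / 2) * (Real.exp (1 / 6) * Real.exp (-z / 3)) := by
        rw [mul_assoc, e1, mul_one]
    _ ≤ (1.27 * (7.54 * a + (2.8 * z + 31) * b)) * (1.19 * Real.exp (-z / 3)) := by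
        refine mul_le_mul (hc.trans ?_) (by gcongr) (by positivity) (by positivity)
        linarith
    _ ≤ (13.5 * a + 48 * b * (1 + z)) * Real.exp (-z / 3) := by
        rw [← mul_assoc]
        refine mul_le_mul_of_nonneg_right ?_ e3.le
        nlinarith [mul_nonneg hz0 hb0.le]
    _ = _ := by ring

/-- The bound on the right half-line when the moments are small. -/
lemma abs_measureReal_sub_Phi_le_of_small (h : IsPerturbedSum ξ p T T' a μ)
    (hb : absMoment μ ξ p ≤ 1 / 100) {z : ℝ} (hz : 2 ≤ z) :
    |μ.real {ω | ∑ j, ξ j ω + T ω ≤ z} - Phi z| ≤ tailBound a (absMoment μ ξ p) p z := by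
  have hβb := h.truncMoment_le
  have hβ : truncMoment μ ξ ≤ 1 / 100 := hβb.trans hb
  have hη := h.toIsL2Family.isNearUnitFamily_trunc h.centred h.unit hβ
  set b := absMoment μ ξ p with hbdef
  have hb0 : 0 < b := hη.pos.trans_le hβb
  have hz0 : 0 ≤ z := by linarith
  set R := b / (1 + z) ^ p with hR
  have hzp : 0 < (1 + z) ^ p := Real.rpow_pos_of_pos (by linarith) p
  have hR0 : 0 < R := by positivity
  have hexp := one_add_mul_exp_le h.le_three hz0
  have hexp1 := exp_le_div_rpow h.le_three hz0
  have hRe : b * (2800 / (1 + z) ^ p) = 2800 * R := by rw [hR]; ring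
  set W : Ω → ℝ := fun ω => ∑ j, ξ j ω with hW
  set Wb : Ω → ℝ := fun ω => ∑ j, trunc (ξ j ω) with hWb
  have hWbm : Measurable Wb := hη.measurable_sum
  have hWm : Measurable W := h.measurable_sum
  have heq : ∀ ω, (¬ ∃ i, 1 / 2 < |ξ i ω|) → Wb ω = W ω := fun ω hω => by
    push Not at hω
    exact Finset.sum_congr rfl fun i _ => if_pos (hω i)
  have hconc : ∀ α : ℝ, 0 ≤ α → α ≤ 1 →
      μ.real {ω | z - α * min |T ω| ((z + 1) / 3) ≤ Wb ω ∧
        Wb ω ≤ z - α * min |T ω| ((z + 1) / 3) + min |T ω| ((z + 1) / 3)} ≤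
      13.5 * Real.exp (-z / 3) * a + 134400 * R := fun α hα0 hα1 => by
    refine (h.measureReal_interval_le hβ hz hα0 hα1).trans ?_
    have : truncMoment μ ξ * ((1 + z) * Real.exp (-z / 3)) ≤ b * (2800 / (1 + z) ^ p) :=
      mul_le_mul hβb hexp (by positivity) hb0.le
    linarith
  have hJ1 : μ.real {ω | z ≤ Wb ω ∧ ∃ i, 1 / 2 < |ξ i ω|} ≤ 67200 * R := by
    refine (h.measureReal_le_sum_trunc_and_large_le hη.toIsBoundedFamily z).trans ?_
    have h1 : Real.exp (-z) ≤ 2800 / (1 + z) ^ p :=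
      (Real.exp_le_exp.2 (by linarith)).trans hexp1
    have := mul_le_mul_of_nonneg_left h1 hb0.le
    linarith
  -- When `W + T > z` and `|T| ≤ (z+1)/3`, only `W ≥ (2z-1)/3` is known. Half of this level is at
  -- least `(1+z)/6`, precisely because `z ≥ 2`, and `8856 = 41 · 6³`.
  have hJ2 : μ.real {ω | (2 * z - 1) / 3 ≤ W ω ∧ ∃ i, 1 / 2 < |ξ i ω|} ≤ 8856 * R := by
    refine (h.measureReal_le_sum_and_large_le (by linarith) (by linarith)).trans ?_
    have h1 := div_rpow_le (c := (2 * z - 1) / 3 / 2) h.pos h.le_three hz0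
      (k := 6) (by norm_num) (by linarith)
    have h2 := mul_le_mul_of_nonneg_left h1 hb0.le
    calc _ = 41 * (b * (1 / ((2 * z - 1) / 3 / 2) ^ p)) := by ring
      _ ≤ 41 * (b * (6 ^ 3 / (1 + z) ^ p)) := by gcongr
      _ = _ := by rw [hR]; ring
  have hΔ := h.measureReal_lt_abs_le hz0
  have hA : MeasurableSet {ω | W ω + T ω ≤ z} :=
    measurableSet_le (hWm.add h.measurable_pert) measurable_const
  have hB : MeasurableSet {ω | Wb ω ≤ z} := measurableSet_le hWbm measurable_const
  have hu3 : ∀ A B C : Set Ω, μ.real (A ∪ B ∪ C) ≤ μ.real A + μ.real B + μ.real C := fun A B C =>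
    (measureReal_union_le _ _).trans (add_le_add (measureReal_union_le _ _) le_rfl)
  have hcmp : |μ.real {ω | W ω + T ω ≤ z} - μ.real {ω | Wb ω ≤ z}| ≤
      9 * a ^ 2 / (1 + z) ^ 2 + (13.5 * Real.exp (-z / 3) * a + 134400 * R) + 67200 * R := by
    refine abs_measureReal_sub_le hA hB ?_ ?_
    · have hsub : {ω | W ω + T ω ≤ z} \ {ω | Wb ω ≤ z} ⊆ {ω | (z + 1) / 3 < |T ω|} ∪
          {ω | z - 0 * min |T ω| ((z + 1) / 3) ≤ Wb ω ∧
            Wb ω ≤ z - 0 * min |T ω| ((z + 1) / 3) + min |T ω| ((z + 1) / 3)} ∪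
          {ω | z ≤ Wb ω ∧ ∃ i, 1 / 2 < |ξ i ω|} := by
        rintro ω ⟨h1, h2⟩
        have h1 : W ω + T ω ≤ z := h1
        have h2 : ¬ Wb ω ≤ z := h2
        push Not at h2
        by_cases h3 : (z + 1) / 3 < |T ω|
        · exact Or.inl (Or.inl h3)
        by_cases h4 : ∃ i, 1 / 2 < |ξ i ω|
        · exact Or.inr ⟨h2.le, h4⟩
        · refine Or.inl (Or.inr ?_)
          rw [mem_ofPred_eq, min_eq_left (not_lt.1 h3)]
          have := heq ω h4
          have h5 := neg_abs_le (T ω)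
          constructor <;> linarith
      refine (measureReal_mono hsub (measure_ne_top μ _)).trans ((hu3 _ _ _).trans ?_)
      exact add_le_add (add_le_add hΔ (hconc 0 le_rfl zero_le_one)) hJ1
    · have hsub : {ω | Wb ω ≤ z} \ {ω | W ω + T ω ≤ z} ⊆ {ω | (z + 1) / 3 < |T ω|} ∪
          {ω | z - 1 * min |T ω| ((z + 1) / 3) ≤ Wb ω ∧
            Wb ω ≤ z - 1 * min |T ω| ((z + 1) / 3) + min |T ω| ((z + 1) / 3)} ∪
          {ω | (2 * z - 1) / 3 ≤ W ω ∧ ∃ i, 1 / 2 < |ξ i ω|} := by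
        rintro ω ⟨h1, h2⟩
        have h1 : Wb ω ≤ z := h1
        have h2 : ¬ W ω + T ω ≤ z := h2
        push Not at h2
        have h5 := le_abs_self (T ω)
        by_cases h3 : (z + 1) / 3 < |T ω|
        · exact Or.inl (Or.inl h3)
        by_cases h4 : ∃ i, 1 / 2 < |ξ i ω|
        · refine Or.inr ⟨?_, h4⟩
          push Not at h3
          linarith
        · refine Or.inl (Or.inr ?_)
          rw [mem_ofPred_eq, min_eq_left (not_lt.1 h3)]
          have := heq ω h4
          constructor <;> linarith
      refine (measureReal_mono hsub (measure_ne_top μ _)).trans ((hu3 _ _ _).trans ?_)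
      exact add_le_add (add_le_add hΔ (hconc 1 zero_le_one le_rfl)) (hJ2.trans (by linarith))
  have hBE : |μ.real {ω | Wb ω ≤ z} - Phi z| ≤ 168000000 * R := by
    refine (hη.abs_measureReal_sub_Phi_le_exp hz0).trans ?_
    have h1 : Real.exp (-z / 2) ≤ 2800 / (1 + z) ^ p :=
      (Real.exp_le_exp.2 (by linarith)).trans hexp1
    have : truncMoment μ ξ * Real.exp (-z / 2) ≤ b * (2800 / (1 + z) ^ p) :=
      mul_le_mul hβb h1 (Real.exp_pos _).le hb0.le
    linarith
  have htri := abs_sub_le (μ.real {ω | W ω + T ω ≤ z}) (μ.real {ω | Wb ω ≤ z}) (Phi z)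
  rw [tailBound, abs_of_nonneg hz0]
  have e : 10 ^ 9 * b / (1 + z) ^ p = 10 ^ 9 * R := by rw [hR]; ring
  rw [e]
  linarith

/-- The bound on the right half-line when the moments are not small. -/
lemma abs_measureReal_sub_Phi_le_of_large (h : IsPerturbedSum ξ p T T' a μ)
    (hb : 1 / 100 ≤ absMoment μ ξ p) {z : ℝ} (hz : 2 ≤ z) :
    |μ.real {ω | ∑ j, ξ j ω + T ω ≤ z} - Phi z| ≤ tailBound a (absMoment μ ξ p) p z := by
  set b := absMoment μ ξ p with hbdef
  have hz0 : 0 ≤ z := by linarith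
  have ha := h.nonneg
  set R := b / (1 + z) ^ p with hR
  have hzp : 0 < (1 + z) ^ p := Real.rpow_pos_of_pos (by linarith) p
  have hb0 : 0 < b := by linarith
  have hR0 : 0 < R := by positivity
  set W : Ω → ℝ := fun ω => ∑ j, ξ j ω with hW
  have hA : MeasurableSet {ω | W ω + T ω ≤ z} :=
    measurableSet_le (h.measurable_sum.add h.measurable_pert) measurable_const
  -- No normal approximation is needed: both right tails are small separately. As `b ≥ 1/100`, the
  -- additive `4` of the moment inequality is at most `400 b`.
  have h1 : 1 - μ.real {ω | W ω + T ω ≤ z} ≤ 9 * a ^ 2 / (1 + z) ^ 2 + 10827 * R := by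
    rw [← probReal_compl_eq_one_sub hA]
    have hsub : {ω | W ω + T ω ≤ z}ᶜ ⊆ {ω | (z + 1) / 3 < |T ω|} ∪
        {ω | (2 * z - 1) / 3 ≤ |W ω|} := by
      intro ω hω
      have hω : ¬ W ω + T ω ≤ z := hω
      by_cases h3 : (z + 1) / 3 < |T ω|
      · exact Or.inl h3
      · refine Or.inr ?_
        push Not at h3 hω
        rw [mem_ofPred_eq]
        have := le_abs_self (T ω)
        have := le_abs_self (W ω)
        linarith
    have hM := measureReal_abs_ge_le h.pos h.integrable_sum (t := (2 * z - 1) / 3) (by linarith)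
    have hd := div_rpow_le (c := (2 * z - 1) / 3) h.pos h.le_three hz0
      (k := 3) (by norm_num) (by linarith)
    refine (measureReal_mono hsub (measure_ne_top μ _)).trans ((measureReal_union_le _ _).trans
      (add_le_add (h.measureReal_lt_abs_le hz0) (hM.trans ?_)))
    have hros := h.integral_abs_sum_rpow_le
    calc _ = (∫ ω, |W ω| ^ p ∂μ) * (1 / ((2 * z - 1) / 3) ^ p) := by ring
      _ ≤ (401 * b) * (3 ^ 3 / (1 + z) ^ p) := by
          refine mul_le_mul (by linarith) hd ?_ (by positivity)
          exact one_div_nonneg.2 (Real.rpow_nonneg (by linarith) p)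
      _ = _ := by rw [hR]; ring
  have h2 : 1 - Phi z ≤ 280000 * R := by
    refine (one_sub_Phi_le hz0).trans ?_
    have e1 : Real.exp (-z ^ 2 / 2) ≤ Real.exp (-z / 3) := Real.exp_le_exp.2 (by nlinarith)
    have e2 := exp_le_div_rpow h.le_three hz0
    have e3 : 2800 / (1 + z) ^ p ≤ 280000 * R := by
      rw [hR, mul_div_assoc']; gcongr; linarith
    linarith [Real.exp_pos (-z ^ 2 / 2)]
  have h3 : 0 ≤ 9 * a ^ 2 / (1 + z) ^ 2 := by positivity
  have h4 : 0 ≤ 13.5 * Real.exp (-z / 3) * a := by positivity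
  have h5 : μ.real {ω | W ω + T ω ≤ z} ≤ 1 := measureReal_le_one
  have h6 := Phi_le_one z
  rw [tailBound, abs_of_nonneg hz0, abs_le]
  have e : 10 ^ 9 * b / (1 + z) ^ p = 10 ^ 9 * R := by rw [hR]; ring
  rw [e]
  constructor <;> linarith

/-- In this range `13.5 exp (-|z|/3) ≥ 2` and `(1+|z|)^p ≤ 27`, so the uniform bound is already of
the required form. -/
lemma abs_measureReal_sub_Phi_le_of_abs_le_two (h : IsPerturbedSum ξ p T T' a μ) {z : ℝ}
    (hz : |z| ≤ 2) :
    |μ.real {ω | ∑ j, ξ j ω + T ω ≤ z} - Phi z| ≤ tailBound a (absMoment μ ξ p) p z := by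
  refine (h.abs_measureReal_sub_Phi_le z).trans ?_
  have ha := h.nonneg
  have hb := IsMomentFamily.absMoment_nonneg (μ := μ) ξ p
  have h1 : 2 * a ≤ 13.5 * Real.exp (-|z| / 3) * a := by
    have : 1 / 3 ≤ Real.exp (-|z| / 3) := by
      have := Real.add_one_le_exp (-|z| / 3); linarith
    nlinarith
  have h2 : 6.6 * absMoment μ ξ p ≤ 10 ^ 9 * absMoment μ ξ p / (1 + |z|) ^ p := by
    rw [le_div_iff₀ (Real.rpow_pos_of_pos (by positivity) p)]
    have h3 : (1 + |z|) ^ p ≤ 27 := by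
      calc (1 + |z|) ^ p ≤ 3 ^ p := Real.rpow_le_rpow (by positivity) (by linarith) h.pos.le
        _ ≤ 3 ^ (3 : ℝ) := Real.rpow_le_rpow_of_exponent_le (by norm_num) h.le_three
        _ = 27 := by norm_num
    nlinarith
  have h3 : 0 ≤ 9 * a ^ 2 / (1 + |z|) ^ 2 := by positivity
  rw [tailBound]
  linarith

lemma abs_measureReal_sub_Phi_le_tail_of_le (h : IsPerturbedSum ξ p T T' a μ) {z : ℝ}
    (hz : -2 ≤ z) :
    |μ.real {ω | ∑ j, ξ j ω + T ω ≤ z} - Phi z| ≤ tailBound a (absMoment μ ξ p) p z := by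
  rcases le_total z 2 with h1 | h1
  · exact h.abs_measureReal_sub_Phi_le_of_abs_le_two (abs_le.2 ⟨hz, h1⟩)
  · rcases le_total (absMoment μ ξ p) (1 / 100) with h2 | h2
    · exact h.abs_measureReal_sub_Phi_le_of_small h2 h1
    · exact h.abs_measureReal_sub_Phi_le_of_large h2 h1

/-- The nonuniform bound. -/
theorem abs_measureReal_sub_Phi_le_tail (h : IsPerturbedSum ξ p T T' a μ) (z : ℝ) :
    |μ.real {ω | ∑ j, ξ j ω + T ω ≤ z} - Phi z| ≤ tailBound a (absMoment μ ξ p) p z := by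
  rcases le_or_gt (-2) z with hz | hz
  · exact h.abs_measureReal_sub_Phi_le_tail_of_le hz
  set V : Ω → ℝ := fun ω => ∑ j, ξ j ω + T ω with hV
  have hVm : Measurable V := h.measurable_sum.add h.measurable_pert
  have hb : absMoment μ (fun i ω => -ξ i ω) p = absMoment μ ξ p := by simp [absMoment]
  -- Negation gives the bound for the strict inequality. The non-strict one follows by letting `x`
  -- decrease to `z`, using right continuity of `Φ` and continuity of the bound.
  have key : ∀ x < 0, |μ.real {ω | V ω < x} - Phi x| ≤ tailBound a (absMoment μ ξ p) p x := by
    intro x hx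
    have h1 := h.neg.abs_measureReal_sub_Phi_le_tail_of_le (z := -x) (by linarith)
    rw [hb, tailBound_neg, Phi_neg] at h1
    have h2 : {ω | ∑ j, -ξ j ω + -T ω ≤ -x} = {ω | V ω < x}ᶜ := by
      ext ω
      simp only [mem_ofPred_eq, mem_compl_iff, not_lt, Finset.sum_neg_distrib, hV]
      constructor <;> intro h3 <;> linarith
    rw [h2, probReal_compl_eq_one_sub (measurableSet_lt hVm measurable_const)] at h1
    rw [show 1 - μ.real {ω | V ω < x} - (1 - Phi x) = -(μ.real {ω | V ω < x} - Phi x) by ring,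
      abs_neg] at h1
    exact h1
  have hlow := (abs_le.1 (key z (by linarith))).1
  have hmono : μ.real {ω | V ω < z} ≤ μ.real {ω | V ω ≤ z} :=
    measureReal_mono (s₁ := {ω | V ω < z}) (s₂ := {ω | V ω ≤ z})
      (fun ω (hω : V ω < z) => hω.le) (measure_ne_top μ _)
  have hup : μ.real {ω | V ω ≤ z} ≤ Phi z + tailBound a (absMoment μ ξ p) p z := by
    have hlim : Tendsto (fun x => Phi x + tailBound a (absMoment μ ξ p) p x) (𝓝[>] z)
        (𝓝 (Phi z + tailBound a (absMoment μ ξ p) p z)) := by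
      refine Tendsto.add ?_ ((continuous_tailBound _ _ _).tendsto z |>.mono_left inf_le_left)
      exact ((cdf (gaussianReal 0 1)).right_continuous z).tendsto.mono_left
        (nhdsWithin_mono _ Ioi_subset_Ici_self)
    refine ge_of_tendsto hlim ?_
    filter_upwards [Ioo_mem_nhdsGT (by linarith : z < 0)] with x hx
    have h1 := (abs_le.1 (key x hx.2)).2
    have h2 : μ.real {ω | V ω ≤ z} ≤ μ.real {ω | V ω < x} :=
      measureReal_mono (fun ω hω => lt_of_le_of_lt (show V ω ≤ z from hω) hx.1)
        (measure_ne_top μ _)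
    linarith
  rw [abs_le]
  constructor <;> linarith

end IsPerturbedSum

end NormalApprox

/-! ### Counting index tuples -/

namespace Multisample

section Counting

-- Strictly increasing tuples correspond to their images, so this counts the `m`-element sets
-- containing `Q`.
open Classical in
lemma card_strictMono_filter (m n : ℕ) (Q : Finset (Fin n)) (hQ : Q.card ≤ m) :
    (Finset.univ.filter fun s : Fin m → Fin n =>
      StrictMono s ∧ Q ⊆ Finset.univ.image s).card = (n - Q.card).choose (m - Q.card) := by
  have h0 := Finset.card_filter_powersetCard_subset Q Finset.univ m (Finset.subset_univ Q) hQ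
  rw [Finset.card_fin] at h0
  rw [← h0]
  refine Finset.card_bij (fun s _ => Finset.univ.image s) ?_ ?_ ?_
  · intro s hs
    obtain ⟨h1, h2⟩ := (Finset.mem_filter.1 hs).2
    rw [Finset.mem_filter, Finset.mem_powersetCard]
    refine ⟨⟨Finset.subset_univ _, ?_⟩, h2⟩
    rw [Finset.card_image_of_injective _ h1.injective, Finset.card_fin]
  · intro s hs t ht hst
    have h1 := (Finset.mem_filter.1 hs).2.1
    have h2 := (Finset.mem_filter.1 ht).2.1
    refine (h1.range_inj h2).1 ?_
    simpa using congrArg (fun F : Finset (Fin n) => (F : Set (Fin n))) hst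
  · intro t ht
    rw [Finset.mem_filter, Finset.mem_powersetCard] at ht
    refine ⟨t.orderEmbOfFin ht.1.2, ?_, Finset.image_orderEmbOfFin_univ t ht.1.2⟩
    rw [Finset.mem_filter]
    exact ⟨Finset.mem_univ _, (t.orderEmbOfFin ht.1.2).strictMono,
      by rw [Finset.image_orderEmbOfFin_univ]; exact ht.2⟩

/-- The ratio of the binomial coefficients is the product of `(m - i)/(n - i)` over `i < r`, and
each factor is at most `m/n`. -/
lemma choose_sub_mul_pow_le {m n : ℕ} (hmn : m ≤ n) :
    ∀ r ≤ m, (n - r).choose (m - r) * n ^ r ≤ n.choose m * m ^ r := by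
  intro r
  induction r with
  | zero => simp
  | succ r ih =>
    intro hr
    have h1 := ih (by omega)
    obtain ⟨m', rfl⟩ : ∃ m', m = m' + 1 + r := ⟨m - 1 - r, by omega⟩
    obtain ⟨n', rfl⟩ : ∃ n', n = n' + 1 + r := ⟨n - 1 - r, by omega⟩
    have e1 : n' + 1 + r - (r + 1) = n' := by omega
    have e2 : m' + 1 + r - (r + 1) = m' := by omega
    have e3 : n' + 1 + r - r = n' + 1 := by omega
    have e4 : m' + 1 + r - r = m' + 1 := by omega
    rw [e1, e2]
    rw [e3, e4] at h1
    have h2 := Nat.add_one_mul_choose_eq n' m'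
    refine Nat.le_of_mul_le_mul_left (c := n' + 1) ?_ (Nat.succ_pos _)
    set N := n' + 1 + r with hN
    set M := m' + 1 + r with hM
    have h3 : (m' + 1) * N ≤ (n' + 1) * M := by
      rw [hN, hM]; nlinarith
    calc (n' + 1) * (n'.choose m' * N ^ (r + 1))
        = ((n' + 1) * n'.choose m') * N ^ r * N := by ring
      _ = ((n' + 1).choose (m' + 1) * N ^ r) * ((m' + 1) * N) := by rw [h2]; ring
      _ ≤ (N.choose M * M ^ r) * ((n' + 1) * M) := Nat.mul_le_mul h1 h3
      _ = _ := by ring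

open Classical in
lemma card_strictMono_filter_le {m n : ℕ} (hm : 1 ≤ m) (hmn : m ≤ n) (Q : Finset (Fin n)) :
    ((Finset.univ.filter fun s : Fin m → Fin n =>
      StrictMono s ∧ Q ⊆ Finset.univ.image s).card : ℝ) ≤
      n.choose m * ((m : ℝ) / n) ^ Q.card := by
  rcases le_or_gt Q.card m with hQ | hQ
  · rw [card_strictMono_filter m n Q hQ, div_pow, mul_div_assoc']
    have hn : (0 : ℝ) < n := by exact_mod_cast (by omega : 0 < n)
    rw [le_div_iff₀ (by positivity)]
    exact_mod_cast choose_sub_mul_pow_le hmn Q.card hQ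
  · rw [Finset.filter_false_of_mem]
    · simp only [Finset.card_empty, Nat.cast_zero]; positivity
    · rintro s - ⟨-, h2⟩
      have h3 := (Finset.card_le_card h2).trans Finset.card_image_le
      rw [Finset.card_fin] at h3
      omega

variable {k : ℕ}

/-- The observation used as the argument `s` of the kernel evaluated at the index tuple `i`. -/
def obs {m n : Fin k → ℕ} (i : ∀ j, Fin (m j) → Fin (n j)) (s : Σ j, Fin (m j)) :
    Σ j, Fin (n j) := ⟨s.1, i s.1 s.2⟩

/-- The set of observations used by an index tuple. -/
def support {m n : Fin k → ℕ} (i : ∀ j, Fin (m j) → Fin (n j)) : Finset (Σ j, Fin (n j)) :=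
  Finset.univ.image (obs i)

open Classical in
/-- The strictly increasing index tuples. -/
def tuples (m n : Fin k → ℕ) : Finset (∀ j, Fin (m j) → Fin (n j)) :=
  Finset.univ.filter fun i => ∀ j, StrictMono (i j)

variable {m n : Fin k → ℕ}

lemma mem_tuples {i : ∀ j, Fin (m j) → Fin (n j)} : i ∈ tuples m n ↔ ∀ j, StrictMono (i j) := by
  simp [tuples]

lemma obs_injective {i : ∀ j, Fin (m j) → Fin (n j)} (hi : ∀ j, Function.Injective (i j)) :
    Function.Injective (obs i) := by
  rintro ⟨j, l⟩ ⟨j', l'⟩ h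
  simp only [obs, Sigma.mk.injEq] at h
  obtain ⟨rfl, h⟩ := h
  rw [hi j (eq_of_heq h)]

lemma mem_support {i : ∀ j, Fin (m j) → Fin (n j)} {j : Fin k} {c : Fin (n j)} :
    (⟨j, c⟩ : Σ j, Fin (n j)) ∈ support i ↔ c ∈ Finset.univ.image (i j) := by
  simp only [support, Finset.mem_image, Finset.mem_univ, true_and]
  constructor
  · rintro ⟨⟨j', l⟩, h⟩
    simp only [obs, Sigma.mk.injEq] at h
    obtain ⟨rfl, h⟩ := h
    exact ⟨l, eq_of_heq h⟩
  · rintro ⟨l, rfl⟩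
    exact ⟨⟨j, l⟩, rfl⟩

-- The blocks are chosen independently, so the condition on `Q` splits into its slices.
open Classical in
lemma card_tuples_filter_eq (Q : Finset (Σ j, Fin (n j))) :
    ((tuples m n).filter fun i => Q ⊆ support i).card =
      ∏ j, (Finset.univ.filter fun s : Fin (m j) → Fin (n j) =>
        StrictMono s ∧ (Finset.univ.filter fun c => (⟨j, c⟩ : Σ j, Fin (n j)) ∈ Q) ⊆
          Finset.univ.image s).card := by
  rw [← Fintype.card_piFinset]
  congr 1
  ext i
  simp only [Finset.mem_filter, mem_tuples, Fintype.mem_piFinset, Finset.mem_univ, true_and,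
    Finset.subset_iff]
  constructor
  · rintro ⟨h1, h2⟩ j
    exact ⟨h1 j, fun c hc => mem_support.1 (h2 hc)⟩
  · intro h
    exact ⟨fun j => (h j).1, fun ⟨j, c⟩ hq => mem_support.2 ((h j).2 hq)⟩

lemma card_tuples (m n : Fin k → ℕ) : (tuples m n).card = ∏ j, (n j).choose (m j) := by
  classical
  have h := card_tuples_filter_eq (m := m) (n := n) ∅
  simp only [Finset.empty_subset, Finset.filter_true, Finset.notMem_empty, Finset.filter_false,
    and_true] at h
  rw [h]
  refine Finset.prod_congr rfl fun j _ => ?_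
  have := card_strictMono_filter (m j) (n j) ∅ (by simp)
  simpa using this

/-- The proportion of index tuples which use a given observation. -/
def weight (m n : Fin k → ℕ) (q : Σ j, Fin (n j)) : ℝ := (m q.1 : ℝ) / n q.1

lemma weight_nonneg (m n : Fin k → ℕ) (q : Σ j, Fin (n j)) : 0 ≤ weight m n q := by
  unfold weight; positivity

open Classical in
lemma card_tuples_filter_le (hm : ∀ j, 1 ≤ m j) (hmn : ∀ j, m j ≤ n j)
    (Q : Finset (Σ j, Fin (n j))) :
    (((tuples m n).filter fun i => Q ⊆ support i).card : ℝ) ≤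
      (tuples m n).card * ∏ q ∈ Q, weight m n q := by
  have hQ : Q = Finset.univ.sigma fun j =>
      Finset.univ.filter fun c => (⟨j, c⟩ : Σ j, Fin (n j)) ∈ Q := by
    ext ⟨j, c⟩; simp
  have h1 : ∏ q ∈ Q, weight m n q = ∏ j, ((m j : ℝ) / n j) ^
      (Finset.univ.filter fun c => (⟨j, c⟩ : Σ j, Fin (n j)) ∈ Q).card := by
    conv_lhs => rw [hQ]
    rw [Finset.prod_sigma]
    simp only [weight, Finset.prod_const]
  rw [card_tuples_filter_eq, card_tuples, h1]
  push_cast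
  rw [← Finset.prod_mul_distrib]
  exact Finset.prod_le_prod (fun j _ => Nat.cast_nonneg _) fun j _ =>
    card_strictMono_filter_le (hm j) (hmn j) _

-- The upper bound holds for every observation, and both sides have the same sum over all
-- observations by double counting: each tuple uses `∑ m_j` of them. Hence equality holds
-- throughout.
open Classical in
lemma card_tuples_filter_mem (hm : ∀ j, 1 ≤ m j) (hmn : ∀ j, m j ≤ n j) (q : Σ j, Fin (n j)) :
    (((tuples m n).filter fun i => q ∈ support i).card : ℝ) =
      (tuples m n).card * weight m n q := by
  have hle : ∀ q : Σ j, Fin (n j), (((tuples m n).filter fun i => q ∈ support i).card : ℝ) ≤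
      (tuples m n).card * weight m n q := fun q => by
    simpa only [Finset.singleton_subset_iff, Finset.prod_singleton] using
      card_tuples_filter_le hm hmn {q}
  have hsum : ∑ q : Σ j, Fin (n j), (((tuples m n).filter fun i => q ∈ support i).card : ℝ) =
      ∑ q : Σ j, Fin (n j), (tuples m n).card * weight m n q := by
    have e1 : ∀ i ∈ tuples m n, (support i).card = ∑ j, m j := fun i hi => by
      rw [support, Finset.card_image_of_injective _
        (obs_injective fun j => (mem_tuples.1 hi j).injective)]
      simp
    have e2 : ∑ q : Σ j, Fin (n j), ((tuples m n).filter fun i => q ∈ support i).card =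
        (tuples m n).card * ∑ j, m j := by
      simp_rw [Finset.card_filter]
      rw [Finset.sum_comm, ← smul_eq_mul, ← Finset.sum_const]
      refine Finset.sum_congr rfl fun i hi => ?_
      rw [← e1 i hi, ← Finset.card_filter]
      congr 1
      ext q; simp
    have e3 : ∑ q : Σ j, Fin (n j), weight m n q = ∑ j, (m j : ℝ) := by
      rw [Fintype.sum_sigma]
      refine Finset.sum_congr rfl fun j _ => ?_
      have : (n j : ℝ) ≠ 0 := by
        have := hm j; have := hmn j
        exact_mod_cast (by omega : n j ≠ 0)
      simp only [weight, Finset.sum_const, Finset.card_univ, Fintype.card_fin, nsmul_eq_mul]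
      field_simp
    rw [← Finset.mul_sum, e3]
    exact_mod_cast e2
  exact (Finset.sum_eq_sum_iff_of_le fun q _ => hle q).1 hsum q (Finset.mem_univ q)

lemma sum_weight_sq (m : Fin k → ℕ) (hn : ∀ j, 1 ≤ n j) :
    ∑ q : Σ j, Fin (n j), weight m n q ^ 2 = ∑ j, (m j : ℝ) ^ 2 / n j := by
  rw [Fintype.sum_sigma]
  refine Finset.sum_congr rfl fun j _ => ?_
  have : (n j : ℝ) ≠ 0 := by have := hn j; exact_mod_cast (by omega : n j ≠ 0)
  simp only [weight, Finset.sum_const, Finset.card_univ, Fintype.card_fin, nsmul_eq_mul]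
  field_simp

open Classical in
/-- The number of pairs of index tuples which share `q` and another observation. -/
lemma card_pairs_le (hm : ∀ j, 1 ≤ m j) (hmn : ∀ j, m j ≤ n j) (q : Σ j, Fin (n j)) :
    ((((tuples m n).filter fun i => q ∈ support i) ×ˢ
      ((tuples m n).filter fun i => q ∈ support i)).filter
        fun x => 2 ≤ (support x.1 ∩ support x.2).card).card ≤
      ((tuples m n).card : ℝ) ^ 2 * weight m n q ^ 2 * ∑ j, (m j : ℝ) ^ 2 / n j := by
  set N : ℝ := ((tuples m n).card : ℝ) with hN
  set F : Finset (Σ j, Fin (n j)) → Finset (∀ j, Fin (m j) → Fin (n j)) :=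
    fun Q => (tuples m n).filter fun i => Q ⊆ support i with hF
  -- A union bound over a second shared observation `q'`: both tuples then contain the pair `{q,
  -- q'}`.
  have hsub : ((((tuples m n).filter fun i => q ∈ support i) ×ˢ
      ((tuples m n).filter fun i => q ∈ support i)).filter
        fun x => 2 ≤ (support x.1 ∩ support x.2).card) ⊆
      (Finset.univ.erase q).biUnion fun q' => F {q, q'} ×ˢ F {q, q'} := by
    rintro ⟨i, i'⟩ hx
    simp only [Finset.mem_filter, Finset.mem_product] at hx
    obtain ⟨⟨⟨h1, h2⟩, h3, h4⟩, h5⟩ := hx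
    obtain ⟨q', hq', hne⟩ := Finset.exists_mem_ne (s := support i ∩ support i') (by omega) q
    rw [Finset.mem_inter] at hq'
    simp only [Finset.mem_biUnion, Finset.mem_erase, Finset.mem_univ, and_true,
      Finset.mem_product, hF, Finset.mem_filter, Finset.insert_subset_iff,
      Finset.singleton_subset_iff]
    exact ⟨q', hne, ⟨h1, h2, hq'.1⟩, h3, h4, hq'.2⟩
  have hcard := (Finset.card_le_card hsub).trans Finset.card_biUnion_le
  calc (_ : ℝ) ≤ ((∑ q' ∈ Finset.univ.erase q, (F {q, q'} ×ˢ F {q, q'}).card : ℕ) : ℝ) := by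
        exact_mod_cast hcard
    _ = ∑ q' ∈ Finset.univ.erase q, ((F {q, q'}).card : ℝ) ^ 2 := by
        push_cast
        exact Finset.sum_congr rfl fun q' _ => by
          rw [Finset.card_product]; push_cast; ring
    _ ≤ ∑ q' ∈ Finset.univ.erase q, (N * (weight m n q * weight m n q')) ^ 2 := by
        refine Finset.sum_le_sum fun q' hq' => ?_
        have := card_tuples_filter_le hm hmn {q, q'}
        rw [Finset.prod_pair (Finset.ne_of_mem_erase hq').symm] at this
        exact pow_le_pow_left₀ (by positivity) this 2
    _ ≤ ∑ q', (N * (weight m n q * weight m n q')) ^ 2 :=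
        Finset.sum_le_sum_of_subset_of_nonneg (Finset.erase_subset _ _) fun _ _ _ => sq_nonneg _
    _ = _ := by
        rw [← sum_weight_sq m fun j => (hm j).trans (hmn j), Finset.mul_sum]
        exact Finset.sum_congr rfl fun q' _ => by ring

end Counting

end Multisample

namespace NormalApprox

variable {Ω : Type*} [MeasurableSpace Ω] {μ : Measure Ω} {ι : Type*}

/-! ### Orthogonality of functions of independent variables -/

/-- If the partial average of `G (π U, Z)` given `π U` vanishes, then `G (π U, Z)` is orthogonal
to the functions of `U`, for independent `U` and `Z`. -/
lemma integral_mul_eq_zero_of_indepFun [IsProbabilityMeasure μ] {α β : Type*} [MeasurableSpace α]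
    [MeasurableSpace β] {U : Ω → α} {Z : Ω → β} (hU : Measurable U) (hZ : Measurable Z)
    (hind : IndepFun U Z μ) {π : α → ℝ} (hπ : Measurable π) {G : ℝ × β → ℝ} (hG : Measurable G)
    {F : α → ℝ} (hF : Measurable F) (hG2 : MemLp (fun ω => G (π (U ω), Z ω)) 2 μ)
    (hF2 : MemLp (fun ω => F (U ω)) 2 μ)
    (h0 : ∀ S, MeasurableSet S →
      ∫ ω, S.indicator (fun _ => (1 : ℝ)) (π (U ω)) * G (π (U ω), Z ω) ∂μ = 0) :
    ∫ ω, G (π (U ω), Z ω) * F (U ω) ∂μ = 0 := by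
  have hp : μ.map (fun ω => (U ω, Z ω)) = (μ.map U).prod (μ.map Z) :=
    (indepFun_iff_map_prod_eq_prod_map_map hU.aemeasurable hZ.aemeasurable).1 hind
  have hp' : μ.map (fun ω => (π (U ω), Z ω)) = (μ.map fun ω => π (U ω)).prod (μ.map Z) :=
    (indepFun_iff_map_prod_eq_prod_map_map (hπ.comp hU).aemeasurable hZ.aemeasurable).1
      (hind.comp hπ measurable_id)
  have := Measure.isProbabilityMeasure_map (μ := μ) hU.aemeasurable
  have := Measure.isProbabilityMeasure_map (μ := μ) hZ.aemeasurable
  have := Measure.isProbabilityMeasure_map (μ := μ) (hπ.comp hU).aemeasurable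
  have hUZ : Measurable fun ω => (U ω, Z ω) := hU.prodMk hZ
  have hPZ : Measurable fun ω => (π (U ω), Z ω) := (hπ.comp hU).prodMk hZ
  have hGi : Integrable G ((μ.map fun ω => π (U ω)).prod (μ.map Z)) := by
    rw [← hp']
    exact (integrable_map_measure hG.aestronglyMeasurable hPZ.aemeasurable).2
      (hG2.integrable (by norm_num))
  set ψ : ℝ → ℝ := fun y => ∫ z, G (y, z) ∂(μ.map Z) with hψ
  -- The hypothesis says that the partial average integrates to zero over every measurable set,
  -- hence vanishes almost everywhere. Fubini with the inner integral over `Z` then finishes the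
  -- proof.
  have hψ0 : ψ =ᵐ[μ.map fun ω => π (U ω)] 0 := by
    refine Integrable.ae_eq_zero_of_forall_setIntegral_eq_zero hGi.integral_prod_left
      fun S hS _ => ?_
    have hm : Measurable fun x : ℝ × β => S.indicator (fun _ => (1 : ℝ)) x.1 * G x :=
      ((measurable_const.indicator hS).comp measurable_fst).mul hG
    have hi : Integrable (fun x : ℝ × β => S.indicator (fun _ => (1 : ℝ)) x.1 * G x)
        ((μ.map fun ω => π (U ω)).prod (μ.map Z)) := by
      refine hGi.mono hm.aestronglyMeasurable (Eventually.of_forall fun x => ?_)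
      rw [norm_mul]
      refine mul_le_of_le_one_left (norm_nonneg _) ?_
      refine (norm_indicator_le_norm_self _ _).trans (by simp)
    have h1 := h0 S hS
    rw [← integral_map (φ := fun ω => (π (U ω), Z ω))
      (f := fun x : ℝ × β => S.indicator (fun _ => (1 : ℝ)) x.1 * G x)
      hPZ.aemeasurable hm.aestronglyMeasurable, hp', integral_prod _ hi] at h1
    rw [← h1, ← integral_indicator hS]
    refine integral_congr_ae (Eventually.of_forall fun y => ?_)
    simp only [integral_const_mul]
    by_cases hy : y ∈ S <;> simp [hy, hψ]
  have hprod : Integrable (fun x : α × β => G (π x.1, x.2) * F x.1)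
      ((μ.map U).prod (μ.map Z)) := by
    rw [← hp]
    refine (integrable_map_measure ?_ hUZ.aemeasurable).2 (MemLp.integrable_fun_mul hG2 hF2)
    exact ((hG.comp ((hπ.comp measurable_fst).prodMk measurable_snd)).mul
      (hF.comp measurable_fst)).aestronglyMeasurable
  have h2 : ∫ ω, G (π (U ω), Z ω) * F (U ω) ∂μ =
      ∫ x, G (π x.1, x.2) * F x.1 ∂((μ.map U).prod (μ.map Z)) := by
    rw [← hp, integral_map hUZ.aemeasurable]
    rw [hp]; exact hprod.aestronglyMeasurable
  rw [h2, integral_prod _ hprod]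
  refine integral_eq_zero_of_ae ?_
  have h3 : ∀ᵐ u ∂(μ.map U), ψ (π u) = 0 := by
    have h4 : μ.map (fun ω => π (U ω)) = (μ.map U).map π := (Measure.map_map hπ hU).symm
    rw [h4] at hψ0
    exact ae_of_ae_map hπ.aemeasurable hψ0
  filter_upwards [h3] with u hu
  rw [integral_mul_const]
  have : ∫ z, G (π u, z) ∂(μ.map Z) = 0 := hu
  simp [this]

/-- Functions of the same independent family whose sets of variables meet in at most one point `q`
are orthogonal if the partial average of the first one given the `q`-th variable vanishes. -/
lemma integral_mul_eq_zero_of_dependsOn [DecidableEq ι] [IsProbabilityMeasure μ] {Y : ι → Ω → ℝ}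
    (hY : ∀ i, Measurable (Y i)) (hind : iIndepFun Y μ) {f g : (ι → ℝ) → ℝ} (hf : Measurable f)
    (hg : Measurable g) {S R : Finset ι} {q : ι} (hfS : DependsOn f S) (hgR : DependsOn g R)
    (hSR : S ∩ R ⊆ {q}) (hf2 : MemLp (fun ω => f fun i => Y i ω) 2 μ)
    (hg2 : MemLp (fun ω => g fun i => Y i ω) 2 μ)
    (h0 : ∀ B, MeasurableSet B →
      ∫ ω, B.indicator (fun _ => (1 : ℝ)) (Y q ω) * f (fun i => Y i ω) ∂μ = 0) :
    ∫ ω, f (fun i => Y i ω) * g (fun i => Y i ω) ∂μ = 0 := by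
  -- Extension by zero; the default value is irrelevant, because `f` and `g` only see coordinates
  -- that are filled in.
  set ext : ∀ P : Finset ι, (P → ℝ) → ι → ℝ :=
    fun P x i => if h : i ∈ P then x ⟨i, h⟩ else 0 with hext
  have hextm : ∀ P, Measurable (ext P) := fun P => by
    refine measurable_pi_lambda _ fun i => ?_
    by_cases h : i ∈ P
    · simpa only [hext, h, dite_true] using measurable_pi_apply (⟨i, h⟩ : P)
    · simpa only [hext, h, dite_false] using measurable_const
  -- The shared coordinate `q` goes with `R`, so that `U` determines the second factor and `Z`
  -- carries the rest of `S`.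
  set S' : Finset ι := S.erase q with hS'
  have hdisj : Disjoint (insert q R) S' := by
    rw [Finset.disjoint_left]
    intro i hi hi'
    rw [hS', Finset.mem_erase] at hi'
    rcases Finset.mem_insert.1 hi with h | h
    · exact hi'.1 h
    · exact hi'.1 (Finset.mem_singleton.1 (hSR (Finset.mem_inter.2 ⟨hi'.2, h⟩)))
  have hI := hind.indepFun_finset (insert q R) S' hdisj hY
  have hUm : Measurable fun ω (i : (insert q R : Finset ι)) => Y i ω :=
    measurable_pi_lambda _ fun i => hY i
  have hZm : Measurable fun ω (i : S') => Y i ω :=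
    measurable_pi_lambda _ fun i => hY i
  have hfe : ∀ ω, f (Function.update (ext S' fun i => Y i ω) q (Y q ω)) =
      f fun i => Y i ω := fun ω => by
    refine hfS fun i hi => ?_
    by_cases h : i = q
    · subst h; simp
    · rw [Function.update_of_ne h]
      simp only [hext]
      rw [dif_pos (Finset.mem_erase.2 ⟨h, hi⟩)]
  have hge : ∀ ω, g (ext (insert q R) fun i => Y i ω) = g fun i => Y i ω := fun ω => by
    refine hgR fun i hi => ?_
    simp only [hext]
    rw [dif_pos (Finset.mem_insert_of_mem hi)]
  have hum : Measurable fun x : ℝ × (S' → ℝ) =>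
      Function.update (ext S' x.2) q x.1 := by
    refine measurable_pi_lambda _ fun i => ?_
    by_cases h : i = q
    · subst h; simpa using measurable_fst
    · simp only [Function.update_of_ne h]
      exact (measurable_pi_apply i).comp ((hextm _).comp measurable_snd)
  have := integral_mul_eq_zero_of_indepFun hUm hZm hI
    (π := fun u => u ⟨q, Finset.mem_insert_self q R⟩) (measurable_pi_apply _)
    (G := fun x => f (Function.update (ext S' x.2) q x.1)) (hf.comp hum)
    (F := fun u => g (ext (insert q R) u)) (hg.comp (hextm _))
    (by simpa only [hfe] using hf2) (by simpa only [hge] using hg2)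
    (by simpa only [hfe] using h0)
  simpa only [hfe, hge] using this

end NormalApprox

/-! ### Multisample U-statistics -/

namespace Multisample

open NormalApprox

variable {Ω : Type*} [MeasurableSpace Ω] {μ : Measure Ω} {k : ℕ} {m n : Fin k → ℕ}
  {h : (∀ j, Fin (m j) → ℝ) → ℝ} {X : Fin k → ℕ → Ω → ℝ} {g : Fin k → ℝ → ℝ}

/-- The observations, indexed by their sample and their number. -/
def sampleAt (X : Fin k → ℕ → Ω → ℝ) (q : Σ j, Fin (n j)) : Ω → ℝ := X q.1 q.2

/-- The kernel at the index tuple `i`, as a function of all observations. -/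
def kernelFun (h : (∀ j, Fin (m j) → ℝ) → ℝ) (i : ∀ j, Fin (m j) → Fin (n j))
    (v : (Σ j, Fin (n j)) → ℝ) : ℝ := h fun j l => v ⟨j, i j l⟩

/-- The kernel at the index tuple `i` without its projections, as a function of all
observations. -/
def residual (h : (∀ j, Fin (m j) → ℝ) → ℝ) (g : Fin k → ℝ → ℝ)
    (i : ∀ j, Fin (m j) → Fin (n j)) (v : (Σ j, Fin (n j)) → ℝ) : ℝ :=
  kernelFun h i v - ∑ c ∈ support i, g c.1 (v c)

/-- A centred square integrable symmetric kernel evaluated at independent samples, whose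
projections are the functions `g j` of single observations. -/
structure IsKernelSetting (μ : Measure Ω) (m n : Fin k → ℕ) (h : (∀ j, Fin (m j) → ℝ) → ℝ)
    (X : Fin k → ℕ → Ω → ℝ) (g : Fin k → ℝ → ℝ) : Prop where
  one_le : ∀ j, 1 ≤ m j
  le : ∀ j, m j ≤ n j
  measurable_kernel : Measurable h
  symm : IsBlockSymmetric m h
  sample : IsSample μ n X
  memLp : MemLp (kernelAt m h X) 2 μ
  centred : ∫ ω, kernelAt m h X ω ∂μ = 0
  measurable_proj : ∀ j, Measurable (g j)
  proj_eq : ∀ j, proj μ m h X j = g j ∘ X j 0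

/-- A conditional expectation given `X j 0` is a measurable function of it (Doob–Dynkin). Having `g
j` allows the projection to be evaluated at the other observations of the sample. -/
lemma exists_measurable_proj_eq (μ : Measure Ω) (m : Fin k → ℕ)
    (h : (∀ j, Fin (m j) → ℝ) → ℝ) (X : Fin k → ℕ → Ω → ℝ) :
    ∃ g : Fin k → ℝ → ℝ, (∀ j, Measurable (g j)) ∧ ∀ j, proj μ m h X j = g j ∘ X j 0 := by
  have : ∀ j, ∃ g : ℝ → ℝ, Measurable g ∧ proj μ m h X j = g ∘ X j 0 := fun j =>
    (stronglyMeasurable_condExp (f := kernelAt m h X) (μ := μ)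
      (m := MeasurableSpace.comap (X j 0) inferInstance)).measurable.exists_eq_measurable_comp
  choose g hg using this
  exact ⟨g, fun j => (hg j).1, fun j => (hg j).2⟩

namespace IsKernelSetting

lemma measurable_sampleAt (H : IsKernelSetting μ m n h X g) (q : Σ j, Fin (n j)) :
    Measurable (sampleAt X q) := H.sample.measurable q.1 q.2 q.2.2

lemma measurable_first (H : IsKernelSetting μ m n h X g) (j : Fin k) : Measurable (X j 0) :=
  H.sample.measurable j 0 ((H.one_le j).trans (H.le j))

lemma measurable_kernelFun (H : IsKernelSetting μ m n h X g) (i : ∀ j, Fin (m j) → Fin (n j)) :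
    Measurable (kernelFun h i) :=
  H.measurable_kernel.comp (measurable_pi_lambda _ fun _ => measurable_pi_lambda _ fun _ =>
    measurable_pi_apply _)

lemma identDistrib_sampleAt (H : IsKernelSetting μ m n h X g) (q : Σ j, Fin (n j)) :
    IdentDistrib (sampleAt X q) (X q.1 0) μ μ := H.sample.identDistrib q.1 q.2 q.2.2

lemma map_obs_eq_pi [IsProbabilityMeasure μ] (H : IsKernelSetting μ m n h X g)
    {i : ∀ j, Fin (m j) → Fin (n j)} (hi : ∀ j, Function.Injective (i j)) :
    μ.map (fun ω s => sampleAt X (obs i s) ω) = Measure.pi fun s => μ.map (X s.1 0) := by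
  have h1 := H.sample.indep.precomp (obs_injective hi)
  have h2 := (iIndepFun_iff_map_fun_eq_pi_map
    fun s => (H.measurable_sampleAt (obs i s)).aemeasurable).1 h1
  exact h2.trans (congrArg Measure.pi (funext fun s => (H.identDistrib_sampleAt (obs i s)).map_eq))

lemma identDistrib_obs [IsProbabilityMeasure μ] (H : IsKernelSetting μ m n h X g)
    {i : ∀ j, Fin (m j) → Fin (n j)} (hi : ∀ j, Function.Injective (i j)) :
    IdentDistrib (fun ω s => sampleAt X (obs i s) ω)
      (fun ω (s : Σ j, Fin (m j)) => X s.1 s.2 ω) μ μ := by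
  have h0 : ∀ j, Function.Injective (Fin.castLE (H.le j)) := fun j => Fin.castLE_injective _
  refine ⟨(measurable_pi_lambda _ fun s => H.measurable_sampleAt _).aemeasurable,
    (measurable_pi_lambda _ fun s : Σ j, Fin (m j) => H.sample.measurable s.1 s.2
      (s.2.2.trans_le (H.le s.1))).aemeasurable, ?_⟩
  exact (H.map_obs_eq_pi hi).trans (H.map_obs_eq_pi h0).symm

/-- The joint law of the kernel and one of its arguments. -/
lemma identDistrib_kernelFun [IsProbabilityMeasure μ] (H : IsKernelSetting μ m n h X g)
    {i : ∀ j, Fin (m j) → Fin (n j)} (hi : ∀ j, Function.Injective (i j)) (s : Σ j, Fin (m j)) :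
    IdentDistrib (fun ω => (kernelFun h i fun q => sampleAt X q ω, sampleAt X (obs i s) ω))
      (fun ω => (kernelAt m h X ω, X s.1 0 ω)) μ μ := by
  obtain ⟨j, l⟩ := s
  set l0 : Fin (m j) := ⟨0, H.one_le j⟩
  -- A swap in block `j` brings the tracked argument to the first place; by symmetry the kernel is
  -- unchanged.
  set π : ∀ j, Equiv.Perm (Fin (m j)) :=
    Function.update (fun j => Equiv.refl _) j (Equiv.swap l0 l) with hπ
  have hi' : ∀ j, Function.Injective fun l => i j (π j l) := fun j =>
    (hi j).comp (π j).injective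
  have hm : Measurable fun w : (Σ j, Fin (m j)) → ℝ => (h (fun j l => w ⟨j, l⟩), w ⟨j, l0⟩) :=
    (H.measurable_kernel.comp (measurable_pi_lambda _ fun j => measurable_pi_lambda _ fun l =>
      measurable_pi_apply _)).prodMk (measurable_pi_apply _)
  have h1 := (H.identDistrib_obs hi').comp hm
  have e : (fun ω => (kernelFun h i fun q => sampleAt X q ω, sampleAt X (obs i ⟨j, l⟩) ω)) =
      (fun w : (Σ j, Fin (m j)) → ℝ => (h (fun j l => w ⟨j, l⟩), w ⟨j, l0⟩)) ∘
        fun ω s => sampleAt X (obs (fun j l => i j (π j l)) s) ω := by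
    funext ω
    refine Prod.ext ?_ ?_
    · exact (H.symm π fun j l => sampleAt X (⟨j, i j l⟩ : Σ j, Fin (n j)) ω).symm
    · simp [obs, hπ]
  rw [e]
  exact h1

lemma integrable_kernelAt [IsProbabilityMeasure μ] (H : IsKernelSetting μ m n h X g) :
    Integrable (kernelAt m h X) μ := H.memLp.integrable (by norm_num)

/-- The sample `j` only witnesses that the kernel has an argument, as the joint law above needs one.
-/
lemma memLp_kernelFun [IsProbabilityMeasure μ] (H : IsKernelSetting μ m n h X g) (j : Fin k)
    {i : ∀ j, Fin (m j) → Fin (n j)} (hi : ∀ j, Function.Injective (i j)) :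
    MemLp (fun ω => kernelFun h i fun q => sampleAt X q ω) 2 μ :=
  ((H.identDistrib_kernelFun hi ⟨j, ⟨0, H.one_le j⟩⟩).comp measurable_fst).memLp_iff.2 H.memLp

lemma memLp_proj [IsProbabilityMeasure μ] (H : IsKernelSetting μ m n h X g)
    (q : Σ j, Fin (n j)) : MemLp (fun ω => g q.1 (sampleAt X q ω)) 2 μ := by
  refine ((H.identDistrib_sampleAt q).comp (H.measurable_proj q.1)).memLp_iff.2 ?_
  rw [← H.proj_eq]
  exact MemLp.condExp (by norm_num) H.memLp

lemma integral_comp_proj [IsProbabilityMeasure μ] (H : IsKernelSetting μ m n h X g)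
    (q : Σ j, Fin (n j)) {f : ℝ → ℝ} (hf : Measurable f) :
    ∫ ω, f (g q.1 (sampleAt X q ω)) ∂μ = ∫ ω, f (proj μ m h X q.1 ω) ∂μ := by
  rw [H.proj_eq]
  exact ((H.identDistrib_sampleAt q).comp (hf.comp (H.measurable_proj q.1))).integral_eq

lemma integral_proj [IsProbabilityMeasure μ] (H : IsKernelSetting μ m n h X g)
    (q : Σ j, Fin (n j)) : ∫ ω, g q.1 (sampleAt X q ω) ∂μ = 0 := by
  have h1 := H.integral_comp_proj q measurable_id
  simp only [id] at h1
  rw [h1, ← H.centred]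
  exact integral_condExp (H.measurable_first q.1).comap_le

/-- The defining property of the projection, at an arbitrary argument of the kernel. -/
lemma integral_indicator_mul_kernelFun [IsProbabilityMeasure μ] (H : IsKernelSetting μ m n h X g)
    {i : ∀ j, Fin (m j) → Fin (n j)} (hi : ∀ j, Function.Injective (i j)) {q : Σ j, Fin (n j)}
    (hq : q ∈ support i) {B : Set ℝ} (hB : MeasurableSet B) :
    ∫ ω, B.indicator (fun _ => (1 : ℝ)) (sampleAt X q ω) *
        kernelFun h i (fun q => sampleAt X q ω) ∂μ =
      ∫ ω, B.indicator (fun _ => (1 : ℝ)) (sampleAt X q ω) * g q.1 (sampleAt X q ω) ∂μ := by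
  obtain ⟨s, -, rfl⟩ := Finset.mem_image.1 hq
  have hBm : Measurable (B.indicator fun _ => (1 : ℝ)) := measurable_const.indicator hB
  have e1 := ((H.identDistrib_kernelFun hi s).comp
    (u := fun x : ℝ × ℝ => B.indicator (fun _ => (1 : ℝ)) x.2 * x.1)
    ((hBm.comp measurable_snd).mul measurable_fst)).integral_eq
  have e2 := ((H.identDistrib_sampleAt (obs i s)).comp
    (u := fun x : ℝ => B.indicator (fun _ => (1 : ℝ)) x * g s.1 x)
    (hBm.mul (H.measurable_proj s.1))).integral_eq
  have hset : MeasurableSet (X s.1 0 ⁻¹' B) := H.measurable_first s.1 hB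
  have key : ∀ f : Ω → ℝ, ∫ ω, B.indicator (fun _ => (1 : ℝ)) (X s.1 0 ω) * f ω ∂μ =
      ∫ ω in X s.1 0 ⁻¹' B, f ω ∂μ := fun f => by
    rw [← integral_indicator hset]
    refine integral_congr_ae (Eventually.of_forall fun ω => ?_)
    by_cases hω : X s.1 0 ω ∈ B <;> simp [hω]
  refine e1.trans (Eq.trans ?_ e2.symm)
  refine (key _).trans (Eq.trans ?_ (key _).symm)
  rw [← setIntegral_condExp (H.measurable_first s.1).comap_le H.integrable_kernelAt
    (⟨B, hB, rfl⟩ : MeasurableSet[MeasurableSpace.comap (X s.1 0) inferInstance] _)]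
  exact congrArg (fun f : Ω → ℝ => ∫ ω in X s.1 0 ⁻¹' B, f ω ∂μ) (H.proj_eq s.1)

lemma measurable_residual (H : IsKernelSetting μ m n h X g) (i : ∀ j, Fin (m j) → Fin (n j)) :
    Measurable (residual h g i) :=
  (H.measurable_kernelFun i).sub (Finset.measurable_fun_sum _ fun c _ =>
    (H.measurable_proj c.1).comp (measurable_pi_apply c))

lemma dependsOn_residual (h : (∀ j, Fin (m j) → ℝ) → ℝ) (g : Fin k → ℝ → ℝ)
    (i : ∀ j, Fin (m j) → Fin (n j)) : DependsOn (residual h g i) (support i) := by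
  intro v w hvw
  unfold residual kernelFun
  congr 1
  · congr 1
    funext j l
    exact hvw _ (Finset.mem_coe.2 (mem_support.2 (Finset.mem_image_of_mem _ (Finset.mem_univ l))))
  · exact Finset.sum_congr rfl fun c hc => by rw [hvw c hc]

lemma memLp_residual [IsProbabilityMeasure μ] (H : IsKernelSetting μ m n h X g) (j : Fin k)
    {i : ∀ j, Fin (m j) → Fin (n j)} (hi : ∀ j, Function.Injective (i j)) :
    MemLp (fun ω => residual h g i fun q => sampleAt X q ω) 2 μ :=
  (H.memLp_kernelFun j hi).sub (memLp_finsetSum _ fun c _ => H.memLp_proj c)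

/-- Degeneracy of the residual: given an observation of the tuple, the kernel has conditional mean
`g`, which is subtracted, and the projections on the other observations are centred and independent
of it. -/
lemma integral_indicator_mul_residual [IsProbabilityMeasure μ] (H : IsKernelSetting μ m n h X g)
    {i : ∀ j, Fin (m j) → Fin (n j)} (hi : ∀ j, Function.Injective (i j)) {q : Σ j, Fin (n j)}
    (hq : q ∈ support i) {B : Set ℝ} (hB : MeasurableSet B) :
    ∫ ω, B.indicator (fun _ => (1 : ℝ)) (sampleAt X q ω) *
      residual h g i (fun q => sampleAt X q ω) ∂μ = 0 := by
  have hBm : Measurable (B.indicator fun _ => (1 : ℝ)) := measurable_const.indicator hB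
  have hind : MemLp (fun ω => B.indicator (fun _ => (1 : ℝ)) (sampleAt X q ω)) 2 μ :=
    MemLp.of_bound (hBm.comp (H.measurable_sampleAt q)).aestronglyMeasurable 1
      (Eventually.of_forall fun ω => (norm_indicator_le_norm_self _ _).trans (by simp))
  have i1 : Integrable (fun ω => B.indicator (fun _ => (1 : ℝ)) (sampleAt X q ω) *
      kernelFun h i (fun q => sampleAt X q ω)) μ :=
    MemLp.integrable_fun_mul hind (H.memLp_kernelFun q.1 hi)
  have i2 : ∀ c : Σ j, Fin (n j), Integrable (fun ω =>
      B.indicator (fun _ => (1 : ℝ)) (sampleAt X q ω) * g c.1 (sampleAt X c ω)) μ := fun c =>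
    MemLp.integrable_fun_mul hind (H.memLp_proj c)
  have e : ∀ ω, B.indicator (fun _ => (1 : ℝ)) (sampleAt X q ω) *
      residual h g i (fun q => sampleAt X q ω) =
      B.indicator (fun _ => (1 : ℝ)) (sampleAt X q ω) * kernelFun h i (fun q => sampleAt X q ω) -
      ∑ c ∈ support i, B.indicator (fun _ => (1 : ℝ)) (sampleAt X q ω) *
        g c.1 (sampleAt X c ω) := fun ω => by
    rw [residual, mul_sub, Finset.mul_sum]
  simp only [e]
  rw [integral_sub i1 (integrable_finsetSum _ fun c _ => i2 c),
    integral_finsetSum _ fun c _ => i2 c, H.integral_indicator_mul_kernelFun hi hq hB,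
    Finset.sum_eq_single_of_mem q hq, sub_self]
  intro c _ hc
  have h1 := ((H.sample.indep.indepFun hc.symm).comp hBm (H.measurable_proj c.1))
  have h2 := h1.integral_fun_mul_eq_mul_integral
    (hBm.comp (H.measurable_sampleAt q)).aestronglyMeasurable
    (H.memLp_proj c).aestronglyMeasurable
  refine h2.trans ?_
  have h3 : ∫ ω, (g c.1 ∘ fun ω => X c.1 c.2 ω) ω ∂μ = 0 := H.integral_proj c
  rw [mul_eq_zero]
  exact Or.inr h3

lemma integral_residual_mul_eq_zero [IsProbabilityMeasure μ] (H : IsKernelSetting μ m n h X g)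
    {i : ∀ j, Fin (m j) → Fin (n j)} (hi : ∀ j, Function.Injective (i j)) {q : Σ j, Fin (n j)}
    (hq : q ∈ support i) {f : ((Σ j, Fin (n j)) → ℝ) → ℝ} (hf : Measurable f)
    {R : Finset (Σ j, Fin (n j))} (hfR : DependsOn f R) (hR : support i ∩ R ⊆ {q})
    (hf2 : MemLp (fun ω => f fun q => sampleAt X q ω) 2 μ) :
    ∫ ω, residual h g i (fun q => sampleAt X q ω) * f (fun q => sampleAt X q ω) ∂μ = 0 :=
  integral_mul_eq_zero_of_dependsOn (Y := sampleAt X) H.measurable_sampleAt H.sample.indep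
    (H.measurable_residual i) hf (dependsOn_residual h g i) hfR hR (H.memLp_residual q.1 hi) hf2
    fun _ hB => H.integral_indicator_mul_residual hi hq hB

/-- Pythagoras: the residual is orthogonal to each projection subtracted from the kernel. -/
lemma integral_residual_sq_le [IsProbabilityMeasure μ] (H : IsKernelSetting μ m n h X g)
    (j : Fin k) {i : ∀ j, Fin (m j) → Fin (n j)} (hi : ∀ j, Function.Injective (i j)) :
    ∫ ω, residual h g i (fun q => sampleAt X q ω) ^ 2 ∂μ ≤ sigma μ m h X ^ 2 := by
  have hr := H.memLp_residual j hi
  set r : Ω → ℝ := fun ω => residual h g i fun q => sampleAt X q ω with hrdef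
  set s : Ω → ℝ := fun ω => ∑ c ∈ support i, g c.1 (sampleAt X c ω) with hs
  have hs2 : MemLp s 2 μ := memLp_finsetSum _ fun c _ => H.memLp_proj c
  have h0 : ∫ ω, r ω * s ω ∂μ = 0 := by
    simp only [hs, Finset.mul_sum]
    rw [integral_finsetSum _ fun c _ => MemLp.integrable_fun_mul hr (H.memLp_proj c)]
    refine Finset.sum_eq_zero fun c hc => ?_
    exact H.integral_residual_mul_eq_zero hi hc (f := fun v => g c.1 (v c))
      ((H.measurable_proj c.1).comp (measurable_pi_apply c)) (R := {c})
      (fun v w hvw => congrArg (g c.1) (hvw c (by simp))) Finset.inter_subset_right (H.memLp_proj c)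
  have h1 : sigma μ m h X ^ 2 = ∫ ω, (r ω + s ω) ^ 2 ∂μ := by
    rw [sigma, Real.sq_sqrt (integral_nonneg fun ω => sq_nonneg _)]
    have := ((H.identDistrib_kernelFun hi ⟨j, ⟨0, H.one_le j⟩⟩).comp
      (u := fun x : ℝ × ℝ => x.1 ^ 2) (by fun_prop)).integral_eq
    refine this.symm.trans (integral_congr_ae (Eventually.of_forall fun ω => ?_))
    simp only [Function.comp, hrdef, hs, residual, sub_add_cancel]
  have h2 : ∫ ω, (r ω + s ω) ^ 2 ∂μ = ∫ ω, r ω ^ 2 ∂μ + ∫ ω, s ω ^ 2 ∂μ := by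
    have i1 := hr.integrable_sq
    have i2 := hs2.integrable_sq
    have i3 := (MemLp.integrable_fun_mul hr hs2).const_mul 2
    calc _ = ∫ ω, ((r ω ^ 2 + s ω ^ 2) + 2 * (r ω * s ω)) ∂μ :=
          integral_congr_ae (Eventually.of_forall fun ω => by simp only; ring)
      _ = ∫ ω, (r ω ^ 2 + s ω ^ 2) ∂μ + ∫ ω, 2 * (r ω * s ω) ∂μ := integral_add (i1.add i2) i3
      _ = _ := by rw [integral_add i1 i2, integral_const_mul, h0, mul_zero, add_zero]
  have h3 : 0 ≤ ∫ ω, s ω ^ 2 ∂μ := integral_nonneg fun ω => sq_nonneg _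
  rw [h1, h2]
  linarith

open Classical in
/-- The second moment of a sum of residuals, in terms of the number of pairs of index tuples
sharing at least two observations. -/
lemma integral_sum_residual_sq_le [IsProbabilityMeasure μ] (H : IsKernelSetting μ m n h X g)
    (j : Fin k) {C : Finset (∀ j, Fin (m j) → Fin (n j))} (hC : C ⊆ tuples m n) :
    ∫ ω, (∑ i ∈ C, residual h g i fun q => sampleAt X q ω) ^ 2 ∂μ ≤
      sigma μ m h X ^ 2 *
        ((C ×ˢ C).filter fun x => 2 ≤ (support x.1 ∩ support x.2).card).card := by
  have hinj : ∀ i ∈ C, ∀ j, Function.Injective (i j) := fun i hi j =>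
    (mem_tuples.1 (hC hi) j).injective
  set r : (∀ j, Fin (m j) → Fin (n j)) → Ω → ℝ :=
    fun i ω => residual h g i fun q => sampleAt X q ω with hr
  have hr2 : ∀ i ∈ C, MemLp (r i) 2 μ := fun i hi => H.memLp_residual j (hinj i hi)
  have e : ∀ ω, (∑ i ∈ C, r i ω) ^ 2 = ∑ x ∈ C ×ˢ C, r x.1 ω * r x.2 ω := fun ω => by
    rw [pow_two, Finset.sum_mul_sum, Finset.sum_product]
  have hint : ∀ x ∈ C ×ˢ C, Integrable (fun ω => r x.1 ω * r x.2 ω) μ := fun x hx =>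
    MemLp.integrable_fun_mul (hr2 _ (Finset.mem_product.1 hx).1) (hr2 _ (Finset.mem_product.1 hx).2)
  have hb : ∀ x ∈ C ×ˢ C, ∫ ω, r x.1 ω * r x.2 ω ∂μ ≤
      if 2 ≤ (support x.1 ∩ support x.2).card then sigma μ m h X ^ 2 else 0 := fun x hx => by
    obtain ⟨h1, h2⟩ := Finset.mem_product.1 hx
    split_ifs with hc
    · refine (integral_mul_le_sqrt_mul_sqrt (hr2 _ h1) (hr2 _ h2)).trans ?_
      have s1 : ∀ i ∈ C, √(∫ ω, r i ω ^ 2 ∂μ) ≤ sigma μ m h X := fun i hi =>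
        Real.sqrt_le_iff.2 ⟨Real.sqrt_nonneg _, H.integral_residual_sq_le j (hinj i hi)⟩
      rw [pow_two]
      exact mul_le_mul (s1 _ h1) (s1 _ h2) (Real.sqrt_nonneg _) (Real.sqrt_nonneg _)
    · have hc1 : (support x.1 ∩ support x.2).card ≤ 1 := by omega
      -- If the supports are disjoint, any observation of the first tuple can play the part of `q`.
      obtain ⟨q, hq, hqs⟩ : ∃ q ∈ support x.1, support x.1 ∩ support x.2 ⊆ {q} := by
        rcases (support x.1 ∩ support x.2).eq_empty_or_nonempty with h3 | ⟨q, hq⟩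
        · exact ⟨obs x.1 ⟨j, ⟨0, H.one_le j⟩⟩,
            Finset.mem_image_of_mem _ (Finset.mem_univ _), by rw [h3]; exact Finset.empty_subset _⟩
        · exact ⟨q, (Finset.mem_inter.1 hq).1, fun q' hq' =>
            Finset.mem_singleton.2 (Finset.card_le_one.1 hc1 q' hq' q hq)⟩
      exact (H.integral_residual_mul_eq_zero (hinj _ h1) hq (H.measurable_residual x.2)
        (dependsOn_residual h g x.2) hqs (hr2 _ h2)).le
  rw [integral_congr_ae (Eventually.of_forall e), integral_finsetSum _ hint]
  refine (Finset.sum_le_sum hb).trans (le_of_eq ?_)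
  rw [← Finset.sum_filter, Finset.sum_const, nsmul_eq_mul, mul_comm]

end IsKernelSetting

end Multisample

/-! ### Independence of one variable from functions of all the others. -/

namespace NormalApprox

variable {Ω : Type*} [MeasurableSpace Ω] {μ : Measure Ω} {ι : Type*}

lemma indepFun_prodMk_of_dependsOn [Fintype ι] [DecidableEq ι] {Y : ι → Ω → ℝ}
    (hY : ∀ i, Measurable (Y i)) (hind : iIndepFun Y μ) {f : (ι → ℝ) → ℝ} (hf : Measurable f)
    {q : ι} (hfq : DependsOn f {q}ᶜ) :
    IndepFun (Y q) (fun ω => (f fun i => Y i ω, fun j : {j // j ≠ q} => Y j ω)) μ := by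
  have h1 := hind.indepFun_finset {q} ({q}ᶜ : Finset ι) (by simp) hY
  set ext : (({q}ᶜ : Finset ι) → ℝ) → ι → ℝ :=
    fun y i => if h : i ∈ ({q}ᶜ : Finset ι) then y ⟨i, h⟩ else 0 with hext
  have hextm : Measurable ext := by
    refine measurable_pi_lambda _ fun i => ?_
    by_cases h : i ∈ ({q}ᶜ : Finset ι)
    · simpa only [hext, h, dite_true] using
        measurable_pi_apply (⟨i, h⟩ : {x // x ∈ ({q}ᶜ : Finset ι)})
    · simpa only [hext, h, dite_false] using measurable_const
  have hφ : Measurable fun x : (({q} : Finset ι) → ℝ) => x ⟨q, by simp⟩ := measurable_pi_apply _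
  have hψ : Measurable fun y : (({q}ᶜ : Finset ι) → ℝ) =>
      (f (ext y), fun j : {j // j ≠ q} => y ⟨j, by simpa using j.2⟩) :=
    (hf.comp hextm).prodMk (measurable_pi_lambda _ fun j => measurable_pi_apply _)
  have h2 := h1.comp hφ hψ
  refine h2.congr (ae_eq_refl _) (Eventually.of_forall fun ω => ?_)
  refine Prod.ext ?_ rfl
  refine hfq fun i hi => ?_
  have hi' : i ∈ ({q}ᶜ : Finset ι) := by simpa using hi
  simp only [hext]
  rw [dif_pos hi']

end NormalApprox

/-! ### The U-statistic as a perturbed sum of normalized projections. -/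

namespace Multisample

open NormalApprox

variable {Ω : Type*} [MeasurableSpace Ω] {μ : Measure Ω} {k : ℕ} {m n : Fin k → ℕ}
  {h : (∀ j, Fin (m j) → ℝ) → ℝ} {X : Fin k → ℕ → Ω → ℝ} {g : Fin k → ℝ → ℝ}

/-- The normalized projection on one observation. -/
def summand (μ : Measure Ω) (m n : Fin k → ℕ) (h : (∀ j, Fin (m j) → ℝ) → ℝ)
    (X : Fin k → ℕ → Ω → ℝ) (g : Fin k → ℝ → ℝ) (q : Σ j, Fin (n j)) : Ω → ℝ :=
  fun ω => (sigmaN μ m n h X)⁻¹ * (weight m n q * g q.1 (sampleAt X q ω))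

/-- The normalized sum of the residuals over a set of index tuples. -/
def remainder (μ : Measure Ω) (m n : Fin k → ℕ) (h : (∀ j, Fin (m j) → ℝ) → ℝ)
    (X : Fin k → ℕ → Ω → ℝ) (g : Fin k → ℝ → ℝ) (C : Finset (∀ j, Fin (m j) → Fin (n j))) :
    Ω → ℝ :=
  fun ω => (sigmaN μ m n h X)⁻¹ * (((tuples m n).card : ℝ)⁻¹ *
    ∑ i ∈ C, residual h g i fun q => sampleAt X q ω)

open Classical in
/-- The index tuples which do not use the observation `q`. -/
def avoiding (m n : Fin k → ℕ) (q : Σ j, Fin (n j)) : Finset (∀ j, Fin (m j) → Fin (n j)) :=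
  (tuples m n).filter fun i => q ∉ support i

namespace IsKernelSetting

lemma card_tuples_pos (H : IsKernelSetting μ m n h X g) : 0 < ((tuples m n).card : ℝ) := by
  rw [card_tuples]
  exact_mod_cast Finset.prod_pos fun j _ => Nat.choose_pos (H.le j)

lemma natCast_pos (H : IsKernelSetting μ m n h X g) (j : Fin k) :
    (0 : ℝ) < m j ∧ (0 : ℝ) < n j := by
  have h1 := H.one_le j
  have h2 := H.le j
  exact ⟨by exact_mod_cast h1, by exact_mod_cast (by omega : 0 < n j)⟩

lemma sigmaN_sq (μ : Measure Ω) (m n : Fin k → ℕ) (h : (∀ j, Fin (m j) → ℝ) → ℝ)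
    (X : Fin k → ℕ → Ω → ℝ) : sigmaN μ m n h X ^ 2 =
      ∑ j, (m j : ℝ) ^ 2 / (n j : ℝ) * sigmaProj μ m h X j ^ 2 :=
  Real.sq_sqrt (Finset.sum_nonneg fun _ _ => by positivity)

lemma sigmaN_pos (H : IsKernelSetting μ m n h X g) (hpos : ∃ j, 0 < sigmaProj μ m h X j) :
    0 < sigmaN μ m n h X := by
  obtain ⟨j, hj⟩ := hpos
  refine Real.sqrt_pos.2 (Finset.sum_pos' (fun _ _ => by positivity) ⟨j, Finset.mem_univ j, ?_⟩)
  obtain ⟨h1, h2⟩ := H.natCast_pos j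
  positivity

/-- After exchanging the sums over tuples and observations, the projection on `q` appears once for
each tuple using `q`, and these form exactly the proportion `weight m n q` of all tuples. -/
lemma sum_summand_add_remainder (H : IsKernelSetting μ m n h X g) (ω : Ω) :
    ∑ q, summand μ m n h X g q ω + remainder μ m n h X g (tuples m n) ω =
      (sigmaN μ m n h X)⁻¹ * uStat m n h X ω := by
  classical
  have hN := H.card_tuples_pos
  have e1 : ∑ i ∈ tuples m n, ∑ c ∈ support i, g c.1 (sampleAt X c ω) =
      ∑ q, (tuples m n).card * (weight m n q * g q.1 (sampleAt X q ω)) := by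
    have : ∀ i : ∀ j, Fin (m j) → Fin (n j), ∑ c ∈ support i, g c.1 (sampleAt X c ω) =
        ∑ c, if c ∈ support i then g c.1 (sampleAt X c ω) else 0 := fun i => by
      rw [Finset.sum_ite_mem, Finset.univ_inter]
    simp_rw [this]
    rw [Finset.sum_comm]
    refine Finset.sum_congr rfl fun q _ => ?_
    rw [← Finset.sum_filter, Finset.sum_const, nsmul_eq_mul,
      card_tuples_filter_mem H.one_le H.le, mul_assoc]
  have e2 : uStat m n h X ω = ((tuples m n).card : ℝ)⁻¹ *
      ∑ i ∈ tuples m n, kernelFun h i fun q => sampleAt X q ω := by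
    rw [uStat, card_tuples]
    push_cast
    rw [Finset.prod_inv_distrib]
    rfl
  have e3 : ∑ i ∈ tuples m n, kernelFun h i (fun q => sampleAt X q ω) =
      ∑ i ∈ tuples m n, residual h g i (fun q => sampleAt X q ω) +
        (tuples m n).card * ∑ q, weight m n q * g q.1 (sampleAt X q ω) := by
    rw [Finset.mul_sum, ← e1, ← Finset.sum_add_distrib]
    exact Finset.sum_congr rfl fun i _ => by rw [residual, sub_add_cancel]
  rw [e2, e3, mul_add, ← mul_assoc _ (_ : ℝ) (∑ q, _), inv_mul_cancel₀ hN.ne', one_mul]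
  simp only [summand, remainder]
  rw [← Finset.mul_sum]
  ring

lemma measurable_summand (H : IsKernelSetting μ m n h X g) (q : Σ j, Fin (n j)) :
    Measurable (summand μ m n h X g q) :=
  (((H.measurable_proj q.1).comp (H.measurable_sampleAt q)).const_mul _).const_mul _

lemma measurable_remainder (H : IsKernelSetting μ m n h X g)
    (C : Finset (∀ j, Fin (m j) → Fin (n j))) : Measurable (remainder μ m n h X g C) :=
  ((Finset.measurable_fun_sum _ fun i _ => (H.measurable_residual i).comp
    (measurable_pi_lambda _ fun q => H.measurable_sampleAt q)).const_mul _).const_mul _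

lemma memLp_remainder [IsProbabilityMeasure μ] (H : IsKernelSetting μ m n h X g) (j : Fin k)
    {C : Finset (∀ j, Fin (m j) → Fin (n j))} (hC : C ⊆ tuples m n) :
    MemLp (remainder μ m n h X g C) 2 μ :=
  ((memLp_finsetSum _ fun _ hi => H.memLp_residual j
    fun j => (mem_tuples.1 (hC hi) j).injective).const_mul _).const_mul _

open Classical in
lemma integral_remainder_sq_le [IsProbabilityMeasure μ] (H : IsKernelSetting μ m n h X g)
    (j : Fin k) {C : Finset (∀ j, Fin (m j) → Fin (n j))} (hC : C ⊆ tuples m n) {K : ℝ}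
    (hK : (((C ×ˢ C).filter fun x => 2 ≤ (support x.1 ∩ support x.2).card).card : ℝ) ≤
      ((tuples m n).card : ℝ) ^ 2 * K) :
    ∫ ω, remainder μ m n h X g C ω ^ 2 ∂μ ≤ (sigma μ m h X / sigmaN μ m n h X) ^ 2 * K := by
  have hN := H.card_tuples_pos
  set N : ℝ := ((tuples m n).card : ℝ)
  have h1 := H.integral_sum_residual_sq_le j hC
  simp only [remainder, mul_pow, integral_const_mul]
  calc _ ≤ (sigmaN μ m n h X)⁻¹ ^ 2 * (N⁻¹ ^ 2 * (sigma μ m h X ^ 2 * (N ^ 2 * K))) := by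
        gcongr
        exact h1.trans (by gcongr)
    _ = (sigma μ m h X / sigmaN μ m n h X) ^ 2 * K * (N⁻¹ * N) ^ 2 := by ring
    _ = _ := by rw [inv_mul_cancel₀ hN.ne', one_pow, mul_one]

open Classical in
lemma remainder_sub (q : Σ j, Fin (n j)) (ω : Ω) :
    remainder μ m n h X g (tuples m n) ω - remainder μ m n h X g (avoiding m n q) ω =
      remainder μ m n h X g ((tuples m n).filter fun i => q ∈ support i) ω := by
  simp only [remainder, avoiding]
  rw [← Finset.sum_filter_add_sum_filter_not (tuples m n) fun i => q ∈ support i]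
  ring

/-- The difference at `q` involves only tuples using `q`; its pairs sharing a second observation are
a proportion at most `weight² M`, and the squared weights sum to `M`. -/
lemma sum_integral_remainder_sub_sq_le [IsProbabilityMeasure μ]
    (H : IsKernelSetting μ m n h X g) (j : Fin k) :
    ∑ q, ∫ ω, (remainder μ m n h X g (tuples m n) ω -
      remainder μ m n h X g (avoiding m n q) ω) ^ 2 ∂μ ≤
      (sigma μ m h X / sigmaN μ m n h X * ∑ j, (m j : ℝ) ^ 2 / n j) ^ 2 := by
  classical
  simp only [remainder_sub]
  set M := ∑ j, (m j : ℝ) ^ 2 / n j with hM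
  calc _ ≤ ∑ q : Σ j, Fin (n j),
        (sigma μ m h X / sigmaN μ m n h X) ^ 2 * (weight m n q ^ 2 * M) := by
        refine Finset.sum_le_sum fun q _ =>
          H.integral_remainder_sq_le j (Finset.filter_subset _ _) ?_
        rw [← mul_assoc]
        exact card_pairs_le H.one_le H.le q
    _ = _ := by
        rw [← Finset.mul_sum, ← Finset.sum_mul,
          sum_weight_sq m fun j => (H.one_le j).trans (H.le j), ← hM]
        ring

/-- Every pair sharing two observations is found among the pairs attached to one shared `q`, so the
previous count, summed over `q`, applies again. -/
lemma integral_remainder_sq_le_sq [IsProbabilityMeasure μ]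
    (H : IsKernelSetting μ m n h X g) (j : Fin k) :
    ∫ ω, remainder μ m n h X g (tuples m n) ω ^ 2 ∂μ ≤
      (sigma μ m h X / sigmaN μ m n h X * ∑ j, (m j : ℝ) ^ 2 / n j) ^ 2 := by
  classical
  set M := ∑ j, (m j : ℝ) ^ 2 / n j with hM
  rw [mul_pow]
  refine H.integral_remainder_sq_le j (Finset.Subset.refl _) ?_
  have hsub : ((tuples m n ×ˢ tuples m n).filter
        fun x => 2 ≤ (support x.1 ∩ support x.2).card) ⊆
      Finset.univ.biUnion fun q => (((tuples m n).filter fun i => q ∈ support i) ×ˢ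
        ((tuples m n).filter fun i => q ∈ support i)).filter
          fun x => 2 ≤ (support x.1 ∩ support x.2).card := by
    rintro ⟨i, i'⟩ hx
    simp only [Finset.mem_filter, Finset.mem_product] at hx
    obtain ⟨q, hq⟩ := Finset.card_pos.1 (by omega : 0 < (support i ∩ support i').card)
    rw [Finset.mem_inter] at hq
    simp only [Finset.mem_biUnion, Finset.mem_univ, true_and, Finset.mem_filter,
      Finset.mem_product]
    exact ⟨q, ⟨⟨hx.1.1, hq.1⟩, hx.1.2, hq.2⟩, hx.2⟩
  have hcard := (Finset.card_le_card hsub).trans Finset.card_biUnion_le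
  calc (_ : ℝ) ≤ ∑ q : Σ j, Fin (n j),
        ((((tuples m n).filter fun i => q ∈ support i) ×ˢ
        ((tuples m n).filter fun i => q ∈ support i)).filter
          fun x => 2 ≤ (support x.1 ∩ support x.2).card).card := by exact_mod_cast hcard
    _ ≤ ∑ q : Σ j, Fin (n j), ((tuples m n).card : ℝ) ^ 2 * weight m n q ^ 2 * M := by
        rw [Nat.cast_sum]
        exact Finset.sum_le_sum fun q _ => card_pairs_le H.one_le H.le q
    _ = _ := by
        rw [← Finset.sum_mul, ← Finset.mul_sum,
          sum_weight_sq m fun j => (H.one_le j).trans (H.le j), ← hM]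
        ring

lemma dependsOn_sum_residual (h : (∀ j, Fin (m j) → ℝ) → ℝ) (g : Fin k → ℝ → ℝ)
    (q : Σ j, Fin (n j)) :
    DependsOn (fun v => ∑ i ∈ avoiding m n q, residual h g i v) {q}ᶜ := by
  intro v w hvw
  refine Finset.sum_congr rfl fun i hi => dependsOn_residual h g i fun c hc => hvw c ?_
  rintro rfl
  exact (Finset.mem_filter.1 hi).2 (Finset.mem_coe.1 hc)

lemma indepFun_summand [IsProbabilityMeasure μ] (H : IsKernelSetting μ m n h X g)
    (q : Σ j, Fin (n j)) :
    IndepFun (summand μ m n h X g q) (fun ω => (remainder μ m n h X g (avoiding m n q) ω,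
      fun c : {c // c ≠ q} => summand μ m n h X g c ω)) μ := by
  have h1 := indepFun_prodMk_of_dependsOn (Y := sampleAt X) H.measurable_sampleAt
    H.sample.indep (f := fun v => ∑ i ∈ avoiding m n q, residual h g i v)
    (Finset.measurable_fun_sum _ fun i _ => H.measurable_residual i)
    (dependsOn_sum_residual h g q)
  exact h1.comp (φ := fun x => (sigmaN μ m n h X)⁻¹ * (weight m n q * g q.1 x))
    (ψ := fun x : ℝ × ({c // c ≠ q} → ℝ) => ((sigmaN μ m n h X)⁻¹ *
      (((tuples m n).card : ℝ)⁻¹ * x.1), fun c =>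
        (sigmaN μ m n h X)⁻¹ * (weight m n c.1 * g c.1.1 (x.2 c))))
    (((H.measurable_proj q.1).const_mul _).const_mul _)
    (((measurable_fst.const_mul _).const_mul _).prodMk (measurable_pi_lambda _ fun c =>
      (((H.measurable_proj c.1.1).comp
        ((measurable_pi_apply c).comp measurable_snd)).const_mul _).const_mul _))

lemma sum_integral_summand_sq [IsProbabilityMeasure μ] (H : IsKernelSetting μ m n h X g)
    (hpos : ∃ j, 0 < sigmaProj μ m h X j) :
    ∑ q, ∫ ω, summand μ m n h X g q ω ^ 2 ∂μ = 1 := by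
  have hs := H.sigmaN_pos hpos
  have e : ∀ q : Σ j, Fin (n j), ∫ ω, summand μ m n h X g q ω ^ 2 ∂μ =
      (sigmaN μ m n h X)⁻¹ ^ 2 * (weight m n q ^ 2 * sigmaProj μ m h X q.1 ^ 2) := fun q => by
    simp only [summand, mul_pow, integral_const_mul]
    rw [H.integral_comp_proj q (f := fun x => x ^ 2) (by fun_prop), sigmaProj,
      Real.sq_sqrt (integral_nonneg fun ω => sq_nonneg _)]
  simp only [e]
  rw [← Finset.mul_sum, Fintype.sum_sigma]
  have e2 : ∑ j, ∑ c : Fin (n j), weight m n ⟨j, c⟩ ^ 2 * sigmaProj μ m h X j ^ 2 =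
      sigmaN μ m n h X ^ 2 := by
    rw [sigmaN_sq]
    refine Finset.sum_congr rfl fun j _ => ?_
    have := (H.natCast_pos j).2.ne'
    simp only [weight, Finset.sum_const, Finset.card_univ, Fintype.card_fin, nsmul_eq_mul]
    field_simp
  rw [e2, ← mul_pow, inv_mul_cancel₀ hs.ne', one_pow]

lemma abs_summand_rpow (H : IsKernelSetting μ m n h X g)
    (hpos : ∃ j, 0 < sigmaProj μ m h X j) (p : ℝ) (q : Σ j, Fin (n j)) (ω : Ω) :
    |summand μ m n h X g q ω| ^ p =
      ((sigmaN μ m n h X)⁻¹ * weight m n q) ^ p * |g q.1 (sampleAt X q ω)| ^ p := by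
  have hs := H.sigmaN_pos hpos
  have hw := weight_nonneg m n q
  rw [summand, ← mul_assoc, abs_mul, abs_of_nonneg (by positivity),
    Real.mul_rpow (by positivity) (abs_nonneg _)]

/-- Sample `j` contributes `n_j` equal moments with weight `(m_j/n_j)^p`, hence `m_j^p / n_j^(p-1)`.
-/
lemma absMoment_summand [IsProbabilityMeasure μ] (H : IsKernelSetting μ m n h X g)
    (hpos : ∃ j, 0 < sigmaProj μ m h X j) (p : ℝ) :
    sigmaN μ m n h X ^ p * absMoment μ (summand μ m n h X g) p =
      ∑ j, (m j : ℝ) ^ p / (n j : ℝ) ^ (p - 1) * ∫ ω, |proj μ m h X j ω| ^ p ∂μ := by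
  have hs := H.sigmaN_pos hpos
  have e : ∀ q : Σ j, Fin (n j), sigmaN μ m n h X ^ p * ∫ ω, |summand μ m n h X g q ω| ^ p ∂μ =
      weight m n q ^ p * ∫ ω, |proj μ m h X q.1 ω| ^ p ∂μ := fun q => by
    simp only [H.abs_summand_rpow hpos, integral_const_mul]
    rw [H.integral_comp_proj q (f := fun x => |x| ^ p) (by fun_prop),
      Real.mul_rpow (by positivity) (weight_nonneg m n q), ← mul_assoc, ← mul_assoc,
      Real.inv_rpow hs.le, mul_inv_cancel₀ (Real.rpow_pos_of_pos hs p).ne', one_mul]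
  rw [absMoment, Finset.mul_sum]
  simp only [e]
  rw [Fintype.sum_sigma]
  refine Finset.sum_congr rfl fun j _ => ?_
  obtain ⟨h1, h2⟩ := H.natCast_pos j
  simp only [weight, Finset.sum_const, Finset.card_univ, Fintype.card_fin, nsmul_eq_mul]
  rw [← mul_assoc, Real.div_rpow h1.le h2.le, Real.rpow_sub_one h2.ne']
  congr 1
  field_simp

lemma isPerturbedSum [IsProbabilityMeasure μ] (H : IsKernelSetting μ m n h X g)
    (hpos : ∃ j, 0 < sigmaProj μ m h X j) {p : ℝ} (hp : 2 < p) (hp3 : p ≤ 3)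
    (hint : ∀ j, Integrable (fun ω => |proj μ m h X j ω| ^ p) μ) :
    IsPerturbedSum (summand μ m n h X g) p (remainder μ m n h X g (tuples m n))
      (fun q => remainder μ m n h X g (avoiding m n q))
      (sigma μ m h X / sigmaN μ m n h X * ∑ j, (m j : ℝ) ^ 2 / n j) μ := by
  have hs := H.sigmaN_pos hpos
  obtain ⟨j, -⟩ := id hpos
  have hsum := H.sum_integral_summand_sq hpos
  refine
    { measurable := H.measurable_summand
      memLp := fun q => ((H.memLp_proj q).const_mul _).const_mul _
      indep := H.sample.indep.comp
        (fun q x => (sigmaN μ m n h X)⁻¹ * (weight m n q * g q.1 x))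
        fun q => ((H.measurable_proj q.1).const_mul _).const_mul _
      two_lt := hp
      le_three := hp3
      centred := fun q => ?_
      sum_sq := hsum.le
      integrable := fun q => ?_
      unit := hsum
      measurable_pert := H.measurable_remainder _
      memLp_pert := H.memLp_remainder j (Finset.Subset.refl _)
      measurable_approx := fun q => H.measurable_remainder _
      memLp_approx := fun q => H.memLp_remainder j (Finset.filter_subset _ _)
      indep_approx := H.indepFun_summand
      nonneg := ?_
      integral_sq_le := H.integral_remainder_sq_le_sq j
      sum_integral_sq_le := H.sum_integral_remainder_sub_sq_le j }
  · simp only [summand, integral_const_mul, H.integral_proj q, mul_zero]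
  · simp only [H.abs_summand_rpow hpos]
    refine Integrable.const_mul ?_ _
    have h1 := (H.identDistrib_sampleAt q).comp
      (u := fun x => |g q.1 x| ^ p) (by have := H.measurable_proj q.1; fun_prop)
    refine h1.integrable_iff.2 ?_
    have h2 := hint q.1
    rw [H.proj_eq] at h2
    exact h2
  · exact mul_nonneg (div_nonneg (Real.sqrt_nonneg _) hs.le)
      (Finset.sum_nonneg fun j _ => by positivity)

end IsKernelSetting

/-! ### Passage between extended nonnegative and real moments. -/

lemma lintegral_enorm_rpow_eq {f : Ω → ℝ} {p : ℝ} (hp : 0 ≤ p)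
    (hf : Integrable (fun ω => |f ω| ^ p) μ) :
    ∫⁻ ω, ‖f ω‖ₑ ^ p ∂μ = ENNReal.ofReal (∫ ω, |f ω| ^ p ∂μ) := by
  rw [ofReal_integral_eq_lintegral_ofReal hf
    (Eventually.of_forall fun ω => Real.rpow_nonneg (abs_nonneg _) _)]
  refine lintegral_congr fun ω => ?_
  rw [Real.enorm_eq_ofReal_abs, ENNReal.ofReal_rpow_of_nonneg (abs_nonneg _) hp]

lemma integrable_abs_rpow_of_lintegral_ne_top {f : Ω → ℝ} (hf : AEStronglyMeasurable f μ) {p : ℝ}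
    (hp : 0 ≤ p) (h : ∫⁻ ω, ‖f ω‖ₑ ^ p ∂μ ≠ ⊤) : Integrable (fun ω => |f ω| ^ p) μ := by
  refine ⟨(hf.aemeasurable.abs.pow_const p).aestronglyMeasurable, ?_⟩
  rw [HasFiniteIntegral]
  refine lt_of_le_of_lt (le_of_eq (lintegral_congr fun ω => ?_)) h.lt_top
  rw [Real.enorm_of_nonneg (Real.rpow_nonneg (abs_nonneg _) _), Real.enorm_eq_ofReal_abs,
    ENNReal.ofReal_rpow_of_nonneg (abs_nonneg _) hp]

end Multisample

end

/-! ### The two bounds for multisample U-statistics. -/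

open Multisample NormalApprox in
theorem theorem3p2 :
    ∃ C : ℝ, 0 < C ∧
      ∀ (Ω : Type*) [MeasurableSpace Ω] (μ : Measure Ω) [IsProbabilityMeasure μ]
        (k : ℕ) (m n : Fin k → ℕ) (h : (∀ j, Fin (m j) → ℝ) → ℝ) (X : Fin k → ℕ → Ω → ℝ),
        (∀ j, 1 ≤ m j) → (∀ j, 2 * m j ≤ n j) →
        Measurable h → Multisample.IsBlockSymmetric m h → Multisample.IsSample μ n X →
        MemLp (Multisample.kernelAt m h X) 2 μ →
        ∫ ω, Multisample.kernelAt m h X ω ∂μ = 0 →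
        (∃ j, 0 < Multisample.sigmaProj μ m h X j) →
        ∀ p : ℝ, 2 < p → p ≤ 3 →
          (⨆ z : ℝ, ENNReal.ofReal (Multisample.normalError μ m n h X z)) ≤
              ENNReal.ofReal ((1 + √2) * Multisample.sigma μ m h X / Multisample.sigmaN μ m n h X *
                ∑ j, (m j : ℝ) ^ 2 / (n j : ℝ)) +
              ENNReal.ofReal (6.6 / Multisample.sigmaN μ m n h X ^ p) *
                Multisample.momentSum μ m n h X p
          ∧ ∀ z : ℝ, ENNReal.ofReal (Multisample.normalError μ m n h X z) ≤
              ENNReal.ofReal (9 * Multisample.sigma μ m h X ^ 2 /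
                  ((1 + |z|) ^ 2 * Multisample.sigmaN μ m n h X ^ 2) *
                (∑ j, (m j : ℝ) ^ 2 / (n j : ℝ)) ^ 2) +
              ENNReal.ofReal (13.5 * Real.exp (-|z| / 3) *
                (Multisample.sigma μ m h X / Multisample.sigmaN μ m n h X) *
                ∑ j, (m j : ℝ) ^ 2 / (n j : ℝ)) +
              ENNReal.ofReal (C / ((1 + |z|) ^ p * Multisample.sigmaN μ m n h X ^ p)) *
                Multisample.momentSum μ m n h X p := by
  refine ⟨10 ^ 9, by norm_num, ?_⟩
  intro Ω _ μ _ k m n h X hm hn hh hsymm hX hL2 h0 hpos p hp hp3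
  obtain ⟨g, hgm, hg⟩ := exists_measurable_proj_eq μ m h X
  have H : IsKernelSetting μ m n h X g :=
    ⟨hm, fun j => by have := hn j; omega, hh, hsymm, hX, hL2, h0, hgm, hg⟩
  have hs := H.sigmaN_pos hpos
  have hsp : 0 < sigmaN μ m n h X ^ p := Real.rpow_pos_of_pos hs p
  have hzp : ∀ z : ℝ, 0 < (1 + |z|) ^ p := fun z => Real.rpow_pos_of_pos (by positivity) p
  -- An infinite moment sum has a positive coefficient in both bounds, so they are trivial.
  -- Otherwise each coefficient in the sum is positive, which forces every single moment to be
  -- finite.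
  by_cases htop : momentSum μ m n h X p = ⊤
  · rw [htop]
    refine ⟨?_, fun z => ?_⟩
    · rw [ENNReal.mul_top (by rw [ne_eq, ENNReal.ofReal_eq_zero, not_le]; positivity), add_top]
      exact le_top
    · have := hzp z
      rw [ENNReal.mul_top (by rw [ne_eq, ENNReal.ofReal_eq_zero, not_le]; positivity), add_top]
      exact le_top
  have hc : ∀ j, 0 < (m j : ℝ) ^ p / (n j : ℝ) ^ (p - 1) := fun j => by
    obtain ⟨h1, h2⟩ := H.natCast_pos j
    positivity
  have hint : ∀ j, Integrable (fun ω => |proj μ m h X j ω| ^ p) μ := fun j => by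
    refine integrable_abs_rpow_of_lintegral_ne_top integrable_condExp.aestronglyMeasurable
      (by linarith) fun h1 => htop ?_
    refine ENNReal.sum_eq_top.2 ⟨j, Finset.mem_univ j, ?_⟩
    rw [show ∫⁻ ω, ‖proj μ m h X j ω‖ₑ ^ p ∂μ = ⊤ from h1, ENNReal.mul_top]
    rw [ne_eq, ENNReal.ofReal_eq_zero, not_le]
    exact hc j
  have hmom : momentSum μ m n h X p = ENNReal.ofReal (sigmaN μ m n h X ^ p *
      absMoment μ (summand μ m n h X g) p) := by
    rw [H.absMoment_summand hpos, momentSum, ENNReal.ofReal_sum_of_nonneg fun j _ =>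
      mul_nonneg (hc j).le (IsMomentFamily.integral_nonneg_rpow _ _)]
    refine Finset.sum_congr rfl fun j _ => ?_
    rw [ENNReal.ofReal_mul (hc j).le, lintegral_enorm_rpow_eq (by linarith) (hint j)]
  have hP := H.isPerturbedSum hpos hp hp3 hint
  have hb := IsMomentFamily.absMoment_nonneg (μ := μ) (summand μ m n h X g) p
  set b := absMoment μ (summand μ m n h X g) p with hbdef
  set M := ∑ j, (m j : ℝ) ^ 2 / (n j : ℝ) with hM
  have ha := hP.nonneg
  set s := sigma μ m h X
  set t := sigmaN μ m n h X with ht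
  have herr : ∀ z, normalError μ m n h X z = |μ.real {ω | ∑ q, summand μ m n h X g q ω +
      remainder μ m n h X g (tuples m n) ω ≤ z} - Phi z| := fun z => by
    simp only [normalError, H.sum_summand_add_remainder]
  rw [hmom]
  refine ⟨iSup_le fun z => ?_, fun z => ?_⟩
  · rw [← ENNReal.ofReal_mul (by positivity), ← ENNReal.ofReal_add ?_ (by positivity), herr]
    · refine ENNReal.ofReal_le_ofReal ((hP.abs_measureReal_sub_Phi_le z).trans ?_)
      have e1 : (1 + √2) * s / t * M = (1 + √2) * (s / t * M) := by ring
      have e2 : 6.6 / t ^ p * (t ^ p * b) = 6.6 * b := by field_simp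
      -- The bound for perturbed sums has the coefficient `2`, which is at most `1 + √2`.
      have e3 : 1 ≤ √2 := Real.one_le_sqrt.2 (by norm_num)
      rw [e1, e2]
      nlinarith
    · have e1 : (1 + √2) * s / t * M = (1 + √2) * (s / t * M) := by ring
      rw [e1]; positivity
  · have hz := hzp z
    have hM0 : 0 ≤ M := Finset.sum_nonneg fun j _ => by positivity
    have hs0 : 0 ≤ s := Real.sqrt_nonneg _
    rw [← ENNReal.ofReal_mul (by positivity), ← ENNReal.ofReal_add (by positivity) (by positivity),
      ← ENNReal.ofReal_add (by positivity) (by positivity), herr]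
    refine ENNReal.ofReal_le_ofReal ((hP.abs_measureReal_sub_Phi_le_tail z).trans (le_of_eq ?_))
    rw [tailBound]
    congr 1
    · congr 1
      · field_simp
      · ring
    · field_simp
      exact hbdef.symm
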